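/- Let $G$ be an amenable group, and let $\mu$ be a $G$-invariant finitely additive probability measure on $G$, i.e. $\mu$ is defined on all subsets of $G$ and $\mu(gA)=\mu(A)=\mu(Ag)$ for all $A\subseteq G$ and $g\in G$. Let $r\in\mathbb{N}$ and let $c:G\to\{1,\dots,r\}$ be any coloring. Then $$\mu\big(\{y:\ \mu(\{x:\ \{x,y,xy,yx\}\text{ is monochromatic}\})>0\}\big)>0.$$ More generally, for every $k\ge 0$ and $x_0,\dots,x_k\in G$ put $$S(x_0,\dots,x_k)=\Big\{x_i x_{i+1}\cdots x_j:\ 0\le i\le j\le k\Big\}\cup\Big\{\Big(\overrightarrow{\prod_{a\in I}}x_a\Big)\, x_0x_1\cdots x_j:\ 0\le j\le k,\ I\subseteq\{j+1,\dots,k\}\Big\},$$ where $\overrightarrow{\prod}_{a\in I}x_a$ is the product of the $x_a$, $a\in I$, written from left to right in increasing order of the index (it equals $1$ if $I=\emptyset$). Then there are many tuples $(x_k,x_{k-1},\dots,x_0)$ for which $S(x_0,\dots,x_k)$ is monochromatic, in the sense that $$\mu\Big(\Big\{x_k:\ \mu\big(\big\{x_{k-1}:\ \cdots\ \mu(\{x_0:\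 S(x_0,\dots,x_k)\text{ is monochromatic}\})>0\ \cdots\big\}\big)>0\Big\}\Big)>0.$$ -/

import Mathlib

open scoped NNReal Pointwise

/-- `μ` is a `G`-invariant finitely additive probability measure defined on all subsets of `G`:
a finitely additive set function on the family of all subsets, with total mass `1` and
`μ (g A) = μ A = μ (A g)`. -/
structure IsInvariantProb {G : Type*} [Group G]
    (μ : MeasureTheory.AddContent ℝ≥0 (Set.univ : Set (Set G))) : Prop where
  univ_eq_one : μ Set.univ = 1
  left_inv : ∀ (g : G) (A : Set G), μ (g • A) = μ A
  right_inv : ∀ (g : G) (A : Set G), μ (MulOpposite.op g • A) = μ A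

/-- There are many tuples `(t 0, …, t (n - 1))` satisfying `P`:
`μ {t 0 | μ {t 1 | … μ {t (n - 1) | P t} > 0 …} > 0} > 0`. -/
def Many {G : Type*} (μ : MeasureTheory.AddContent ℝ≥0 (Set.univ : Set (Set G))) :
    (n : ℕ) → ((Fin n → G) → Prop) → Prop
  | 0, P => P Fin.elim0
  | n + 1, P => 0 < μ {y | Many μ n fun t => P (Fin.cons y t)}

/-- `S` is monochromatic for the coloring `c`. -/
def IsMonochromatic {G κ : Type*} (c : G → κ) (S : Set G) : Prop :=
  ∃ a : κ, ∀ g ∈ S, c g = a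

/-- The product of the `x a`, `a ∈ I`, written from left to right with increasing index. -/
def orderedProd {G : Type*} [Group G] {n : ℕ} (x : Fin n → G) (I : Finset (Fin n)) : G :=
  (I.sort.map x).prod

/-- The set of all `x i ⋯ x j` with `i ≤ j ≤ k`, and of all `(∏_{a ∈ I} x a) · x 0 ⋯ x j` with
`j ≤ k` and `I ⊆ {j + 1, …, k}`. -/
def productPattern {G : Type*} [Group G] {k : ℕ} (x : Fin (k + 1) → G) : Set G :=
  {g | ∃ i j : Fin (k + 1), i ≤ j ∧ g = orderedProd x (Finset.Icc i j)} ∪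
  {g | ∃ (j : Fin (k + 1)) (I : Finset (Fin (k + 1))), I ⊆ Finset.Ioi j ∧
    g = orderedProd x I * orderedProd x (Finset.Iic j)}

/-! Density corners feed a colour-focusing argument. Let `G` act from both sides on a space `Z`,
preserving a mean; the points `z`, `gz`, `zg` form a corner with difference `g`. The core is
`corner_pos`: a set of positive mean contains corners with positive mean, averaged over `g`.
Products of such systems are again such systems, so finitely many sets, one for each colour, have
corners with a common difference (`multi_corner_pos`). For each colour `a` let `d a` be a length for
which the `Rich` tuples of colour `a` have positive mean. If the common difference `g` has colour
`a`, putting `g` in front of the corners of rich tuples gives rich tuples of length `d a + 1`. One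
length can therefore always be increased, and some length must exceed `k`. Rich tuples suffice
because the pattern of `x₀, …, xₖ` is covered by `xₖ` and the patterns of three shorter tuples that
form a corner with difference `xₖ` (`productPattern_subset`).

The corner theorem is an infinitary triangle removal. For `a, b, c ∈ G` consider the points `a z
b⁻¹`, `a z c a⁻¹`, `b c z b⁻¹`. With `w = a z b⁻¹` and `g = b c a⁻¹` they are `w`, `wg`, `gw`, so
triangles of a tripartite graph are corners, and for `a = b = c = 1` the three points coincide. Any
two of the three vertices, with their edge and their neighbourhoods among later vertices, have the
same joint law as the corresponding two vertices of this degenerate triangle. Suppose that triangles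
have measure zero. Conditioning each edge on the neighbourhoods of its ends shows that almost every
`bc` edge lies over a null `ab` cell or a null `ac` cell (`ae_le_ind_add_ind`). Evaluating this at
the degenerate triangle (`sq_integral_le_of_le_add`) bounds the square of the edge density by the
mass of edges in null cells, which vanishes as the cells are refined.

Finitely additive means need not satisfy Fubini, so the array of random vertices is only known to be
invariant under order-preserving changes of time. The exchange of `b` and `c` that is needed in
addition holds because probabilities depend on the triple only through `b c a⁻¹`, and averaging over
`c` or over `b` gives the same mean over `g`. -/

open Filter Topology Function

/-- A real function is bounded. -/
def BddF {X : Type*} (f : X → ℝ) : Prop := ∃ C : ℝ, ∀ x, |f x| ≤ C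

/-! ### Bounded functions. -/

namespace BddF

variable {X Y : Type*} {f g : X → ℝ}

lemma const (c : ℝ) : BddF fun _ : X => c := ⟨|c|, fun _ => le_rfl⟩

lemma add (hf : BddF f) (hg : BddF g) : BddF fun x => f x + g x := by
  obtain ⟨C, hC⟩ := hf
  obtain ⟨D, hD⟩ := hg
  exact ⟨C + D, fun x => (abs_add_le _ _).trans (add_le_add (hC x) (hD x))⟩

lemma mul (hf : BddF f) (hg : BddF g) : BddF fun x => f x * g x := by
  obtain ⟨C, hC⟩ := hf
  obtain ⟨D, hD⟩ := hg
  refine ⟨C * D, fun x => ?_⟩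
  rw [abs_mul]
  exact mul_le_mul (hC x) (hD x) (abs_nonneg _) ((abs_nonneg _).trans (hC x))

lemma smul (c : ℝ) (hf : BddF f) : BddF fun x => c * f x := (const c).mul hf

lemma sum {ι : Type*} (s : Finset ι) {f : ι → X → ℝ} (hf : ∀ i ∈ s, BddF (f i)) :
    BddF fun x => ∑ i ∈ s, f i x := by
  classical
  induction s using Finset.induction_on with
  | empty => simpa using const 0
  | insert a s ha ih =>
    simp only [Finset.sum_insert ha]
    exact (hf a (by simp)).add (ih fun i hi => hf i (by simp [hi]))

lemma comp (hf : BddF f) (g : Y → X) : BddF fun y => f (g y) := by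
  obtain ⟨C, hC⟩ := hf
  exact ⟨C, fun y => hC (g y)⟩

lemma of_mem_Icc (h0 : ∀ x, 0 ≤ f x) (h1 : ∀ x, f x ≤ 1) : BddF f :=
  ⟨1, fun x => abs_le.2 ⟨by linarith [h0 x], h1 x⟩⟩

end BddF

open Classical in
/-- The truth value of a proposition as a real number. -/
noncomputable def ind (p : Prop) : ℝ := if p then 1 else 0

@[simp] lemma ind_true {p : Prop} (h : p) : ind p = 1 := if_pos h
@[simp] lemma ind_false {p : Prop} (h : ¬ p) : ind p = 0 := if_neg h
lemma ind_nonneg (p : Prop) : 0 ≤ ind p := by by_cases h : p <;> simp [h]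
lemma ind_le_one (p : Prop) : ind p ≤ 1 := by by_cases h : p <;> simp [h]
lemma ind_and (p q : Prop) : ind (p ∧ q) = ind p * ind q := by
  by_cases h : p <;> by_cases h' : q <;> simp [h, h']
lemma ind_mono {p q : Prop} (h : p → q) : ind p ≤ ind q := by
  by_cases hp : p
  · simp [hp, h hp]
  · rw [ind_false hp]; exact ind_nonneg q
lemma ind_congr {p q : Prop} (h : p ↔ q) : ind p = ind q := by rw [propext h]
lemma BddF.ind {X : Type*} (p : X → Prop) : BddF fun x => ind (p x) :=
  .of_mem_Icc (fun _ => ind_nonneg _) (fun _ => ind_le_one _)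

/-- A mean on the bounded real functions on `X`. -/
structure FinMean (X : Type*) where
  /-- The value of the mean. -/
  toFun : (X → ℝ) → ℝ
  const' : ∀ c, toFun (fun _ => c) = c
  add' : ∀ {f g}, BddF f → BddF g → toFun (fun x => f x + g x) = toFun f + toFun g
  smul' : ∀ (c : ℝ) {f}, BddF f → toFun (fun x => c * f x) = c * toFun f
  mono' : ∀ {f g}, BddF f → BddF g → (∀ x, f x ≤ g x) → toFun f ≤ toFun g

/-! ### Finitely additive means and their ultralimits. -/

namespace FinMean

variable {X Y : Type*}

instance : CoeFun (FinMean X) fun _ => (X → ℝ) → ℝ := ⟨toFun⟩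

lemma const (m : FinMean X) (c : ℝ) : m (fun _ => c) = c := m.const' c

lemma add (m : FinMean X) {f g : X → ℝ} (hf : BddF f) (hg : BddF g) :
    m (fun x => f x + g x) = m f + m g := m.add' hf hg

lemma smul (m : FinMean X) (c : ℝ) {f : X → ℝ} (hf : BddF f) :
    m (fun x => c * f x) = c * m f := m.smul' c hf

lemma mono (m : FinMean X) {f g : X → ℝ} (hf : BddF f) (hg : BddF g) (h : ∀ x, f x ≤ g x) :
    m f ≤ m g := m.mono' hf hg h

lemma sub (m : FinMean X) {f g : X → ℝ} (hf : BddF f) (hg : BddF g) :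
    m (fun x => f x - g x) = m f - m g := by
  have h := m.add hf (hg.smul (-1))
  rw [m.smul _ hg] at h
  rw [← sub_eq_zero] at h ⊢
  rw [← h]
  have : (fun x => f x - g x) = fun x => f x + -1 * g x := by ext; ring
  rw [this]; ring

lemma sum (m : FinMean X) {ι : Type*} (s : Finset ι) {f : ι → X → ℝ}
    (hf : ∀ i ∈ s, BddF (f i)) : m (fun x => ∑ i ∈ s, f i x) = ∑ i ∈ s, m (f i) := by
  classical
  induction s using Finset.induction_on with
  | empty => simpa using m.const 0
  | insert a s ha ih =>
    have hs : ∀ i ∈ s, BddF (f i) := fun i hi => hf i (by simp [hi])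
    simp only [Finset.sum_insert ha]
    rw [m.add (hf a (by simp)) (.sum s hs), ih hs]

lemma le_of_le (m : FinMean X) {f : X → ℝ} {c : ℝ} (hf : BddF f) (h : ∀ x, f x ≤ c) :
    m f ≤ c := (m.mono hf (.const c) h).trans_eq (m.const c)

lemma le_of_ge (m : FinMean X) {f : X → ℝ} {c : ℝ} (hf : BddF f) (h : ∀ x, c ≤ f x) :
    c ≤ m f := (m.const c).symm.trans_le (m.mono (.const c) hf h)

lemma abs_le (m : FinMean X) {f : X → ℝ} {c : ℝ} (h : ∀ x, |f x| ≤ c) : |m f| ≤ c :=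
  _root_.abs_le.2 ⟨m.le_of_ge ⟨c, h⟩ fun x => (_root_.abs_le.1 (h x)).1,
    m.le_of_le ⟨c, h⟩ fun x => (_root_.abs_le.1 (h x)).2⟩

lemma abs_sub_le (m : FinMean X) {f g : X → ℝ} {c : ℝ} (hf : BddF f) (hg : BddF g)
    (h : ∀ x, |f x - g x| ≤ c) : |m f - m g| ≤ c := by
  rw [← m.sub hf hg]
  exact m.abs_le h

lemma bddF {m : Y → FinMean X} {F : Y → X → ℝ} (h : ∃ C, ∀ y x, |F y x| ≤ C) :
    BddF fun y => m y (F y) := by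
  obtain ⟨C, hC⟩ := h
  exact ⟨C, fun y => (m y).abs_le (hC y)⟩

/-- The composition of a mean with a family of means. -/
def bind (m : FinMean X) (n : X → FinMean Y) : FinMean Y where
  toFun F := m fun x => n x F
  const' c := by simp [const]
  add' hf hg := by
    have : ∀ {f : Y → ℝ}, BddF f → BddF fun x => n x f := fun ⟨C, hC⟩ => bddF ⟨C, fun _ => hC⟩
    simp only [fun x => (n x).add hf hg, m.add (this hf) (this hg)]
  smul' c f hf := by
    have : BddF fun x => n x f := bddF (hf.imp fun C hC _ => hC)
    simp only [fun x => (n x).smul c hf, m.smul c this]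
  mono' hf hg h := by
    have : ∀ {f : Y → ℝ}, BddF f → BddF fun x => n x f := fun ⟨C, hC⟩ => bddF ⟨C, fun _ => hC⟩
    exact m.mono (this hf) (this hg) fun x => (n x).mono hf hg h

/-- The image of a mean. -/
def map (m : FinMean X) (g : X → Y) : FinMean Y where
  toFun F := m fun x => F (g x)
  const' c := m.const c
  add' hf hg := m.add (hf.comp g) (hg.comp g)
  smul' c _ hf := m.smul c (hf.comp g)
  mono' hf hg h := m.mono (hf.comp g) (hg.comp g) fun _ => h _

/-- The point mass. -/
def dirac (x : X) : FinMean X where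
  toFun F := F x
  const' _ := rfl
  add' _ _ := rfl
  smul' _ _ _ := rfl
  mono' _ _ h := h x

lemma exists_tendsto {ι : Type*} (u : Ultrafilter ι) {a : ι → ℝ} {C : ℝ} (h : ∀ i, |a i| ≤ C) :
    ∃ l, Tendsto a u (𝓝 l) := by
  have hc : IsCompact (Set.Icc (-C) C) := isCompact_Icc
  obtain ⟨l, -, hl⟩ := hc.ultrafilter_le_nhds (u.map a)
    (by
      rw [le_principal_iff]
      exact Filter.Eventually.of_forall (f := (u : Filter ι)) fun i => _root_.abs_le.1 (h i))
  exact ⟨l, hl⟩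

lemma tendsto_limUnder {ι : Type*} (u : Ultrafilter ι) {a : ι → ℝ} {C : ℝ}
    (h : ∀ i, |a i| ≤ C) : Tendsto a u (𝓝 (limUnder (u : Filter ι) a)) :=
  tendsto_nhds_limUnder (exists_tendsto u h)

/-- The limit of means along an ultrafilter. -/
noncomputable def ulim {ι : Type*} (u : Ultrafilter ι) (m : ι → FinMean X) : FinMean X where
  toFun F := limUnder (u : Filter ι) fun i => m i F
  const' c := by
    simp only [const]
    exact tendsto_const_nhds.limUnder_eq
  add' := by
    rintro f g ⟨C, hC⟩ ⟨D, hD⟩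
    simp only [fun i => (m i).add ⟨C, hC⟩ ⟨D, hD⟩]
    exact ((tendsto_limUnder u fun i => (m i).abs_le hC).add
      (tendsto_limUnder u fun i => (m i).abs_le hD)).limUnder_eq
  smul' := by
    rintro c f ⟨C, hC⟩
    simp only [fun i => (m i).smul c ⟨C, hC⟩]
    exact ((tendsto_limUnder u fun i => (m i).abs_le hC).const_mul c).limUnder_eq
  mono' := by
    rintro f g ⟨C, hC⟩ ⟨D, hD⟩ h
    exact le_of_tendsto_of_tendsto' (tendsto_limUnder u fun i => (m i).abs_le hC)
      (tendsto_limUnder u fun i => (m i).abs_le hD) fun i => (m i).mono ⟨C, hC⟩ ⟨D, hD⟩ h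

lemma ulim_eq {ι : Type*} {u : Ultrafilter ι} {m : ι → FinMean X} {f : X → ℝ} {l : ℝ}
    (h : ∀ᶠ i in (u : Filter ι), m i f = l) : ulim u m f = l :=
  (tendsto_const_nhds.congr' (h.mono fun _ hi => hi.symm)).limUnder_eq

/-- Means that agree on sets agree on bounded functions. -/
lemma ext_ind {m n : FinMean X} (h : ∀ p : X → Prop, m (fun x => ind (p x)) = n fun x => ind (p x))
    {f : X → ℝ} (hf : BddF f) : m f = n f := by
  refine eq_of_forall_dist_le fun ε hε => ?_
  rw [Real.dist_eq]
  obtain ⟨C, hC⟩ := hf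
  set e := ε / 2 with he
  have e0 : 0 < e := by positivity
  obtain ⟨N, hN⟩ := exists_nat_gt (C / e + 1)
  set s : Finset ℤ := Finset.Icc (-N : ℤ) N
  -- Rounding `f` down to multiples of `e` gives a step function within `e` of `f`. The means agree
  -- on it, and the two errors add up to `ε`.
  set g : X → ℝ := fun x => ∑ v ∈ s, (e * v) * ind (⌊f x / e⌋ = v) with hg
  have gb : ∀ v ∈ s, BddF fun x => (e * v) * ind (⌊f x / e⌋ = v) := fun v _ => (BddF.ind _).smul _
  have gB : BddF g := .sum s gb
  have hgm : m g = n g := by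
    rw [hg, m.sum s gb, n.sum s gb]
    refine Finset.sum_congr rfl fun v _ => ?_
    rw [m.smul _ (BddF.ind _), n.smul _ (BddF.ind _), h]
  have hval : ∀ x, g x = e * ⌊f x / e⌋ := by
    intro x
    have hx := _root_.abs_le.1 (hC x)
    have h1 : f x / e ≤ C / e := by gcongr; exact hx.2
    have h2 : -(C / e) ≤ f x / e := by rw [← neg_div]; gcongr; exact hx.1
    have hmem : ⌊f x / e⌋ ∈ s := by
      rw [Finset.mem_Icc]
      constructor
      · rw [Int.le_floor]; push_cast; linarith
      · have := Int.floor_le (f x / e)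
        have h3 : (⌊f x / e⌋ : ℝ) ≤ N := by linarith
        exact_mod_cast h3
    rw [hg]
    simp only
    rw [Finset.sum_eq_single_of_mem _ hmem]
    · simp
    · intro v _ hv
      rw [ind_false (Ne.symm hv), mul_zero]
  have hfg : ∀ x, |f x - g x| ≤ e := by
    intro x
    rw [hval]
    have h1 := Int.floor_le (f x / e)
    have h2 := Int.lt_floor_add_one (f x / e)
    rw [le_div_iff₀ e0] at h1
    rw [div_lt_iff₀ e0] at h2
    rw [_root_.abs_le]
    constructor <;> nlinarith
  have a1 := m.abs_sub_le ⟨C, hC⟩ gB hfg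
  have a2 := n.abs_sub_le ⟨C, hC⟩ gB hfg
  rw [hgm] at a1
  rw [_root_.abs_le] at *
  constructor <;> linarith

end FinMean

/-! ### Integration against a finitely additive probability measure. -/

section Integral

variable {G : Type*} (μ : MeasureTheory.AddContent ℝ≥0 (Set.univ : Set (Set G)))

lemma isSetRing_univ {G : Type*} : MeasureTheory.IsSetRing (Set.univ : Set (Set G)) where
  empty_mem := trivial
  union_mem _ _ _ _ := trivial
  sdiff_mem _ _ _ _ := trivial

lemma content_mono {A B : Set G} (h : A ⊆ B) : μ A ≤ μ B := by
  rw [← Set.union_sdiff_cancel h, MeasureTheory.addContent_union isSetRing_univ trivial trivial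
    Set.disjoint_sdiff_right]
  exact le_self_add

lemma content_eq_sum_fiber {ι : Type*} (q : G → ι) (A : Set G) (s : Finset ι)
    (h : ∀ x ∈ A, q x ∈ s) : μ A = ∑ i ∈ s, μ (A ∩ q ⁻¹' {i}) := by
  rw [← MeasureTheory.addContent_biUnion_eq isSetRing_univ (m := μ)]
  · congr 1
    ext x
    simpa using h x
  · exact fun _ _ => trivial
  · intro i _ j _ hij
    rw [Function.onFun, Set.disjoint_left]
    rintro x ⟨-, hx⟩ ⟨-, hy⟩
    exact hij (hx.symm.trans hy)

open Classical in
/-- The members of a finite family of sets that contain a given point. -/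
noncomputable def cellOf (F : Finset (Set G)) (x : G) : Finset (Set G) := F.filter (x ∈ ·)

lemma mem_cellOf {F : Finset (Set G)} {x : G} {A : Set G} :
    A ∈ cellOf F x ↔ A ∈ F ∧ x ∈ A := by simp [cellOf]

lemma cellOf_mem {F : Finset (Set G)} {x : G} : cellOf F x ∈ F.powerset := by
  simp [cellOf]

/-- The finite approximations of the integral of a finitely additive measure. -/
noncomputable def integralApprox [Nonempty G] (hμ : μ Set.univ = 1) (F : Finset (Set G)) :
    FinMean G where
  -- The fibres of `cellOf F` are the atoms of the algebra generated by `F`, and `f` is sampled at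
  -- one point of each. Over an empty fibre `invFun` is arbitrary, but the weight is `0`.
  toFun f := ∑ S ∈ F.powerset, (μ (cellOf F ⁻¹' {S}) : ℝ) * f (invFun (cellOf F) S)
  const' c := by
    have := content_eq_sum_fiber μ (cellOf F) Set.univ F.powerset fun _ _ => cellOf_mem
    rw [hμ] at this
    simp only [Set.univ_inter] at this
    rw [← Finset.sum_mul, ← NNReal.coe_sum, ← this]
    simp
  add' _ _ := by rw [← Finset.sum_add_distrib]; simp only [mul_add]
  smul' c f _ := by rw [Finset.mul_sum]; exact Finset.sum_congr rfl fun _ _ => by ring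
  mono' _ _ h := Finset.sum_le_sum fun S _ => mul_le_mul_of_nonneg_left (h _) (NNReal.coe_nonneg _)

/-- A member of `F` is a union of atoms, so sampling one point of each atom is exact on it. Along
growing families every set is eventually measured exactly. -/
lemma integralApprox_ind [Nonempty G] (hμ : μ Set.univ = 1) {F : Finset (Set G)} {A : Set G}
    (hA : A ∈ F) : integralApprox μ hμ F (fun x => ind (x ∈ A)) = μ A := by
  rw [content_eq_sum_fiber μ (cellOf F) A F.powerset fun _ _ => cellOf_mem, NNReal.coe_sum]
  refine Finset.sum_congr rfl fun S _ => ?_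
  have key : ∀ x y : G, cellOf F x = cellOf F y → x ∈ A → y ∈ A := fun x y hxy hx =>
    (mem_cellOf.1 (hxy ▸ mem_cellOf.2 ⟨hA, hx⟩)).2
  by_cases hS : ∃ x : G, cellOf F x = S
  · have h1 := invFun_eq hS
    by_cases hx : invFun (cellOf F) S ∈ A
    · have : A ∩ cellOf F ⁻¹' {S} = cellOf F ⁻¹' {S} :=
        Set.inter_eq_right.2 fun y hy => key _ _ (h1.trans hy.symm) hx
      simp [this, hx]
    · have : A ∩ cellOf F ⁻¹' {S} = ∅ := by
        rw [← Set.disjoint_iff_inter_eq_empty, Set.disjoint_left]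
        exact fun y hyA hy => hx (key _ _ (Eq.trans hy h1.symm) hyA)
      simp [this, hx]
  · have : cellOf F ⁻¹' {S} = ∅ := by
      rw [Set.eq_empty_iff_forall_notMem]
      exact fun y hy => hS ⟨y, hy⟩
    simp [this]

/-- The mean defined by a finitely additive probability measure. -/
noncomputable def contentMean [Nonempty G] (hμ : μ Set.univ = 1) : FinMean G :=
  .ulim (Ultrafilter.of atTop) (integralApprox μ hμ)

lemma contentMean_ind [Nonempty G] (hμ : μ Set.univ = 1) (p : G → Prop) :
    contentMean μ hμ (fun x => ind (p x)) = μ {x | p x} :=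
  FinMean.ulim_eq <| Ultrafilter.of_le atTop <| (eventually_ge_atTop {{x | p x}}).mono
    fun _ hF => integralApprox_ind μ hμ (A := {x | p x}) (Finset.singleton_subset_iff.1 hF)

lemma contentMean_left [Group G] (hμ : IsInvariantProb μ) (g : G) {f : G → ℝ} (hf : BddF f) :
    contentMean μ hμ.univ_eq_one (fun x => f (g * x)) = contentMean μ hμ.univ_eq_one f := by
  refine FinMean.ext_ind (m := (contentMean μ hμ.univ_eq_one).map (g * ·)) (fun p => ?_) hf
  refine (contentMean_ind μ _ fun x => p (g * x)).trans ?_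
  rw [contentMean_ind, ← hμ.left_inv g⁻¹ {x | p x}]
  congr 2
  ext x
  simp [Set.mem_inv_smul_set_iff]

lemma contentMean_right [Group G] (hμ : IsInvariantProb μ) (g : G) {f : G → ℝ} (hf : BddF f) :
    contentMean μ hμ.univ_eq_one (fun x => f (x * g)) = contentMean μ hμ.univ_eq_one f := by
  refine FinMean.ext_ind (m := (contentMean μ hμ.univ_eq_one).map (· * g)) (fun p => ?_) hf
  refine (contentMean_ind μ _ fun x => p (x * g)).trans ?_
  rw [contentMean_ind, ← hμ.right_inv g⁻¹ {x | p x}]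
  congr 2
  ext x
  simp [Set.mem_inv_smul_set_iff]

lemma contentMean_pos [Nonempty G] (hμ : μ Set.univ = 1) {f : G → ℝ} (h0 : ∀ x, 0 ≤ f x)
    (h1 : ∀ x, f x ≤ 1) (hf : 0 < contentMean μ hμ f) : 0 < μ {x | 0 < f x} := by
  rw [← NNReal.coe_pos, ← contentMean_ind μ hμ]
  refine hf.trans_le (FinMean.mono _ (.of_mem_Icc h0 h1) (.ind _) fun x => ?_)
  by_cases hx : 0 < f x
  · simpa [hx] using h1 x
  · rw [ind_false hx]; exact not_lt.1 hx

end Integral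

/-! ### Conditional expectations with values in the unit interval. -/

section CondExp

open MeasureTheory

variable {Ω : Type*} {m m' m₀ : MeasurableSpace Ω}

/-- A random variable with values in the unit interval. -/
structure UnitRV (m : MeasurableSpace Ω) (f : Ω → ℝ) : Prop where
  meas : Measurable[m] f
  nonneg : ∀ ω, 0 ≤ f ω
  le_one : ∀ ω, f ω ≤ 1

namespace UnitRV

variable {f g : Ω → ℝ}

lemma mono (h : UnitRV m f) (hm : m ≤ m') : UnitRV m' f :=
  ⟨h.meas.mono hm le_rfl, h.nonneg, h.le_one⟩

lemma mul (hf : UnitRV m f) (hg : UnitRV m g) : UnitRV m fun ω => f ω * g ω :=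
  ⟨hf.meas.mul hg.meas, fun ω => mul_nonneg (hf.nonneg ω) (hg.nonneg ω),
    fun ω => mul_le_one₀ (hf.le_one ω) (hg.nonneg ω) (hg.le_one ω)⟩

lemma ind {s : Set Ω} (hs : MeasurableSet[m] s) : UnitRV m fun ω => ind (ω ∈ s) := by
  refine ⟨?_, fun _ => ind_nonneg _, fun _ => ind_le_one _⟩
  have : (fun ω => _root_.ind (ω ∈ s)) = s.indicator 1 := by
    ext ω
    by_cases h : ω ∈ s <;> simp [h]
  rw [this]
  exact Measurable.indicator (@measurable_const _ _ _ m _) hs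

lemma integrable {P : Measure Ω} [IsFiniteMeasure P] (hf : UnitRV m₀ f) : Integrable f P :=
  .of_bound hf.meas.aestronglyMeasurable 1
    (ae_of_all _ fun ω => by rw [Real.norm_eq_abs, abs_of_nonneg (hf.nonneg ω)]; exact hf.le_one ω)

end UnitRV

/-- A version of the conditional expectation with values in the unit interval. -/
noncomputable def condE (P : Measure[m₀] Ω) (m : MeasurableSpace Ω) (f : Ω → ℝ) (ω : Ω) : ℝ :=
  max 0 (min 1 ((P[f | m]) ω))

variable {P : Measure[m₀] Ω} {f g : Ω → ℝ}

/-- The truncation makes the bounds hold everywhere, so that products and quotients stay in the unit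
interval without exceptional null sets. -/
lemma condE_unit (f : Ω → ℝ) : UnitRV m (condE P m f) :=
  ⟨measurable_const.max (measurable_const.min stronglyMeasurable_condExp.measurable),
    fun _ => le_max_left _ _, fun _ => max_le zero_le_one (min_le_left _ _)⟩

variable [IsProbabilityMeasure P]

lemma condE_ae_eq (hm : m ≤ m₀) (hf : UnitRV m₀ f) : condE P m f =ᵐ[P] P[f | m] := by
  have h0 : 0 ≤ᵐ[P] P[f | m] := condExp_nonneg (ae_of_all _ hf.nonneg)
  have h1 : P[f | m] ≤ᵐ[P] P[(fun _ => 1 : Ω → ℝ) | m] :=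
    condExp_mono hf.integrable (integrable_const _) (ae_of_all _ hf.le_one)
  rw [condExp_const hm] at h1
  filter_upwards [h0, h1] with ω a b
  simp only [Pi.zero_apply] at a
  rw [condE, min_eq_right b, max_eq_right a]

lemma integral_condE_mul (hm : m ≤ m₀) (hf : UnitRV m₀ f) (hg : UnitRV m g) :
    ∫ ω, condE P m f ω * g ω ∂P = ∫ ω, f ω * g ω ∂P := by
  have h := condExp_mul_of_stronglyMeasurable_right (μ := P) (f := f) hg.meas.stronglyMeasurable
    (hf.mul (hg.mono hm)).integrable hf.integrable
  rw [show ∫ ω, f ω * g ω ∂P = ∫ ω, (f * g) ω ∂P from rfl, ← integral_condExp hm (f := f * g)]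
  refine integral_congr_ae ?_
  filter_upwards [h, condE_ae_eq hm hf] with ω h1 h2
  rw [h1, Pi.mul_apply, h2]

lemma integral_condE (hm : m ≤ m₀) (hf : UnitRV m₀ f) :
    ∫ ω, condE P m f ω ∂P = ∫ ω, f ω ∂P := by
  rw [← integral_condExp hm (f := f)]
  exact integral_congr_ae (condE_ae_eq hm hf)

lemma condE_mono (hm : m ≤ m₀) (hf : UnitRV m₀ f) (hg : UnitRV m₀ g) (h : f ≤ᵐ[P] g) :
    condE P m f ≤ᵐ[P] condE P m g := by
  filter_upwards [condExp_mono (m := m) hf.integrable hg.integrable h, condE_ae_eq hm hf,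
    condE_ae_eq hm hg] with ω h1 h2 h3
  rwa [h2, h3]

lemma eq_condE_of_set (hm : m ≤ m₀) (hf : UnitRV m₀ f) (hg : UnitRV m g)
    (h : ∀ s, MeasurableSet[m] s →
      ∫ ω, g ω * ind (ω ∈ s) ∂P = ∫ ω, f ω * ind (ω ∈ s) ∂P) : g =ᵐ[P] condE P m f := by
  refine (ae_eq_condExp_of_forall_setIntegral_eq hm hf.integrable
    (fun s _ _ => (hg.mono hm).integrable.integrableOn) (fun s hs _ => ?_)
    hg.meas.stronglyMeasurable.aestronglyMeasurable).trans (condE_ae_eq hm hf).symm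
  have key : ∀ φ : Ω → ℝ, ∫ ω in s, φ ω ∂P = ∫ ω, φ ω * ind (ω ∈ s) ∂P := fun φ => by
    rw [← integral_indicator (hm _ hs)]
    refine integral_congr_ae (ae_of_all _ fun ω => ?_)
    by_cases hω : ω ∈ s <;> simp [hω]
  rw [key, key, h s hs]

lemma eq_condE (hm : m ≤ m₀) (hf : UnitRV m₀ f) (hg : UnitRV m g)
    (h : ∀ w, UnitRV m w → ∫ ω, g ω * w ω ∂P = ∫ ω, f ω * w ω ∂P) : g =ᵐ[P] condE P m f :=
  eq_condE_of_set hm hf hg fun _ hs => h _ (.ind hs)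

/-- If `f` and `m'` are conditionally independent over `m`, expectations of products factor. -/
lemma condE_mul_of_condE_eq (hmm' : m ≤ m') (hm' : m' ≤ m₀) (hf : UnitRV m₀ f)
    (hg : UnitRV m' g) (h : condE P m' f =ᵐ[P] condE P m f) :
    condE P m (fun ω => f ω * g ω) =ᵐ[P] fun ω => condE P m f ω * condE P m g ω := by
  have hm := hmm'.trans hm'
  refine (eq_condE hm (hf.mul (hg.mono hm')) ((condE_unit f).mul (condE_unit g))
    fun w hw => ?_).symm
  calc ∫ ω, condE P m f ω * condE P m g ω * w ω ∂P
      = ∫ ω, condE P m g ω * (condE P m f ω * w ω) ∂P := by congr 1; ext ω; ring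
    _ = ∫ ω, g ω * (condE P m f ω * w ω) ∂P :=
      integral_condE_mul hm (hg.mono hm') ((condE_unit f).mul hw)
    _ = ∫ ω, condE P m' f ω * (g ω * w ω) ∂P := by
      refine integral_congr_ae ?_
      filter_upwards [h] with ω hω
      rw [hω]; ring
    _ = ∫ ω, f ω * (g ω * w ω) ∂P := integral_condE_mul hm' hf (hg.mul (hw.mono hmm'))
    _ = _ := by congr 1; ext ω; ring

/-- The integral of `(f - g) ^ 2` is `c - 2 * c + c = 0`. -/
lemma ae_eq_of_integral_mul_eq {c : ℝ} (hf : UnitRV m₀ f) (hg : UnitRV m₀ g)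
    (h1 : ∫ ω, f ω * f ω ∂P = c) (h2 : ∫ ω, f ω * g ω ∂P = c) (h3 : ∫ ω, g ω * g ω ∂P = c) :
    f =ᵐ[P] g := by
  have i1 := (hf.mul hf).integrable (P := P)
  have i2 := (hf.mul hg).integrable (P := P)
  have i3 := (hg.mul hg).integrable (P := P)
  have hs : ∫ ω, (f ω - g ω) ^ 2 ∂P = 0 := by
    have : ∀ ω, (f ω - g ω) ^ 2 = f ω * f ω - 2 * (f ω * g ω) + g ω * g ω := fun ω => by ring
    simp only [this]
    have e1 := integral_add (i1.sub (i2.const_mul 2)) i3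
    have e2 := integral_sub i1 (i2.const_mul 2)
    simp only [Pi.sub_apply] at e1
    rw [e1, e2, integral_const_mul, h1, h2, h3]
    ring
  have hi : Integrable (fun ω => (f ω - g ω) ^ 2) P := by
    have : (fun ω => (f ω - g ω) ^ 2) = fun ω => f ω * f ω - 2 * (f ω * g ω) + g ω * g ω := by
      ext ω; ring
    rw [this]
    exact (i1.sub (i2.const_mul 2)).add i3
  rw [integral_eq_zero_iff_of_nonneg (fun ω => sq_nonneg _) hi] at hs
  filter_upwards [hs] with ω hω
  have : f ω - g ω = 0 := by simpa using hω
  linarith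

/-- A sub-`σ`-algebra of `σ(U)` containing a copy `σ(U')` of `σ(U)` with the same joint law with `f`
carries all the information of `σ(U)` on `f`. -/
lemma condE_eq_of_law {E : Type*} [mE : MeasurableSpace E] {U U' : Ω → E} (hf : UnitRV m₀ f)
    (hU : Measurable U) (hU' : Measurable U')
    (hlaw : P.map (fun ω => (f ω, U ω)) = P.map fun ω => (f ω, U' ω))
    (h1 : mE.comap U' ≤ m) (h2 : m ≤ mE.comap U) :
    condE P (mE.comap U) f =ᵐ[P] condE P m f := by
  have hUm : mE.comap U ≤ m₀ := hU.comap_le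
  have hm := h2.trans hUm
  obtain ⟨h₁, hh₁, hA₁⟩ := (condE_unit (P := P) (m := mE.comap U) f).meas.exists_eq_measurable_comp
  -- The conditional expectation on `σ(U)` is `h (U)`, and truncation keeps `h (U')` in the unit
  -- interval as well. Equality of laws makes the integrals of `h (U) ^ 2`, `h (U) * h (U')` and `h
  -- (U') ^ 2` agree. Hence `h (U) = h (U')` almost everywhere, and the latter is `m`-measurable.
  set h : E → ℝ := fun x => max 0 (min 1 (h₁ x))
  have hh : Measurable h := measurable_const.max (measurable_const.min hh₁)
  have hA : condE P (mE.comap U) f = fun ω => h (U ω) := by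
    ext ω
    have h2 := congrFun hA₁ ω
    have h3 := (condE_unit (P := P) (m := mE.comap U) f).nonneg ω
    have h4 := (condE_unit (P := P) (m := mE.comap U) f).le_one ω
    simp only [Function.comp] at h2
    rw [h2] at h3 h4 ⊢
    simp only [h]
    rw [min_eq_right h4, max_eq_right h3]
  have hu : ∀ {V : Ω → E} {n : MeasurableSpace Ω}, Measurable[n] V → UnitRV n fun ω => h (V ω) :=
    fun hV => ⟨hh.comp hV, fun _ => le_max_left _ _, fun _ => max_le zero_le_one (min_le_left _ _)⟩
  have uU : UnitRV (mE.comap U) fun ω => h (U ω) := hu (comap_measurable U)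
  have uU' : UnitRV m fun ω => h (U' ω) := hu ((comap_measurable U').mono h1 le_rfl)
  have tr : ∀ φ : ℝ × E → ℝ, Measurable φ → ∫ ω, φ (f ω, U ω) ∂P = ∫ ω, φ (f ω, U' ω) ∂P := by
    intro φ hφ
    rw [← integral_map (f := φ) (hf.meas.prodMk hU).aemeasurable hφ.aestronglyMeasurable, hlaw,
      integral_map (hf.meas.prodMk hU').aemeasurable hφ.aestronglyMeasurable]
  have e1 : ∫ ω, h (U ω) * h (U ω) ∂P = ∫ ω, f ω * h (U ω) ∂P := by
    have := integral_condE_mul (P := P) hUm hf uU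
    rwa [hA] at this
  have e2 : ∫ ω, h (U ω) * h (U' ω) ∂P = ∫ ω, f ω * h (U ω) ∂P := by
    have := integral_condE_mul (P := P) hUm hf (uU'.mono h2)
    rw [hA] at this
    rw [this]
    exact (tr (fun p => p.1 * h p.2) (measurable_fst.mul (hh.comp measurable_snd))).symm
  have e3 : ∫ ω, h (U' ω) * h (U' ω) ∂P = ∫ ω, f ω * h (U ω) ∂P := by
    rw [← e1]
    exact (tr (fun p => h p.2 * h p.2) ((hh.comp measurable_snd).mul (hh.comp measurable_snd))).symm
  have hAB := ae_eq_of_integral_mul_eq (uU.mono hUm) (uU'.mono hm) e1 e2 e3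
  rw [hA]
  refine hAB.trans (eq_condE hm hf uU' fun w hw => ?_)
  rw [← integral_condE_mul hUm hf (hw.mono h2), hA]
  refine integral_congr_ae ?_
  filter_upwards [hAB] with ω hω
  rw [hω]

/-- A truncated quotient. -/
noncomputable def unitQuot (a b : ℝ) : ℝ := max 0 (min 1 (a / b))

/-- Division by zero is harmless, since `b = 0` forces `a = 0`. -/
lemma unitQuot_mul {a b : ℝ} (h0 : 0 ≤ a) (h : a ≤ b) : unitQuot a b * b = a := by
  rcases (h0.trans h).eq_or_lt with hb | hb
  · rw [← hb] at h ⊢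
    rw [mul_zero, le_antisymm h h0]
  · rw [unitQuot, min_eq_right ((div_le_one hb).2 h), max_eq_right (by positivity),
      div_mul_cancel₀ _ hb.ne']

lemma UnitRV.unitQuot (hf : UnitRV m f) (hg : UnitRV m g) :
    UnitRV m fun ω => unitQuot (f ω) (g ω) :=
  ⟨measurable_const.max (measurable_const.min (hf.meas.div hg.meas)), fun _ => le_max_left _ _,
    fun _ => max_le zero_le_one (min_le_left _ _)⟩

/-- The sets of this form are a `σ`-algebra, because complements and countable unions act on `h`
pointwise. It contains `m` (constant `h`) and `σ(τ)` (each `h i` empty or everything). -/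
lemma exists_of_measurableSet_sup {ι : Type*} [mι : MeasurableSpace ι] {τ : Ω → ι} {s : Set Ω}
    (hs : MeasurableSet[m ⊔ mι.comap τ] s) :
    ∃ h : ι → Set Ω, (∀ i, MeasurableSet[m] (h i)) ∧ s = {ω | ω ∈ h (τ ω)} := by
  let n : MeasurableSpace Ω :=
    { MeasurableSet' := fun s => ∃ h : ι → Set Ω, (∀ i, MeasurableSet[m] (h i)) ∧
        s = {ω | ω ∈ h (τ ω)}
      measurableSet_empty := ⟨fun _ => ∅, fun _ => @MeasurableSet.empty _ m, rfl⟩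
      measurableSet_compl := by
        rintro _ ⟨h, hh, rfl⟩
        exact ⟨fun i => (h i)ᶜ, fun i => (hh i).compl, rfl⟩
      measurableSet_iUnion := by
        intro F hF
        choose h hh hs using hF
        refine ⟨fun i => ⋃ k, h k i, fun i => .iUnion fun k => hh k i, ?_⟩
        ext ω
        simp [hs] }
  have hle : m ⊔ mι.comap τ ≤ n := by
    refine sup_le (fun s hs => ⟨fun _ => s, fun _ => hs, rfl⟩) ?_
    rintro _ ⟨t, -, rfl⟩
    classical
    refine ⟨fun i => if i ∈ t then Set.univ else ∅, fun i => ?_, ?_⟩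
    · dsimp only
      split_ifs
      · exact @MeasurableSet.univ _ m
      · exact @MeasurableSet.empty _ m
    · ext ω
      by_cases h : τ ω ∈ t <;> simp [h]
  exact hle s hs

lemma sum_ind_eq_mul {ι : Type*} [Fintype ι] (i : ι) (g : ι → ℝ) :
    ∑ j, ind (i = j) * g j = g i := by
  classical
  rw [Finset.sum_eq_single_of_mem i (Finset.mem_univ _)]
  · simp
  · intro j _ hj
    rw [ind_false hj.symm, zero_mul]

lemma UnitRV.ind_eq {ι : Type*} [MeasurableSpace ι] [MeasurableSingletonClass ι] {τ : Ω → ι}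
    (hτ : Measurable[m] τ) (i : ι) : UnitRV m fun ω => _root_.ind (τ ω = i) :=
  .ind (s := τ ⁻¹' {i}) (hτ (measurableSet_singleton i))

/-- The conditional expectation on `m ⊔ σ(τ)` for a random variable `τ` with finitely many
values. -/
lemma condE_sup_comap {ι : Type*} [Fintype ι] [mι : MeasurableSpace ι]
    [MeasurableSingletonClass ι] {τ : Ω → ι} (hτ : Measurable τ) (hm : m ≤ m₀) (hf : UnitRV m₀ f) :
    (fun ω => ∑ i, ind (τ ω = i) * unitQuot (condE P m (fun ω => ind (τ ω = i) * f ω) ω)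
      (condE P m (fun ω => ind (τ ω = i)) ω)) =ᵐ[P] condE P (m ⊔ mι.comap τ) f := by
  have hmτ : m ⊔ mι.comap τ ≤ m₀ := sup_le hm hτ.comap_le
  have u1 : ∀ i, UnitRV m₀ fun ω => ind (τ ω = i) := fun i => .ind_eq hτ i
  set R : ι → Ω → ℝ := fun i ω => unitQuot (condE P m (fun ω => ind (τ ω = i) * f ω) ω)
      (condE P m (fun ω => ind (τ ω = i)) ω) with hR
  have uR : ∀ i, UnitRV m (R i) := fun i => (condE_unit _).unitQuot (condE_unit _)
  have hu : UnitRV (m ⊔ mι.comap τ) fun ω => ∑ i, ind (τ ω = i) * R i ω := by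
    refine ⟨Finset.measurable_fun_sum _ fun i _ => ?_, fun ω => ?_, fun ω => ?_⟩
    · have h1 : UnitRV (mι.comap τ) fun ω => ind (τ ω = i) := .ind_eq (comap_measurable τ) i
      exact ((h1.mono le_sup_right).mul ((uR i).mono le_sup_left)).meas
    · exact Finset.sum_nonneg fun i _ => mul_nonneg (ind_nonneg _) ((uR i).nonneg ω)
    · rw [sum_ind_eq_mul (τ ω) (fun i => R i ω)]
      exact (uR _).le_one ω
  refine eq_condE_of_set hmτ hf hu fun s hs => ?_
  change ∫ ω, (∑ i, ind (τ ω = i) * R i ω) * _ ∂P = _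
  -- Where `τ = i`, the test set coincides with the `m`-measurable set `h i`; the identity therefore
  -- splits into one for each `i`, with `m`-measurable test functions.
  obtain ⟨h, hh, rfl⟩ := exists_of_measurableSet_sup hs
  have uh : ∀ i, UnitRV m fun ω => ind (ω ∈ h i) := fun i => .ind (hh i)
  have l1 : ∀ ω, (∑ i, ind (τ ω = i) * R i ω) * ind (ω ∈ {ω | ω ∈ h (τ ω)}) =
      ∑ i, ind (τ ω = i) * (R i ω * ind (ω ∈ h i)) := fun ω => by
    rw [sum_ind_eq_mul (τ ω) (fun i => R i ω), sum_ind_eq_mul (τ ω) fun i => R i ω * ind (ω ∈ h i)]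
    rfl
  have l2 : ∀ ω, f ω * ind (ω ∈ {ω | ω ∈ h (τ ω)}) =
      ∑ i, ind (τ ω = i) * f ω * ind (ω ∈ h i) := fun ω => by
    simp only [mul_assoc]
    rw [sum_ind_eq_mul (τ ω) fun i => f ω * ind (ω ∈ h i)]
    rfl
  simp only [l1, l2]
  rw [integral_finsetSum _ fun i _ => ((u1 i).mul (((uR i).mul (uh i)).mono hm)).integrable,
    integral_finsetSum _ fun i _ => (((u1 i).mul hf).mul ((uh i).mono hm)).integrable]
  refine Finset.sum_congr rfl fun i _ => ?_
  rw [← integral_condE_mul hm (u1 i) ((uR i).mul (uh i)),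
    ← integral_condE_mul hm ((u1 i).mul hf) (uh i)]
  refine integral_congr_ae ?_
  have hle := condE_mono (P := P) hm ((u1 i).mul hf) (u1 i) (ae_of_all _ fun ω =>
    mul_le_of_le_one_right (ind_nonneg _) (hf.le_one ω))
  filter_upwards [hle] with ω hω
  have := unitQuot_mul ((condE_unit (P := P) (m := m) _).nonneg ω) hω
  simp only [hR]
  linear_combination (ind (ω ∈ h i)) * this

end CondExp

set_option linter.unusedSectionVars false

/-! ### The counting inequality for three conditionally independent cells. -/

section CondExp

open MeasureTheory

variable {Ω : Type*} {m m₀ : MeasurableSpace Ω} {P : Measure[m₀] Ω} [IsProbabilityMeasure P]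

/-- The relative density of the cells of a pair of finite-valued random variables. -/
noncomputable def cellQuot {ι : Type*} (P : Measure[m₀] Ω) (m : MeasurableSpace Ω)
    (A B : Ω → ι) (N : Ω → ℝ) (i j : ι) (ω : Ω) : ℝ :=
  unitQuot (condE P m (fun ω => ind (A ω = i) * ind (B ω = j) * N ω) ω)
    (condE P m (fun ω => ind (A ω = i)) ω * condE P m (fun ω => ind (B ω = j)) ω)

variable {ι : Type*} [Fintype ι] [MeasurableSpace ι] [MeasurableSingletonClass ι]
  {A B C A' B' C' : Ω → ι} {e f N N' : Ω → ℝ}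

lemma cellQuot_unit (i j : ι) : UnitRV m (cellQuot P m A B N i j) :=
  (condE_unit _).unitQuot ((condE_unit _).mul (condE_unit _))

/-- The numerator is at most the conditional probability of the cell `(i, j)`, which factors by
`hAB`. So the truncation has no effect wherever the denominator is nonzero. -/
lemma cellQuot_mul (hm : m ≤ m₀) (hA : Measurable A) (hB : Measurable B) (hN : UnitRV m₀ N)
    (hAB : ∀ i j, condE P m (fun ω => ind (A ω = i) * ind (B ω = j)) =ᵐ[P] fun ω =>
      condE P m (fun ω => ind (A ω = i)) ω * condE P m (fun ω => ind (B ω = j)) ω) (i j : ι) :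
    ∀ᵐ ω ∂P, cellQuot P m A B N i j ω *
      (condE P m (fun ω => ind (A ω = i)) ω * condE P m (fun ω => ind (B ω = j)) ω) =
      condE P m (fun ω => ind (A ω = i) * ind (B ω = j) * N ω) ω := by
  have u := (UnitRV.ind_eq hA i).mul (.ind_eq hB j)
  filter_upwards [hAB i j, condE_mono (P := P) hm (u.mul hN) u (ae_of_all _ fun ω =>
    mul_le_of_le_one_right (u.nonneg ω) (hN.le_one ω))] with ω h1 h2
  rw [h1] at h2
  exact unitQuot_mul ((condE_unit _).nonneg ω) h2

/-- Evaluating the relative density of cells at an independent point. -/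
lemma sum_integral_cellQuot (hm : m ≤ m₀) (hA : Measurable A) (hB : Measurable B)
    (he : UnitRV m₀ e)
    (hAB : ∀ i j, condE P m (fun ω => ind (A ω = i) * ind (B ω = j)) =ᵐ[P] fun ω =>
      condE P m (fun ω => ind (A ω = i)) ω * condE P m (fun ω => ind (B ω = j)) ω)
    (hlaw : ∀ i j g, UnitRV m g → ∫ ω, f ω * ind (A' ω = i) * ind (B' ω = j) * g ω ∂P =
      ∫ ω, e ω * ind (A ω = i) * ind (B ω = j) * g ω ∂P) (i j : ι) :
    ∫ ω, f ω * ind (A' ω = i) * ind (B' ω = j) * cellQuot P m A B N i j ω ∂P =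
      ∫ ω, cellQuot P m A B e i j ω * cellQuot P m A B N i j ω *
        (condE P m (fun ω => ind (A ω = i)) ω * condE P m (fun ω => ind (B ω = j)) ω) ∂P := by
  rw [hlaw i j _ (cellQuot_unit i j)]
  have u := ((UnitRV.ind_eq hA i).mul (.ind_eq hB j)).mul he
  calc _ = ∫ ω, ind (A ω = i) * ind (B ω = j) * e ω * cellQuot P m A B N i j ω ∂P := by
        congr 1; ext ω; ring
    _ = ∫ ω, condE P m (fun ω => ind (A ω = i) * ind (B ω = j) * e ω) ω *
          cellQuot P m A B N i j ω ∂P := (integral_condE_mul hm u (cellQuot_unit i j)).symm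
    _ = _ := by
        refine integral_congr_ae ?_
        filter_upwards [cellQuot_mul hm hA hB he hAB i j] with ω hω
        rw [← hω]; ring

/-- On the cell `(i, j)` the quotient of `e` is the conditional expectation of `e` given `m` and
both cells, by `condE_sup_comap`: conditional independence turns the denominator there into the
product. -/
lemma integral_sum_cellQuot (hm : m ≤ m₀) (hA : Measurable A) (hB : Measurable B)
    (hN : UnitRV m₀ N) (he : UnitRV m₀ e)
    (hAB : ∀ i j, condE P m (fun ω => ind (A ω = i) * ind (B ω = j)) =ᵐ[P] fun ω =>
      condE P m (fun ω => ind (A ω = i)) ω * condE P m (fun ω => ind (B ω = j)) ω) :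
    ∑ i, ∑ j, ∫ ω, cellQuot P m A B e i j ω * cellQuot P m A B N i j ω *
        (condE P m (fun ω => ind (A ω = i)) ω * condE P m (fun ω => ind (B ω = j)) ω) ∂P =
      ∫ ω, condE P (m ⊔ MeasurableSpace.comap (fun ω => (A ω, B ω)) inferInstance) e ω * N ω ∂P := by
  have hτ : Measurable fun ω => (A ω, B ω) := hA.prodMk hB
  have ipair : ∀ (i j : ι) ω, ind ((A ω, B ω) = (i, j)) = ind (A ω = i) * ind (B ω = j) := by
    intro i j ω
    rw [← ind_and]
    exact ind_congr Prod.mk_inj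
  have key := condE_sup_comap (P := P) hτ hm he
  have uN := fun i j => ((UnitRV.ind_eq hA i).mul (.ind_eq hB j)).mul hN
  calc _ = ∑ i, ∑ j, ∫ ω, ind (A ω = i) * ind (B ω = j) * N ω * cellQuot P m A B e i j ω ∂P := by
        refine Finset.sum_congr rfl fun i _ => Finset.sum_congr rfl fun j _ => ?_
        rw [← integral_condE_mul hm (uN i j) (cellQuot_unit i j)]
        refine integral_congr_ae ?_
        filter_upwards [cellQuot_mul hm hA hB hN hAB i j] with ω hω
        rw [← hω]; ring
    _ = ∫ ω, ∑ p : ι × ι, ind (A ω = p.1) * ind (B ω = p.2) * N ω *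
          cellQuot P m A B e p.1 p.2 ω ∂P := by
        rw [integral_finsetSum _ fun p _ => ((uN _ _).mul ((cellQuot_unit _ _).mono hm)).integrable,
          Fintype.sum_prod_type]
    _ = _ := by
        have hall : ∀ i j, ∀ᵐ ω ∂P, condE P m (fun ω => ind (A ω = i) * ind (B ω = j)) ω =
          condE P m (fun ω => ind (A ω = i)) ω * condE P m (fun ω => ind (B ω = j)) ω := hAB
        simp only [← ae_all_iff] at hall
        refine integral_congr_ae ?_
        filter_upwards [key, hall] with ω hω hall
        rw [← hω, Finset.sum_mul]
        refine Finset.sum_congr rfl fun p _ => ?_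
        obtain ⟨i, j⟩ := p
        simp only [ipair, cellQuot, hall]
        ring

lemma sum_sum_ind_mul (i j : ι) (g : ι → ι → ℝ) (c : ℝ) :
    ∑ i', ∑ j', c * ind (i = i') * ind (j = j') * g i' j' = c * g i j := by
  have : ∀ i', ∑ j', c * ind (i = i') * ind (j = j') * g i' j' = ind (i = i') * (c * g i' j) := by
    intro i'
    rw [← sum_ind_eq_mul j fun j' => ind (i = i') * (c * g i' j')]
    exact Finset.sum_congr rfl fun _ _ => by ring
  simp only [this]
  exact sum_ind_eq_mul i fun i' => c * g i' j

lemma sum_integral_at (hA : Measurable A) (hB : Measurable B) (hf : UnitRV m₀ f)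
    {g : ι → ι → Ω → ℝ} (hg : ∀ i j, UnitRV m₀ (g i j)) :
    ∑ i, ∑ j, ∫ ω, f ω * ind (A ω = i) * ind (B ω = j) * g i j ω ∂P =
      ∫ ω, f ω * g (A ω) (B ω) ω ∂P := by
  have u := fun i j => ((hf.mul (.ind_eq hA i)).mul (.ind_eq hB j)).mul (hg i j)
  simp only [← fun ω => sum_sum_ind_mul (A ω) (B ω) (fun i j => g i j ω) (f ω)]
  rw [integral_finsetSum _ fun i _ => integrable_finsetSum _ fun j _ => (u i j).integrable]
  refine Finset.sum_congr rfl fun i _ => ?_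
  rw [integral_finsetSum _ fun j _ => (u i j).integrable]

lemma unitRV_at (hA : Measurable A) (hB : Measurable B)
    {g : ι → ι → Ω → ℝ} (hg : ∀ i j, UnitRV m₀ (g i j)) : UnitRV m₀ fun ω => g (A ω) (B ω) ω := by
  refine ⟨?_, fun ω => (hg _ _).nonneg ω, fun ω => (hg _ _).le_one ω⟩
  have : (fun ω => g (A ω) (B ω) ω) = fun ω =>
      ∑ i, ∑ j, 1 * ind (A ω = i) * ind (B ω = j) * g i j ω := by
    ext ω
    rw [sum_sum_ind_mul, one_mul]
  rw [this]
  simp only [one_mul]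
  exact Finset.measurable_fun_sum _ fun i _ => Finset.measurable_fun_sum _ fun j _ =>
    (((UnitRV.ind_eq hA i).mul (.ind_eq hB j)).mul (hg i j)).meas

/-- `A` almost surely avoids values of conditional probability zero. The law of `A'` weighted by `f`
is that of `A` weighted by `e`, so `A'` avoids them where `f ≠ 0`. This allows the denominators to
be cancelled at the degenerate point. -/
lemma condE_pos_at (hm : m ≤ m₀) (hA : Measurable A) (hB : Measurable B) (hA' : Measurable A')
    (hB' : Measurable B') (he : UnitRV m₀ e) (hf : UnitRV m₀ f)
    (hlaw : ∀ i j g, UnitRV m g → ∫ ω, f ω * ind (A' ω = i) * ind (B' ω = j) * g ω ∂P =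
      ∫ ω, e ω * ind (A ω = i) * ind (B ω = j) * g ω ∂P) :
    ∀ᵐ ω ∂P, f ω ≠ 0 → 0 < condE P m (fun ω' => ind (A ω' = A' ω)) ω := by
  have key : ∀ i j, ∀ᵐ ω ∂P, f ω * ind (A' ω = i) * ind (B' ω = j) *
      ind (condE P m (fun ω => ind (A ω = i)) ω = 0) = 0 := by
    intro i j
    have u0 : UnitRV m fun ω => ind (condE P m (fun ω => ind (A ω = i)) ω = 0) :=
      .ind (s := {ω | condE P m (fun ω => ind (A ω = i)) ω = 0})
        ((condE_unit _).meas (measurableSet_singleton 0))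
    have u1 := ((hf.mul (.ind_eq hA' i)).mul (.ind_eq hB' j)).mul (u0.mono hm)
    have u2 := ((he.mul (.ind_eq hA i)).mul (.ind_eq hB j)).mul (u0.mono hm)
    have h0 : ∫ ω, ind (A ω = i) * ind (condE P m (fun ω => ind (A ω = i)) ω = 0) ∂P = 0 := by
      rw [← integral_condE_mul hm (.ind_eq hA i) u0, ← integral_zero Ω ℝ (μ := P)]
      refine integral_congr_ae (ae_of_all _ fun ω => ?_)
      by_cases h : condE P m (fun ω => ind (A ω = i)) ω = 0 <;> simp [h]
    have h1 : ∫ ω, e ω * ind (A ω = i) * ind (B ω = j) *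
        ind (condE P m (fun ω => ind (A ω = i)) ω = 0) ∂P = 0 := by
      refine le_antisymm ((integral_mono u2.integrable
        ((UnitRV.ind_eq hA i).mul (u0.mono hm)).integrable fun ω => ?_).trans_eq h0)
        (integral_nonneg u2.nonneg)
      refine mul_le_mul_of_nonneg_right ?_ (ind_nonneg _)
      calc _ ≤ 1 * ind (A ω = i) * 1 := by
            gcongr
            · exact ind_nonneg _
            · exact mul_nonneg zero_le_one (ind_nonneg _)
            · exact ind_nonneg _
            · exact he.le_one ω
            · exact ind_le_one _
        _ = _ := by ring
    rw [← hlaw i j _ u0, integral_eq_zero_iff_of_nonneg u1.nonneg u1.integrable] at h1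
    exact h1
  simp only [← ae_all_iff] at key
  filter_upwards [key] with ω h hf
  refine ((condE_unit _).nonneg ω).lt_of_ne' fun h0 => hf ?_
  have := h (A' ω) (B' ω)
  simpa [h0] using this

/-- Cauchy–Schwarz, by integrating `(q - δ) ^ 2 ≥ 0` against the product weights, where `q` is the
density and `δ` the integral of `e`. The weights have total mass `1` and `q` has mean `δ` for them.
-/
lemma sq_le_sum_cellQuot (hm : m ≤ m₀) (hA : Measurable A) (hB : Measurable B) (he : UnitRV m₀ e)
    (hAB : ∀ i j, condE P m (fun ω => ind (A ω = i) * ind (B ω = j)) =ᵐ[P] fun ω =>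
      condE P m (fun ω => ind (A ω = i)) ω * condE P m (fun ω => ind (B ω = j)) ω) :
    (∫ ω, e ω ∂P) ^ 2 ≤ ∑ i, ∑ j, ∫ ω, cellQuot P m A B e i j ω * cellQuot P m A B e i j ω *
        (condE P m (fun ω => ind (A ω = i)) ω * condE P m (fun ω => ind (B ω = j)) ω) ∂P := by
  have hδ := sum_integral_at (P := P) hA hB he (g := fun _ _ _ => 1)
    fun _ _ => ⟨measurable_const, fun _ => zero_le_one, fun _ => le_rfl⟩
  have h1 := sum_integral_at (P := P) (f := fun _ => 1) hA hB
    ⟨measurable_const, fun _ => zero_le_one, fun _ => le_rfl⟩ (g := fun _ _ _ => 1)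
    fun _ _ => ⟨measurable_const, fun _ => zero_le_one, fun _ => le_rfl⟩
  simp only [mul_one, one_mul, integral_const, probReal_univ, smul_eq_mul] at hδ h1
  generalize ∫ ω, e ω ∂P = δ at hδ ⊢
  have key : ∀ i j, 2 * δ * ∫ ω, e ω * ind (A ω = i) * ind (B ω = j) ∂P -
      δ ^ 2 * ∫ ω, ind (A ω = i) * ind (B ω = j) ∂P ≤
      ∫ ω, cellQuot P m A B e i j ω * cellQuot P m A B e i j ω *
        (condE P m (fun ω => ind (A ω = i)) ω * condE P m (fun ω => ind (B ω = j)) ω) ∂P := by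
    intro i j
    have uab : UnitRV m₀ fun ω => ind (A ω = i) * ind (B ω = j) :=
      (UnitRV.ind_eq hA i).mul (.ind_eq hB j)
    have ue := uab.mul he
    have e1 : ∫ ω, e ω * ind (A ω = i) * ind (B ω = j) ∂P =
        ∫ ω, condE P m (fun ω => ind (A ω = i) * ind (B ω = j) * e ω) ω ∂P := by
      rw [integral_condE hm ue]
      congr 1; ext ω; ring
    rw [e1, ← integral_condE hm uab, ← integral_const_mul, ← integral_const_mul,
      ← integral_sub (((condE_unit _).mono hm).integrable.const_mul _)
        (((condE_unit _).mono hm).integrable.const_mul _)]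
    refine integral_mono_ae ((((condE_unit _).mono hm).integrable.const_mul _).sub
      (((condE_unit _).mono hm).integrable.const_mul _))
      ((((cellQuot_unit i j).mul (cellQuot_unit i j)).mul
        ((condE_unit _).mul (condE_unit _))).mono hm).integrable ?_
    filter_upwards [cellQuot_mul hm hA hB he hAB i j, hAB i j] with ω h1 h2
    rw [← h1, h2]
    have := mul_nonneg (sq_nonneg (cellQuot P m A B e i j ω - δ))
      (((condE_unit (P := P) (m := m) fun ω => ind (A ω = i)).mul
        (condE_unit (P := P) (m := m) fun ω => ind (B ω = j))).nonneg ω)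
    linarith
  calc δ ^ 2 = ∑ i, ∑ j, (2 * δ * ∫ ω, e ω * ind (A ω = i) * ind (B ω = j) ∂P -
      δ ^ 2 * ∫ ω, ind (A ω = i) * ind (B ω = j) ∂P) := by
        simp only [Finset.sum_sub_distrib, ← Finset.mul_sum, hδ, h1]
        ring
    _ ≤ _ := Finset.sum_le_sum fun i _ => Finset.sum_le_sum fun j _ => key i j

omit [Fintype ι] [MeasurableSpace ι] [MeasurableSingletonClass ι] in
lemma condE_le_add (hm : m ≤ m₀) (he : UnitRV m₀ e) (hN : UnitRV m₀ N) (hN' : UnitRV m₀ N')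
    (h : ∀ᵐ ω ∂P, e ω ≤ N ω + N' ω) :
    ∀ᵐ ω ∂P, condE P m e ω ≤ condE P m N ω + condE P m N' ω := by
  filter_upwards [condE_ae_eq hm he, condE_ae_eq hm hN, condE_ae_eq hm hN',
    condExp_mono (m := m) he.integrable (hN.integrable.add hN'.integrable) h,
    condExp_add hN.integrable hN'.integrable m] with ω h1 h2 h3 h4 h5
  rw [h1, h2, h3]
  exact h4.trans_eq h5

/-- The counting inequality for three edge variables `e`, `e'`, `e''` on pairs of conditionally
independent cells, evaluated at an independent point where the three edges coincide with `f`. -/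
lemma sq_integral_le_of_le_add {e' e'' : Ω → ℝ} (hm : m ≤ m₀) (hA : Measurable A)
    (hB : Measurable B) (hC : Measurable C) (hA' : Measurable A') (hB' : Measurable B')
    (hC' : Measurable C') (he : UnitRV m₀ e) (he' : UnitRV m₀ e') (he'' : UnitRV m₀ e'')
    (hf : UnitRV m₀ f) (hN : UnitRV m₀ N) (hN' : UnitRV m₀ N')
    (hle : ∀ᵐ ω ∂P, e'' ω ≤ N ω + N' ω)
    (hAB : ∀ i j, condE P m (fun ω => ind (A ω = i) * ind (B ω = j)) =ᵐ[P] fun ω =>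
      condE P m (fun ω => ind (A ω = i)) ω * condE P m (fun ω => ind (B ω = j)) ω)
    (hAC : ∀ i j, condE P m (fun ω => ind (A ω = i) * ind (C ω = j)) =ᵐ[P] fun ω =>
      condE P m (fun ω => ind (A ω = i)) ω * condE P m (fun ω => ind (C ω = j)) ω)
    (hBC : ∀ i j, condE P m (fun ω => ind (B ω = i) * ind (C ω = j)) =ᵐ[P] fun ω =>
      condE P m (fun ω => ind (B ω = i)) ω * condE P m (fun ω => ind (C ω = j)) ω)
    (h₁ : ∀ i j k,
      condE P m (fun ω => ind (A ω = i) * (ind (B ω = j) * ind (C ω = k) * e'' ω)) =ᵐ[P] fun ω =>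
        condE P m (fun ω => ind (A ω = i)) ω *
          condE P m (fun ω => ind (B ω = j) * ind (C ω = k) * e'' ω) ω)
    (h₂ : ∀ i j k,
      condE P m (fun ω => ind (A ω = i) * ind (B ω = j) * N ω * ind (C ω = k)) =ᵐ[P] fun ω =>
        condE P m (fun ω => ind (A ω = i) * ind (B ω = j) * N ω) ω *
          condE P m (fun ω => ind (C ω = k)) ω)
    (h₃ : ∀ i j k,
      condE P m (fun ω => ind (A ω = i) * ind (C ω = k) * N' ω * ind (B ω = j)) =ᵐ[P] fun ω =>
        condE P m (fun ω => ind (A ω = i) * ind (C ω = k) * N' ω) ω *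
          condE P m (fun ω => ind (B ω = j)) ω)
    (lAB : ∀ i j g, UnitRV m g → ∫ ω, f ω * ind (A' ω = i) * ind (B' ω = j) * g ω ∂P =
      ∫ ω, e ω * ind (A ω = i) * ind (B ω = j) * g ω ∂P)
    (lAC : ∀ i j g, UnitRV m g → ∫ ω, f ω * ind (A' ω = i) * ind (C' ω = j) * g ω ∂P =
      ∫ ω, e' ω * ind (A ω = i) * ind (C ω = j) * g ω ∂P)
    (lBC : ∀ i j g, UnitRV m g → ∫ ω, f ω * ind (B' ω = i) * ind (C' ω = j) * g ω ∂P =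
      ∫ ω, e'' ω * ind (B ω = i) * ind (C ω = j) * g ω ∂P) :
    (∫ ω, e'' ω ∂P) ^ 2 ≤
      ∫ ω, condE P (m ⊔ MeasurableSpace.comap (fun ω => (A ω, B ω)) inferInstance) e ω * N ω ∂P +
      ∫ ω, condE P (m ⊔ MeasurableSpace.comap (fun ω => (A ω, C ω)) inferInstance) e' ω *
        N' ω ∂P := by
  have uq : ∀ {X Y : Ω → ι} {M : Ω → ℝ} (i j : ι), UnitRV m₀ (cellQuot P m X Y M i j) :=
    fun i j => (cellQuot_unit i j).mono hm
  -- Multiply `e'' ≤ N + N'` by the indicators of the three cells and condition on `m`. Each of the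
  -- three terms splits off the cell of the vertex that it does not involve.
  have star : ∀ i j k, ∀ᵐ ω ∂P,
      condE P m (fun ω => ind (A ω = i)) ω *
          condE P m (fun ω => ind (B ω = j) * ind (C ω = k) * e'' ω) ω ≤
        condE P m (fun ω => ind (A ω = i) * ind (B ω = j) * N ω) ω *
          condE P m (fun ω => ind (C ω = k)) ω +
        condE P m (fun ω => ind (A ω = i) * ind (C ω = k) * N' ω) ω *
          condE P m (fun ω => ind (B ω = j)) ω := by
    intro i j k
    have uA := UnitRV.ind_eq hA i
    have uB := UnitRV.ind_eq hB j
    have uC := UnitRV.ind_eq hC k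
    filter_upwards [h₁ i j k, h₂ i j k, h₃ i j k, condE_le_add hm (uA.mul ((uB.mul uC).mul he''))
      (((uA.mul uB).mul hN).mul uC) (((uA.mul uC).mul hN').mul uB)
      (hle.mono fun ω hω => by
        have := mul_le_mul_of_nonneg_left hω ((uA.mul (uB.mul uC)).nonneg ω)
        linarith)] with ω a b c d
    rwa [a, b, c] at d
  have q1 := fun i j => cellQuot_mul hm hA hB hN hAB i j
  have q2 := fun i j => cellQuot_mul hm hA hC hN' hAC i j
  have q3 := fun i j => cellQuot_mul hm hB hC he'' hBC i j
  simp only [← ae_all_iff] at star q1 q2 q3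
  -- At the cells `A' ω`, `B' ω`, `C' ω` with `f ω ≠ 0` the three conditional probabilities are
  -- positive. They cancel, which leaves an inequality between densities.
  have main : ∀ᵐ ω ∂P, f ω * cellQuot P m B C e'' (B' ω) (C' ω) ω ≤
      f ω * cellQuot P m A B N (A' ω) (B' ω) ω + f ω * cellQuot P m A C N' (A' ω) (C' ω) ω := by
    filter_upwards [star, q1, q2, q3, condE_pos_at hm hA hB hA' hB' he hf lAB,
      condE_pos_at hm hB hC hB' hC' he'' hf lBC,
      condE_pos_at (A := C) (B := A) hm hC hA hC' hA' he' hf (fun i j g hg => by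
        have := lAC j i g hg
        calc _ = _ := by congr 1; ext ω; ring
          _ = _ := this
          _ = _ := by congr 1; ext ω; ring)] with ω s p1 p2 p3 a b c
    by_cases hω : f ω = 0
    · simp [hω]
    replace a := a hω
    replace b := b hω
    replace c := c hω
    rw [← mul_add]
    refine mul_le_mul_of_nonneg_left ?_ (hf.nonneg ω)
    have s := s (A' ω) (B' ω) (C' ω)
    rw [← p1, ← p2, ← p3] at s
    refine le_of_mul_le_mul_left ?_ (mul_pos a (mul_pos b c))
    linarith
  have i1 := (hf.mul (unitRV_at hB' hC' fun i j => uq (X := B) (Y := C) (M := e'') i j)).integrable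
    (P := P)
  have i2 := (hf.mul (unitRV_at hA' hB' fun i j => uq (X := A) (Y := B) (M := N) i j)).integrable
    (P := P)
  have i3 := (hf.mul (unitRV_at hA' hC' fun i j => uq (X := A) (Y := C) (M := N') i j)).integrable
    (P := P)
  have fin := integral_mono_ae i1 (i2.add i3) main
  have hadd := integral_add i2 i3
  refine (sq_le_sum_cellQuot hm hB hC he'' hBC).trans ?_
  rw [← integral_sum_cellQuot hm hA hB hN he hAB, ← integral_sum_cellQuot hm hA hC hN' he' hAC]
  simp only [← sum_integral_cellQuot hm hA hB he hAB lAB,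
    ← sum_integral_cellQuot hm hA hC he' hAC lAC, ← sum_integral_cellQuot hm hB hC he'' hBC lBC]
  rw [sum_integral_at hB' hC' hf uq, sum_integral_at hA' hB' hf uq, sum_integral_at hA' hC' hf uq]
  exact fin.trans_eq hadd

end CondExp

/-! ### Removal of null cells and martingale convergence. -/

section CondExp

open MeasureTheory

variable {Ω : Type*} {m m' m₀ : MeasurableSpace Ω} {P : Measure[m₀] Ω} [IsProbabilityMeasure P]
  {e e' e'' : Ω → ℝ}

lemma condE_eq_of_le_of_le {k : MeasurableSpace Ω} (h1 : m ≤ k) (h2 : k ≤ m') (hm' : m' ≤ m₀)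
    (he : UnitRV m₀ e) (h : condE P m' e =ᵐ[P] condE P m e) :
    condE P k e =ᵐ[P] condE P m e := by
  refine (eq_condE (h2.trans hm') he ((condE_unit e).mono h1) fun w hw => ?_).symm
  rw [← integral_condE_mul hm' he (hw.mono h2)]
  refine integral_congr_ae ?_
  filter_upwards [h] with ω hω
  rw [hω]

/-- Lévy's upward theorem with dominated convergence. -/
lemma tendsto_integral_condE_mul (F : Filtration ℕ m₀) {N : Ω → ℝ} (he : UnitRV m₀ e)
    (hN : UnitRV m₀ N) :
    Tendsto (fun n => ∫ ω, condE P (F n) e ω * N ω ∂P) atTop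
      (𝓝 (∫ ω, condE P (⨆ n, F n) e ω * N ω ∂P)) := by
  refine tendsto_integral_of_dominated_convergence (fun _ => 1)
    (fun n => (((condE_unit e).mono (F.le n)).mul hN).meas.aestronglyMeasurable)
    (integrable_const _) (fun n => ae_of_all _ fun ω => ?_) ?_
  · have := ((condE_unit (P := P) e).mono (F.le n)).mul hN
    rw [Real.norm_eq_abs, abs_of_nonneg (this.nonneg ω)]
    exact this.le_one ω
  · have h1 : ∀ n, ∀ᵐ ω ∂P, condE P (F n) e ω = (P[e | F n]) ω := fun n => condE_ae_eq (F.le n) he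
    filter_upwards [ae_all_iff.2 h1, condE_ae_eq (iSup_le F.le) he,
      tendsto_ae_condExp (μ := P) (ℱ := F) e] with ω a b c
    simp only [a, b]
    exact c.mul_const _

/-- The limit `σ`-algebra lies between `m` and `m'`, so conditioning on it gives the same as
conditioning on `m`, and that vanishes on the event in question. -/
lemma tendsto_integral_condE_mul_ind (F : Filtration ℕ m₀) (h1 : m ≤ ⨆ n, F n)
    (h2 : ⨆ n, F n ≤ m') (hm' : m' ≤ m₀) (he : UnitRV m₀ e)
    (h : condE P m' e =ᵐ[P] condE P m e) :
    Tendsto (fun n => ∫ ω, condE P (F n) e ω * ind (condE P m e ω = 0) ∂P) atTop (𝓝 0) := by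
  have hN : UnitRV m₀ fun ω => ind (condE P m e ω = 0) :=
    .ind (s := {ω | condE P m e ω = 0})
      (((condE_unit e).mono ((h1.trans h2).trans hm')).meas (measurableSet_singleton 0))
  have hz : ∫ ω, condE P (⨆ n, F n) e ω * ind (condE P m e ω = 0) ∂P = 0 := by
    refine integral_eq_zero_of_ae ?_
    filter_upwards [condE_eq_of_le_of_le (P := P) h1 h2 hm' he h] with ω hω
    rw [hω]
    by_cases h0 : condE P m e ω = 0 <;> simp [h0]
  have h3 := tendsto_integral_condE_mul (P := P) F he hN
  rwa [hz] at h3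

lemma ae_mul_eq_zero (hm : m ≤ m₀) (he : UnitRV m₀ e) (he' : UnitRV m e')
    (h : ∫ ω, e ω * e' ω ∂P = 0) : ∀ᵐ ω ∂P, condE P m e ω * e' ω = 0 := by
  have u := ((condE_unit (P := P) e).mul he').mono hm
  rw [← integral_condE_mul hm he he', integral_eq_zero_iff_of_nonneg u.nonneg u.integrable] at h
  exact h

/-- The removal of the null cells from a triangle-free triple of edge variables. -/
lemma ae_le_ind_add_ind {k k' : MeasurableSpace Ω} (hm : m ≤ m₀) (hm' : m' ≤ m₀)
    (he : UnitRV m₀ e) (he'₀ : UnitRV m₀ e') (he' : UnitRV m e') (he''m : UnitRV m e'')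
    (he'' : UnitRV m' e'') (hk : k ≤ m') (h : condE P m e =ᵐ[P] condE P k e)
    (h' : condE P m' e' =ᵐ[P] condE P k' e') (h0 : ∫ ω, e ω * (e' ω * e'' ω) ∂P = 0) :
    ∀ᵐ ω ∂P, e'' ω ≤ ind (condE P k e ω = 0) + ind (condE P k' e' ω = 0) := by
  -- The edges `e'` and `e''` are `m`-measurable, so `e` may be replaced by its conditional
  -- expectation. Of this only the support is kept: its indicator times `e''` is `m'`-measurable,
  -- and so `e'` can be conditioned next.
  have h1 := ae_mul_eq_zero hm he (he'.mul he''m) h0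
  have u : UnitRV m' fun ω => ind (condE P k e ω ≠ 0) * e'' ω :=
    (UnitRV.ind (s := {ω | condE P k e ω = 0}ᶜ)
      (((condE_unit e).meas (measurableSet_singleton 0)).compl)).mono hk |>.mul he''
  have h2 := ae_mul_eq_zero (P := P) hm' he'₀ u (by
    refine integral_eq_zero_of_ae ?_
    filter_upwards [h1, h] with ω a b
    rw [b] at a
    by_cases hc : condE P k e ω = 0
    · simp [hc]
    · simpa [hc] using a)
  filter_upwards [h2, h'] with ω a b
  rw [b] at a
  by_cases hc : condE P k e ω = 0
  · rw [ind_true hc]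
    linarith [he''.le_one ω, ind_nonneg (condE P k' e' ω = 0)]
  by_cases hc' : condE P k' e' ω = 0
  · rw [ind_true hc']
    linarith [he''.le_one ω, ind_nonneg (condE P k e ω = 0)]
  · simp only [hc, hc', ne_eq, not_false_eq_true, ind_true, one_mul, mul_eq_zero, false_or] at a
    rw [a]
    exact add_nonneg (ind_nonneg _) (ind_nonneg _)

end CondExp

/-! ### Iterated means over linearly ordered times. -/

section Iterated

variable {W Z T : Type*} (ν : FinMean W) (l : FinMean Z)

/-- The mean integrating out the coordinates of a tuple, the first one outermost, with a further
variable that is integrated out first. -/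
def iterMean : (k : ℕ) → FinMean ((Fin k → W) × Z)
  | 0 => l.map fun z => (Fin.elim0, z)
  | k + 1 => ν.bind fun w => (iterMean k).map fun p => (Fin.cons w p.1, p.2)

lemma iterMean_succ (k : ℕ) (F : (Fin (k + 1) → W) × Z → ℝ) :
    iterMean ν l (k + 1) F = ν fun w => iterMean ν l k fun p => F (Fin.cons w p.1, p.2) := rfl

/-- A coordinate that `F` does not read is integrated as a constant. Monotonicity of `s` preserves
the order of the remaining integrations, which need not commute. -/
lemma iterMean_comp {k n : ℕ} {s : Fin k → Fin n} (hs : StrictMono s)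
    (F : (Fin k → W) × Z → ℝ) :
    iterMean ν l n (fun p => F (p.1 ∘ s, p.2)) = iterMean ν l k F := by
  induction n generalizing k with
  | zero =>
    cases k with
    | zero =>
      congr 1
      ext p
      congr 2
      exact Subsingleton.elim _ _
    | succ k => exact (s 0).elim0
  | succ n ih =>
    by_cases h : ∀ i, s i ≠ 0
    · have hs' : StrictMono fun i => (s i).pred (h i) := fun i j hij => by
        simpa using hs hij
      have : ∀ (w : W) (v : Fin n → W), (Fin.cons w v : Fin (n + 1) → W) ∘ s =
          v ∘ fun i => (s i).pred (h i) := by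
        intro w v
        ext i
        simp only [Function.comp]
        conv_lhs => rw [← Fin.succ_pred (s i) (h i), Fin.cons_succ]
      simp only [iterMean_succ, this, ih hs']
      exact ν.const _
    · push Not at h
      obtain ⟨i, hi⟩ := h
      cases k with
      | zero => exact i.elim0
      | succ k =>
        have h0 : s 0 = 0 := le_antisymm (hi ▸ hs.monotone (Fin.zero_le i)) (Fin.zero_le _)
        have hpos : ∀ i : Fin k, s i.succ ≠ 0 := fun i =>
          (h0 ▸ hs (Fin.succ_pos i) : (0 : Fin (n + 1)) < s i.succ).ne'
        have hs' : StrictMono fun i : Fin k => (s i.succ).pred (hpos i) := fun i j hij => by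
          simpa using hs (Fin.succ_lt_succ_iff.2 hij)
        have : ∀ (w : W) (v : Fin n → W), (Fin.cons w v : Fin (n + 1) → W) ∘ s =
            Fin.cons w (v ∘ fun i => (s i.succ).pred (hpos i)) := by
          intro w v
          ext i
          refine Fin.cases ?_ (fun i => ?_) i
          · simp [h0]
          · simp only [Function.comp, Fin.cons_succ]
            conv_lhs => rw [← Fin.succ_pred (s i.succ) (hpos i), Fin.cons_succ]
        simp only [iterMean_succ, this]
        congr 1
        ext w
        exact ih hs' fun p => F (Fin.cons w p.1, p.2)

lemma iterMean_invariant {θ : W → W} {σ : Z → Z}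
    (hν : ∀ f, BddF f → ν (fun w => f (θ w)) = ν f) (hl : ∀ f, BddF f → l (fun z => f (σ z)) = l f)
    (k : ℕ) {F : (Fin k → W) × Z → ℝ} (hF : BddF F) :
    iterMean ν l k (fun p => F (θ ∘ p.1, σ p.2)) = iterMean ν l k F := by
  induction k with
  | zero =>
    have : ∀ p : (Fin 0 → W) × Z, F (θ ∘ p.1, σ p.2) = F (Fin.elim0, σ p.2) := fun p => by
      congr 2; exact Subsingleton.elim _ _
    simp only [this]
    exact hl (fun z => F (Fin.elim0, z)) (hF.comp _)
  | succ k ih =>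
    have : ∀ (w : W) (v : Fin k → W), θ ∘ (Fin.cons w v : Fin (k + 1) → W) =
        Fin.cons (θ w) (θ ∘ v) := fun w v => by
      ext i
      refine Fin.cases rfl (fun i => rfl) i
    simp only [iterMean_succ, this]
    have h1 : ∀ w, iterMean ν l k (fun p => F (Fin.cons (θ w) (θ ∘ p.1), σ p.2)) =
        iterMean ν l k fun p => F (Fin.cons (θ w) p.1, p.2) := fun w =>
      ih (F := fun p => F (Fin.cons (θ w) p.1, p.2)) (hF.comp _)
    simp only [h1]
    exact hν (fun w => iterMean ν l k fun p => F (Fin.cons w p.1, p.2))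
      (FinMean.bddF (hF.imp fun C hC _ _ => hC _))

variable [LinearOrder T] (w₀ : W)

/-- The extension of a tuple indexed by a finite set of times. -/
noncomputable def extendTuple (K : Finset T) (v : Fin K.card → W) (t : T) : W :=
  if h : t ∈ K then v ((K.orderIsoOfFin rfl).symm ⟨t, h⟩) else w₀

lemma extendTuple_comp (K : Finset T) (v : T → W) {t : T} (ht : t ∈ K) :
    extendTuple w₀ K (v ∘ K.orderEmbOfFin rfl) t = v t := by
  rw [extendTuple, dif_pos ht]
  simp only [Function.comp]
  congr 1
  rw [← Finset.coe_orderIsoOfFin_apply, OrderIso.apply_symm_apply]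

/-- The mean on arrays indexed by a linear order that integrates out later times first. -/
noncomputable def arrayMean : FinMean ((T → W) × Z) :=
  -- On a function of finitely many times the values are constant once `K` contains these times, and
  -- the filler `w₀` does not matter. The ultralimit extends this to a mean on all bounded
  -- functions.
  .ulim (Ultrafilter.of atTop) fun K : Finset T =>
    (iterMean ν l K.card).map fun p => (extendTuple w₀ K p.1, p.2)

lemma arrayMean_eq {k : ℕ} {t : Fin k → T} (ht : StrictMono t) (F : (Fin k → W) × Z → ℝ) :
    arrayMean ν l w₀ (fun p => F (p.1 ∘ t, p.2)) = iterMean ν l k F := by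
  refine FinMean.ulim_eq <| Ultrafilter.of_le atTop <|
    (eventually_ge_atTop (Finset.univ.image t)).mono fun K hK => ?_
  have hmem : ∀ i, t i ∈ K := fun i => hK (Finset.mem_image_of_mem _ (Finset.mem_univ i))
  have hs : StrictMono fun i => (K.orderIsoOfFin rfl).symm ⟨t i, hmem i⟩ := fun i j hij =>
    (K.orderIsoOfFin rfl).symm.strictMono (ht hij)
  rw [← iterMean_comp ν l hs F]
  refine congrArg (iterMean ν l K.card).toFun (funext fun p =>
    congrArg F (Prod.ext (funext fun i => ?_) rfl))
  simp only [Function.comp, extendTuple, dif_pos (hmem i)]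

/-- The function depends only on the values of the array at the times in a given set. -/
def DependsOnTimes (F : (T → W) × Z → ℝ) (K : Finset T) : Prop :=
  ∀ v v' z, (∀ t ∈ K, v t = v' t) → F (v, z) = F (v', z)

variable {ν l w₀} {F : (T → W) × Z → ℝ} {K : Finset T}

lemma DependsOnTimes.eq (h : DependsOnTimes F K) (p : (T → W) × Z) :
    F p = F (extendTuple w₀ K (p.1 ∘ K.orderEmbOfFin rfl), p.2) :=
  h _ _ _ fun _ ht => (extendTuple_comp w₀ K p.1 ht).symm

lemma arrayMean_eq_iterMean (h : DependsOnTimes F K) :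
    arrayMean ν l w₀ F = iterMean ν l K.card fun p => F (extendTuple w₀ K p.1, p.2) := by
  rw [← arrayMean_eq ν l w₀ (K.orderEmbOfFin rfl).strictMono]
  congr 1
  ext p
  exact h.eq p

/-- Spreadability: only the relative order of the times matters. It replaces exchangeability, which
is not available without Fubini. -/
lemma arrayMean_comp (h : DependsOnTimes F K) {r : T → T} (hr : StrictMono r) :
    arrayMean ν l w₀ (fun p => F (p.1 ∘ r, p.2)) = arrayMean ν l w₀ F := by
  rw [arrayMean_eq_iterMean h,
    ← arrayMean_eq ν l w₀ (hr.comp (K.orderEmbOfFin rfl).strictMono)]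
  congr 1
  ext p
  exact h.eq (p.1 ∘ r, p.2)

lemma arrayMean_invariant (h : DependsOnTimes F K) (hF : BddF F) {θ : W → W} {σ : Z → Z}
    (hν : ∀ f, BddF f → ν (fun w => f (θ w)) = ν f)
    (hl : ∀ f, BddF f → l (fun z => f (σ z)) = l f) :
    arrayMean ν l w₀ (fun p => F (θ ∘ p.1, σ p.2)) = arrayMean ν l w₀ F := by
  have h' : DependsOnTimes (fun p => F (θ ∘ p.1, σ p.2)) K := fun v v' z hv =>
    h _ _ _ fun t ht => congrArg θ (hv t ht)
  rw [arrayMean_eq_iterMean h', arrayMean_eq_iterMean h,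
    ← iterMean_invariant ν l hν hl _ (F := fun p => F (extendTuple w₀ K p.1, p.2)) (hF.comp _)]
  congr 1
  ext p
  refine h _ _ _ fun t ht => ?_
  simp [extendTuple, ht]

lemma arrayMean_of_const {F : Z → ℝ} : arrayMean ν l w₀ (fun p : (T → W) × Z => F p.2) = l F :=
  arrayMean_eq ν l w₀ (t := Fin.elim0) (fun i => i.elim0) fun p => F p.2

/-- The time `t` precedes all others that are read, so it is the outermost integration. -/
lemma arrayMean_split {H : W → (T → W) × Z → ℝ} (h : ∀ w, DependsOnTimes (H w) K) {t : T}
    (ht : ∀ s ∈ K, t < s) :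
    arrayMean ν l w₀ (fun p => H (p.1 t) p) = ν fun w => arrayMean ν l w₀ (H w) := by
  have hs : StrictMono (Fin.cons t (K.orderEmbOfFin rfl) : Fin (K.card + 1) → T) := by
    intro i j
    refine Fin.cases ?_ (fun j => ?_) j
    · exact fun h => absurd h (Fin.not_lt_zero i)
    refine Fin.cases (fun _ => ?_) (fun i h => ?_) i
    · exact ht _ (K.orderEmbOfFin_mem rfl j)
    · exact (K.orderEmbOfFin rfl).strictMono (Fin.succ_lt_succ_iff.1 h)
  simp only [fun w => arrayMean_eq_iterMean (ν := ν) (l := l) (w₀ := w₀) (h w)]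
  have key := arrayMean_eq ν l w₀ hs
    fun p => H (p.1 0) (extendTuple w₀ K (Fin.tail p.1), p.2)
  simp only [iterMean_succ, Fin.cons_zero, Fin.tail_cons] at key
  rw [← key]
  refine congrArg (arrayMean ν l w₀).toFun (funext fun p => ?_)
  exact (h _).eq p

end Iterated

/-! ### Two-sided actions and the tripartite graph of corners. -/

section BiSystem

/-- A mean on a group invariant under left and right multiplication. -/
structure InvMean (G : Type*) [Group G] extends FinMean G where
  left' : ∀ (g : G) {f : G → ℝ}, BddF f → toFun (fun x => f (g * x)) = toFun f
  right' : ∀ (g : G) {f : G → ℝ}, BddF f → toFun (fun x => f (x * g)) = toFun f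

/-- A mean-preserving action `z ↦ p z q` of a group from the left and from the right. -/
structure BiSystem (G Z : Type*) [Group G] where
  act : G → G → Z → Z
  act_one : ∀ z, act 1 1 z = z
  act_act : ∀ p q p' q' z, act p q (act p' q' z) = act (p * p') (q' * q) z
  mean : FinMean Z
  mean_act : ∀ p q f, BddF f → mean (fun z => f (act p q z)) = mean f

variable {G Z : Type*} [Group G] (I : InvMean G) (S : BiSystem G Z)

lemma InvMean.mul_mul (p q : G) {F : G → ℝ} (hF : BddF F) :
    I.toFun (fun x => F (p * x * q)) = I.toFun F :=
  (I.left' p (f := fun x => F (x * q)) (hF.comp _)).trans (I.right' q hF)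

/-- The mean of a triple of independent group elements. -/
def tripleMean : FinMean (G × G × G) :=
  I.toFinMean.bind fun a => I.toFinMean.bind fun b => I.toFinMean.map fun c => (a, b, c)

/-- The symmetries of triples of group elements. -/
def twist (p q : G) (w : G × G × G) : G × G × G := (w.1 * p⁻¹, w.2.1 * q⁻¹, q * w.2.2 * p⁻¹)

lemma tripleMean_twist (p q : G) {f : G × G × G → ℝ} (hf : BddF f) :
    tripleMean I (fun w => f (twist p q w)) = tripleMean I f := by
  obtain ⟨C, hC⟩ := hf
  have h1 : ∀ a b, I.toFun (fun c => f (a, b, q * c * p⁻¹)) = I.toFun fun c => f (a, b, c) := by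
    intro a b
    rw [I.left' q (f := fun c => f (a, b, c * p⁻¹)) ⟨C, fun _ => hC _⟩,
      I.right' p⁻¹ (f := fun c => f (a, b, c)) ⟨C, fun _ => hC _⟩]
  have h2 : ∀ a, I.toFun (fun b => I.toFun fun c => f (a, b * q⁻¹, c)) =
      I.toFun fun b => I.toFun fun c => f (a, b, c) := fun a =>
    I.right' q⁻¹ (f := fun b => I.toFun fun c => f (a, b, c))
      (FinMean.bddF (m := fun _ => I.toFinMean) ⟨C, fun _ _ => hC _⟩)
  have h3 : I.toFun (fun a => I.toFun fun b => I.toFun fun c => f (a * p⁻¹, b, c)) =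
      I.toFun fun a => I.toFun fun b => I.toFun fun c => f (a, b, c) :=
    I.right' p⁻¹ (f := fun a => I.toFun fun b => I.toFun fun c => f (a, b, c))
      (FinMean.bddF (m := fun _ => I.toFinMean)
        ⟨C, fun _ _ => I.toFinMean.abs_le fun _ => hC _⟩)
  change I.toFun (fun a => I.toFun fun b => I.toFun fun c =>
    f (a * p⁻¹, b * q⁻¹, q * c * p⁻¹)) =
      I.toFun fun a => I.toFun fun b => I.toFun fun c => f (a, b, c)
  simp only [h1, h2, h3]

lemma tripleMean_snd (F : G → ℝ) : tripleMean I (fun w => F w.2.1) = I.toFun F := by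
  change I.toFun (fun _ => I.toFun fun b => I.toFun fun _ => F b) = _
  simp only [I.toFinMean.const]

lemma tripleMean_thd (F : G → ℝ) : tripleMean I (fun w => F w.2.2) = I.toFun F := by
  change I.toFun (fun _ => I.toFun fun _ => I.toFun fun c => F c) = _
  simp only [I.toFinMean.const]

/-- Indices of edges between two vertices: `0`, `1`, `2` stand for the pairs of vertex classes
`ab`, `ac`, `bc`. -/
abbrev EdgeIdx (V : Type*) := Fin 3 × V × V

variable {S} {V V' T : Type*} (f : Z → Bool)

variable (S) in
/-- The values of `f` at the three kinds of edges. -/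
def edgeVal (u : V → G × G × G) (z : Z) : EdgeIdx V → Bool
  -- Written as `p z q`, the points are `a z b⁻¹`, `a z c a⁻¹` and `b c z b⁻¹`. For `w = a z b⁻¹`
  -- and `g = b c a⁻¹` these are `w`, `w g` and `g w`.
  | (0, x, y) => f (S.act (u x).1 (u y).2.1⁻¹ z)
  | (1, x, y) => f (S.act (u x).1 ((u y).2.2 * (u x).1⁻¹) z)
  | (2, x, y) => f (S.act ((u x).2.1 * (u y).2.2) (u x).2.1⁻¹ z)

/-- The inserted factors cancel, as in `(a p⁻¹) (p z q⁻¹) (b q⁻¹)⁻¹ = a z b⁻¹`. -/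
lemma edgeVal_twist (p q : G) (u : V → G × G × G) (z : Z) :
    edgeVal S f (twist p q ∘ u) (S.act p q⁻¹ z) = edgeVal S f u z := by
  ext ⟨k, x, y⟩
  fin_cases k <;> simp [edgeVal, twist, S.act_act, mul_assoc]

/-- Renaming the vertices of an edge, separately in the three classes. -/
def EdgeIdx.map (ra rb rc : V → V') : EdgeIdx V → EdgeIdx V'
  | (0, x, y) => (0, ra x, rb y)
  | (1, x, y) => (1, ra x, rc y)
  | (2, x, y) => (2, rb x, rc y)

/-- The edges between given sets of vertices of the three classes. -/
def edgeSet (A B C : Set V) : Set (EdgeIdx V) :=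
  {j | match j with
    | (0, x, y) => x ∈ A ∧ y ∈ B
    | (1, x, y) => x ∈ A ∧ y ∈ C
    | (2, x, y) => x ∈ B ∧ y ∈ C}

lemma edgeVal_congr {u u' : V → G × G × G} {A B C : Set V} (z : Z)
    (hA : ∀ x ∈ A, (u x).1 = (u' x).1)
    (hB : ∀ x ∈ B, (u x).2.1 = (u' x).2.1) (hC : ∀ x ∈ C, (u x).2.2 = (u' x).2.2) {j : EdgeIdx V}
    (hj : j ∈ edgeSet A B C) : edgeVal S f u z j = edgeVal S f u' z j := by
  obtain ⟨k, x, y⟩ := j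
  fin_cases k
  · simp only [edgeVal, hA x hj.1, hB y hj.2]
  · simp only [edgeVal, hA x hj.1, hC y hj.2]
  · simp only [edgeVal, hB x hj.1, hC y hj.2]

lemma edgeVal_map {u : V' → G × G × G} {ra rb rc : V → V'} (z : Z) (j : EdgeIdx V) :
    edgeVal S f u z (j.map ra rb rc) =
      edgeVal S f (fun x => ((u (ra x)).1, (u (rb x)).2.1, (u (rc x)).2.2)) z j := by
  obtain ⟨k, x, y⟩ := j
  fin_cases k <;> rfl

/-- The vertex `none` carries the triple `w`, the others those of an array. -/
def vtx {W : Type*} (w : W) (v : T → W) : Option T → W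
  | none => w
  | some t => v t

section LinearOrder

variable [LinearOrder T]

variable (S) in
/-- The probability that the edges in a finite set have prescribed values. -/
noncomputable def patternProb (w : G × G × G) (K : Finset (EdgeIdx (Option T)))
    (p : EdgeIdx (Option T) → Bool) : ℝ :=
  arrayMean (tripleMean I) S.mean (1 : G × G × G) fun q : (T → G × G × G) × Z =>
    ind (∀ j ∈ K, edgeVal S f (vtx w q.1) q.2 j = p j)

/-- The times of the vertices of the edges in a finite set. -/
def timesOf (K : Finset (EdgeIdx (Option T))) : Finset T :=
  K.biUnion fun j => j.2.1.toFinset ∪ j.2.2.toFinset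

lemma edgeVal_eq_of_timesOf {K : Finset (EdgeIdx (Option T))} {v v' : T → G × G × G}
    (w : G × G × G) (z : Z) (h : ∀ t ∈ timesOf K, v t = v' t) {j : EdgeIdx (Option T)}
    (hj : j ∈ K) :
    edgeVal S f (vtx w v) z j = edgeVal S f (vtx w v') z j := by
  have key : ∀ x : Option T, (∀ t, x = some t → t ∈ timesOf K) → vtx w v x = vtx w v' x := by
    intro x hx
    cases x with
    | none => rfl
    | some t => exact h t (hx t rfl)
  have h1 := key j.2.1 fun t ht => Finset.mem_biUnion.2 ⟨j, hj, by simp [ht]⟩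
  have h2 := key j.2.2 fun t ht => Finset.mem_biUnion.2 ⟨j, hj, by simp [ht]⟩
  obtain ⟨k, x, y⟩ := j
  fin_cases k <;> simp only [edgeVal] at h1 h2 ⊢ <;> rw [h1, h2]

lemma dependsOnTimes_pattern (w : G × G × G) (K : Finset (EdgeIdx (Option T)))
    (p : EdgeIdx (Option T) → Bool) :
    DependsOnTimes (fun q : (T → G × G × G) × Z =>
      ind (∀ j ∈ K, edgeVal S f (vtx w q.1) q.2 j = p j)) (timesOf K) := by
  intro v v' z h
  refine ind_congr (forall₂_congr fun j hj => ?_)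
  rw [edgeVal_eq_of_timesOf f w z h hj]

/-- Renaming the times of a pattern does not change its probability. -/
lemma patternProb_rename {r : T → T} (hr : StrictMono r) (K : Finset (EdgeIdx (Option T)))
    (p : EdgeIdx (Option T) → Bool) (τ : EdgeIdx (Option T) → EdgeIdx (Option T)) [DecidableEq T] :
    arrayMean (tripleMean I) S.mean (1 : G × G × G) (fun q : (T → G × G × G) × Z =>
      ind (∀ j ∈ K, edgeVal S f (vtx 1 q.1) q.2
        ((τ j).map (Option.map r) (Option.map r) (Option.map r)) = p j)) =
    arrayMean (tripleMean I) S.mean (1 : G × G × G) (fun q : (T → G × G × G) × Z =>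
      ind (∀ j ∈ K, edgeVal S f (vtx 1 q.1) q.2 (τ j) = p j)) := by
  have hdep : DependsOnTimes (fun q : (T → G × G × G) × Z =>
      ind (∀ j ∈ K, edgeVal S f (vtx 1 q.1) q.2 (τ j) = p j)) (timesOf (K.image τ)) := by
    intro v v' z h
    refine ind_congr (forall₂_congr fun j hj => ?_)
    rw [edgeVal_eq_of_timesOf f 1 z h (Finset.mem_image_of_mem τ hj)]
  rw [← arrayMean_comp hdep hr]
  refine congrArg (arrayMean (tripleMean I) S.mean (1 : G × G × G)).toFun (funext fun q => ?_)
  refine ind_congr (forall₂_congr fun j _ => ?_)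
  rw [edgeVal_map]
  have : ∀ x, vtx (1 : G × G × G) q.1 (x.map r) = vtx 1 (q.1 ∘ r) x := fun x => by
    cases x <;> rfl
  simp only [this]

/-- Twisting the remaining vertices and `z` at the same time preserves both the mean and the edges.
-/
lemma patternProb_twist (a b : G) (w : G × G × G) (K : Finset (EdgeIdx (Option T)))
    (p : EdgeIdx (Option T) → Bool) :
    patternProb I S f (twist a b w) K p = patternProb I S f w K p := by
  unfold patternProb
  rw [← arrayMean_invariant (dependsOnTimes_pattern f (twist a b w) K p) (.ind _)
    (fun g hg => tripleMean_twist I a b hg) (S.mean_act a b⁻¹)]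
  refine congrArg (arrayMean (tripleMean I) S.mean (1 : G × G × G)).toFun (funext fun q => ?_)
  refine ind_congr (forall₂_congr fun j _ => ?_)
  have : vtx (twist a b w) (twist a b ∘ q.1) = twist a b ∘ vtx w q.1 := by
    ext1 x
    cases x <;> rfl
  rw [this, edgeVal_twist]

/-- Twisting by `a` and `b` normalises the first two entries. Only `b c a⁻¹` survives, the
difference of the corner. -/
lemma patternProb_eq (a b c : G) (K : Finset (EdgeIdx (Option T)))
    (p : EdgeIdx (Option T) → Bool) :
    patternProb I S f (a, b, c) K p = patternProb I S f (1, 1, b * c * a⁻¹) K p := by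
  rw [← patternProb_twist I f a b]
  simp [twist]

/-- Putting the vertex of time `t` in place of `none`. -/
def putVtx (t : T) (x : Option T) : Option T := some (x.getD t)

omit [LinearOrder T] in
lemma edgeVal_putVtx (ta tb tc : T) (v : T → G × G × G) (z : Z) (j : EdgeIdx (Option T)) :
    edgeVal S f (vtx 1 v) z (j.map (putVtx ta) (putVtx tb) (putVtx tc)) =
      edgeVal S f (vtx ((v ta).1, (v tb).2.1, (v tc).2.2) v) z j := by
  rw [edgeVal_map]
  congr 1
  ext1 x
  cases x <;> rfl

variable {t₀ t₁ t₂ : T} (h₀₁ : t₀ < t₁) (h₁₂ : t₁ < t₂) {K : Finset (EdgeIdx (Option T))}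
  (hK : ∀ t ∈ timesOf K, t₂ < t)

include h₀₁ h₁₂ hK in
lemma arrayMean_front (Φ : G × G × G → G × G × G → G × G × G → G × G × G)
    (p : EdgeIdx (Option T) → Bool) :
    arrayMean (tripleMean I) S.mean (1 : G × G × G) (fun q : (T → G × G × G) × Z =>
      ind (∀ j ∈ K, edgeVal S f (vtx (Φ (q.1 t₀) (q.1 t₁) (q.1 t₂)) q.1) q.2 j = p j)) =
    tripleMean I fun w₀ => tripleMean I fun w₁ => tripleMean I fun w₂ =>
      patternProb I S f (Φ w₀ w₁ w₂) K p := by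
  have e2 : ∀ w₀ w₁, arrayMean (tripleMean I) S.mean (1 : G × G × G)
      (fun q : (T → G × G × G) × Z =>
        ind (∀ j ∈ K, edgeVal S f (vtx (Φ w₀ w₁ (q.1 t₂)) q.1) q.2 j = p j)) =
      tripleMean I fun w₂ => patternProb I S f (Φ w₀ w₁ w₂) K p := fun w₀ w₁ =>
    arrayMean_split (H := fun w₂ q => ind (∀ j ∈ K,
      edgeVal S f (vtx (Φ w₀ w₁ w₂) q.1) q.2 j = p j))
      (fun w₂ => dependsOnTimes_pattern f (Φ w₀ w₁ w₂) K p) hK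
  have e1 : ∀ w₀, arrayMean (tripleMean I) S.mean (1 : G × G × G)
      (fun q : (T → G × G × G) × Z =>
        ind (∀ j ∈ K, edgeVal S f (vtx (Φ w₀ (q.1 t₁) (q.1 t₂)) q.1) q.2 j = p j)) =
      tripleMean I fun w₁ => tripleMean I fun w₂ => patternProb I S f (Φ w₀ w₁ w₂) K p := by
    intro w₀
    rw [arrayMean_split (K := insert t₂ (timesOf K)) (H := fun w₁ q => ind (∀ j ∈ K,
      edgeVal S f (vtx (Φ w₀ w₁ (q.1 t₂)) q.1) q.2 j = p j))]
    · simp only [e2]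
    · intro w₁ v v' z h
      dsimp only
      rw [h t₂ (by simp)]
      exact dependsOnTimes_pattern f _ K p v v' z fun t ht => h t (by simp [ht])
    · intro t ht
      rcases Finset.mem_insert.1 ht with rfl | ht
      exacts [h₁₂, h₁₂.trans (hK t ht)]
  rw [arrayMean_split (K := insert t₁ (insert t₂ (timesOf K))) (H := fun w₀ q => ind (∀ j ∈ K,
    edgeVal S f (vtx (Φ w₀ (q.1 t₁) (q.1 t₂)) q.1) q.2 j = p j))]
  · simp only [e1]
  · intro w₁ v v' z h
    dsimp only
    rw [h t₂ (by simp), h t₁ (by simp)]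
    exact dependsOnTimes_pattern f _ K p v v' z fun t ht => h t (by simp [ht])
  · intro t ht
    rcases Finset.mem_insert.1 ht with rfl | ht
    · exact h₀₁
    rcases Finset.mem_insert.1 ht with rfl | ht
    exacts [h₀₁.trans h₁₂, h₀₁.trans (h₁₂.trans (hK t ht))]

lemma bddF_patternProb {X : Type*} (φ : X → G × G × G) (p : EdgeIdx (Option T) → Bool) :
    BddF fun x => patternProb I S f (φ x) K p :=
  FinMean.bddF (m := fun _ => arrayMean (tripleMean I) S.mean (1 : G × G × G))
    ⟨1, fun _ _ => by rw [abs_of_nonneg (ind_nonneg _)]; exact ind_le_one _⟩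

include h₀₁ h₁₂ hK in
-- Here `c` is integrated before `a` and `b`, and the substitution of `b c a⁻¹` for `c` preserves
-- the mean.
lemma patternProb_front (p : EdgeIdx (Option T) → Bool) :
    arrayMean (tripleMean I) S.mean (1 : G × G × G) (fun q : (T → G × G × G) × Z =>
      ind (∀ j ∈ K, edgeVal S f (vtx 1 q.1) q.2
        (j.map (putVtx t₀) (putVtx t₁) (putVtx t₂)) = p j)) =
    I.toFun fun g => patternProb I S f (1, 1, g) K p := by
  simp only [edgeVal_putVtx]
  rw [arrayMean_front I f h₀₁ h₁₂ hK fun w₀ w₁ w₂ => (w₀.1, w₁.2.1, w₂.2.2)]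
  have h3 : ∀ a b, I.toFun (fun c => patternProb I S f (a, b, c) K p) =
      I.toFun fun g => patternProb I S f (1, 1, g) K p := fun a b => by
    simp only [fun c => patternProb_eq I f (S := S) a b c K p]
    exact I.mul_mul b a⁻¹ (F := fun g => patternProb I S f (1, 1, g) K p)
      (bddF_patternProb I f (fun g => (1, 1, g)) p)
  simp only [fun a b => tripleMean_thd I fun c => patternProb I S f (a, b, c) K p, h3,
    FinMean.const]

include h₀₁ h₁₂ hK in
-- Here `b` is integrated before `a` and `c`, and right multiplication by `c a⁻¹` preserves the
-- mean. Agreement with `patternProb_front` is the substitute for Fubini in `b` and `c`.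
lemma patternProb_front_swap (p : EdgeIdx (Option T) → Bool) :
    arrayMean (tripleMean I) S.mean (1 : G × G × G) (fun q : (T → G × G × G) × Z =>
      ind (∀ j ∈ K, edgeVal S f (vtx 1 q.1) q.2
        (j.map (putVtx t₀) (putVtx t₂) (putVtx t₁)) = p j)) =
    I.toFun fun g => patternProb I S f (1, 1, g) K p := by
  simp only [edgeVal_putVtx]
  rw [arrayMean_front I f h₀₁ h₁₂ hK fun w₀ w₁ w₂ => (w₀.1, w₂.2.1, w₁.2.2)]
  have h3 : ∀ a c, I.toFun (fun b => patternProb I S f (a, b, c) K p) =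
      I.toFun fun g => patternProb I S f (1, 1, g) K p := fun a c => by
    simp only [fun b => patternProb_eq I f (S := S) a b c K p, mul_assoc]
    exact I.right' (c * a⁻¹) (f := fun g => patternProb I S f (1, 1, g) K p)
      (bddF_patternProb I f (fun g => (1, 1, g)) p)
  simp only [fun a c => tripleMean_snd I fun b => patternProb I S f (a, b, c) K p, h3,
    FinMean.const]

lemma patternProb_congr {w w' : G × G × G} {A B C : Set (Option T)}
    (hA : none ∈ A → w.1 = w'.1) (hB : none ∈ B → w.2.1 = w'.2.1) (hC : none ∈ C → w.2.2 = w'.2.2)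
    (h : ∀ j ∈ K, j ∈ edgeSet A B C) (p : EdgeIdx (Option T) → Bool) :
    patternProb I S f w K p = patternProb I S f w' K p := by
  refine congrArg (arrayMean (tripleMean I) S.mean (1 : G × G × G)).toFun (funext fun q => ?_)
  refine ind_congr (forall₂_congr fun j hj => ?_)
  rw [edgeVal_congr f (u' := vtx w' q.1) q.2 _ _ _ (h j hj)]
  · rintro (_ | x) hx
    exacts [hA hx, rfl]
  · rintro (_ | x) hx
    exacts [hB hx, rfl]
  · rintro (_ | x) hx
    exacts [hC hx, rfl]

/-- A pattern that misses one of the special vertices does not depend on them. -/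
lemma patternProb_one {A B C : Set (Option T)} (hABC : none ∉ A ∨ none ∉ B ∨ none ∉ C)
    (h : ∀ j ∈ K, j ∈ edgeSet A B C) (p : EdgeIdx (Option T) → Bool) (g : G) :
    patternProb I S f (1, 1, g) K p = patternProb I S f 1 K p := by
  have e1 : patternProb I S f (1, 1, 1) K p = patternProb I S f 1 K p := rfl
  -- The entry of the missing class is free. The choices `a = g`, `b = g⁻¹` and `c = 1` respectively
  -- make `b c a⁻¹` trivial.
  rcases hABC with h0 | h0 | h0
  · rw [patternProb_congr I f (S := S) (w := (1, 1, g)) (w' := (g, 1, g))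
      (fun h => absurd h h0) (fun _ => rfl)
      (fun _ => rfl) h p, patternProb_eq]
    simp [e1]
  · rw [patternProb_congr I f (S := S) (w := (1, 1, g)) (w' := (1, g⁻¹, g))
      (fun _ => rfl) (fun h => absurd h h0)
      (fun _ => rfl) h p, patternProb_eq]
    simp [e1]
  · rw [← e1]
    exact patternProb_congr I f (S := S) (w := (1, 1, g)) (w' := (1, 1, 1)) (fun _ => rfl)
      (fun _ => rfl) (fun h => absurd h h0) h p

end LinearOrder

end BiSystem

/-! ### Random Boolean arrays: laws and conditioning on coordinates. -/

section Cylinder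

open MeasureTheory

variable {ι κ X E : Type*}

/-- A mean of Boolean arrays is represented by a probability measure. -/
lemma exists_measure_of_mean [Countable ι] (M : FinMean X) (φ : X → ι → Bool) :
    ∃ P : Measure (ι → Bool), IsProbabilityMeasure P ∧
      ∀ (K : Finset ι) (τ : ι → ι) (p : ι → Bool),
        P.real {ω | ∀ j ∈ K, ω (τ j) = p j} = M fun x => ind (∀ j ∈ K, φ x (τ j) = p j) := by
  have hb : ∀ g : CompactlySupportedContinuousMap (ι → Bool) ℝ, BddF fun x => g (φ x) := by
    intro g
    obtain ⟨C, hC⟩ := (isCompact_range g.continuous).isBounded.exists_norm_le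
    exact ⟨C, fun x => hC _ ⟨φ x, rfl⟩⟩
  -- On continuous functions on the compact space `ι → Bool` the mean is a positive functional,
  -- hence an integral by Riesz. Cylinder sets are clopen, so their indicators are continuous and
  -- their measure is exactly the mean.
  let Λ : CompactlySupportedContinuousMap (ι → Bool) ℝ →ₚ[ℝ] ℝ :=
    { toFun g := M fun x => g (φ x)
      map_add' g g' := M.add (hb g) (hb g')
      map_smul' c g := M.smul c (hb g)
      monotone' g g' h := M.mono (hb g) (hb g') fun x => h (φ x) }
  have key : ∀ (K : Finset ι) (τ : ι → ι) (p : ι → Bool),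
      (RealRMK.rieszMeasure Λ).real {ω | ∀ j ∈ K, ω (τ j) = p j} =
        M fun x => ind (∀ j ∈ K, φ x (τ j) = p j) := by
    intro K τ p
    have hclopen : IsClopen {ω : ι → Bool | ∀ j ∈ K, ω (τ j) = p j} := by
      have : {ω : ι → Bool | ∀ j ∈ K, ω (τ j) = p j} = ⋂ j ∈ K, (fun ω => ω (τ j)) ⁻¹' {p j} := by
        ext ω; simp
      rw [this]
      exact K.finite_toSet.isClopen_biInter fun j _ =>
        (isClopen_discrete _).preimage (continuous_apply _)
    have hcont : Continuous fun ω : ι → Bool => ind (∀ j ∈ K, ω (τ j) = p j) := by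
      have : (fun ω : ι → Bool => ind (∀ j ∈ K, ω (τ j) = p j)) =
          {ω : ι → Bool | ∀ j ∈ K, ω (τ j) = p j}.indicator 1 := by
        ext ω
        by_cases h : ∀ j ∈ K, ω (τ j) = p j
        · rw [ind_true h, Set.indicator_of_mem (by exact h)]; rfl
        · rw [ind_false h, Set.indicator_of_notMem (by exact h)]
      rw [this]
      exact continuous_one.indicator fun a ha => by simp [hclopen.frontier_eq] at ha
    let g : CompactlySupportedContinuousMap (ι → Bool) ℝ :=
      ⟨⟨fun ω => ind (∀ j ∈ K, ω (τ j) = p j), hcont⟩, HasCompactSupport.of_compactSpace _⟩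
    have h1 := RealRMK.integral_rieszMeasure Λ g
    change ∫ ω : ι → Bool, ind (∀ j ∈ K, ω (τ j) = p j) ∂_ =
      M fun x => ind (∀ j ∈ K, φ x (τ j) = p j) at h1
    rw [← h1, ← integral_indicator_one hclopen.1.measurableSet]
    congr 1
  refine ⟨RealRMK.rieszMeasure Λ, ⟨?_⟩, key⟩
  have h0 := key ∅ id fun _ => true
  simp only [Finset.notMem_empty, false_imp_iff, implies_true, Set.ofPred_true, ind_true] at h0
  rw [M.const, measureReal_def] at h0
  rwa [ENNReal.toReal_eq_one_iff] at h0

/-- The `σ`-algebra generated by a set of coordinates. -/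
@[reducible]
def cyl (D : Set ι) : MeasurableSpace (ι → Bool) :=
  MeasurableSpace.comap (fun ω (j : D) => ω j) MeasurableSpace.pi

lemma measurable_apply_cyl {D : Set ι} {j : ι} (hj : j ∈ D) :
    Measurable[cyl D] fun ω : ι → Bool => ω j :=
  (measurable_pi_apply (X := fun _ : D => Bool) ⟨j, hj⟩).comp
    (comap_measurable fun (ω : ι → Bool) (j : D) => ω j)

lemma cyl_le_iff {D : Set ι} {m : MeasurableSpace (ι → Bool)} :
    cyl D ≤ m ↔ ∀ j ∈ D, Measurable[m] fun ω : ι → Bool => ω j := by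
  refine ⟨fun h j hj => (measurable_apply_cyl hj).mono h le_rfl, fun h => ?_⟩
  rw [cyl, ← measurable_iff_comap_le]
  exact (@measurable_pi_iff _ _ _ m _ _).2 fun j => h j j.2

lemma cyl_mono {D D' : Set ι} (h : D ⊆ D') : cyl D ≤ cyl D' :=
  cyl_le_iff.2 fun _ hj => measurable_apply_cyl (h hj)

lemma cyl_le (D : Set ι) : cyl D ≤ MeasurableSpace.pi :=
  cyl_le_iff.2 fun j _ => measurable_pi_apply j

lemma comap_cyl {D : Set κ} (τ : κ → ι) :
    (MeasurableSpace.pi : MeasurableSpace (D → Bool)).comap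
      (fun (ω : ι → Bool) (j : D) => ω (τ j)) = cyl (τ '' D) := by
  refine le_antisymm ?_ ?_
  · rw [← measurable_iff_comap_le]
    exact (@measurable_pi_iff _ _ _ (cyl (τ '' D)) _ _).2 fun j =>
      measurable_apply_cyl (Set.mem_image_of_mem τ j.2)
  · refine cyl_le_iff.2 ?_
    rintro _ ⟨j, hj, rfl⟩
    exact (measurable_pi_apply (X := fun _ : D => Bool) ⟨j, hj⟩).comp
      (comap_measurable fun (ω : ι → Bool) (j : D) => ω (τ j))

lemma UnitRV.congr_cyl {D : Set ι} {f : (ι → Bool) → ℝ} (hf : UnitRV (cyl D) f) {ω ω' : ι → Bool}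
    (h : ∀ j ∈ D, ω j = ω' j) : f ω = f ω' := by
  obtain ⟨g, -, rfl⟩ := hf.meas.exists_eq_measurable_comp
  refine congrArg g (funext fun j => h j j.2)

/-- The coordinates in `K₀` have the same joint law after the substitutions `τ` and `τ'`. -/
def SameLaw (P : Measure (ι → Bool)) (τ τ' : ι → ι) (K₀ : Set ι) : Prop :=
  ∀ (K : Finset ι), ↑K ⊆ K₀ → ∀ p : ι → Bool,
    P.real {ω | ∀ j ∈ K, ω (τ j) = p j} = P.real {ω | ∀ j ∈ K, ω (τ' j) = p j}

variable {P : Measure (ι → Bool)} [IsProbabilityMeasure P] {τ τ' : ι → ι} {K₀ : Set ι}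

lemma measurable_restr (τ : ι → ι) (K₀ : Set ι) :
    Measurable fun (ω : ι → Bool) (j : K₀) => ω (τ j) :=
  measurable_pi_iff.2 fun _ => measurable_pi_apply _

/-- Finite-dimensional distributions determine the law. -/
lemma SameLaw.map_eq (h : SameLaw P τ τ' K₀) :
    P.map (fun ω (j : K₀) => ω (τ j)) = P.map fun ω (j : K₀) => ω (τ' j) := by
  classical
  have : ∀ J : Finset K₀, IsFiniteMeasure
      ((P.map (fun ω (j : K₀) => ω (τ j))).map J.restrict) := fun J => by
    have := Measure.isFiniteMeasure_map P (fun ω (j : K₀) => ω (τ j))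
    exact Measure.isFiniteMeasure_map _ _
  refine IsProjectiveLimit.unique
    (P := fun J : Finset K₀ => (P.map (fun ω (j : K₀) => ω (τ j))).map J.restrict)
    (fun J => rfl) fun J => ?_
  have hr : Measurable (J.restrict (π := fun _ : K₀ => Bool)) := Finset.measurable_restrict J
  dsimp only
  rw [Measure.map_map hr (measurable_restr τ' K₀), Measure.map_map hr (measurable_restr τ K₀)]
  refine Measure.ext_of_singleton fun p => ?_
  rw [Measure.map_apply (hr.comp (measurable_restr τ' K₀)) (measurableSet_singleton p),
    Measure.map_apply (hr.comp (measurable_restr τ K₀)) (measurableSet_singleton p)]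
  set p' : ι → Bool := fun j => if hj : ∃ h : j ∈ K₀, (⟨j, h⟩ : K₀) ∈ J then
    p ⟨⟨j, hj.choose⟩, hj.choose_spec⟩ else true
  have hset : ∀ σ : ι → ι, (J.restrict (π := fun _ : K₀ => Bool) ∘
      fun (ω : ι → Bool) (j : K₀) => ω (σ j)) ⁻¹' {p} =
      {ω | ∀ j ∈ J.map (Embedding.subtype _), ω (σ j) = p' j} := by
    intro σ
    ext ω
    simp only [Set.mem_preimage, Set.mem_singleton_iff, Set.mem_ofPred_eq, funext_iff,
      Finset.mem_map, Embedding.subtype_apply, Subtype.exists, exists_and_right, exists_eq_right]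
    constructor
    · intro h j hj
      have := h ⟨⟨j, hj.choose⟩, hj.choose_spec⟩
      simp only [p', dif_pos hj]
      exact this
    · intro h j
      have hj : ∃ h : (j : K₀).1 ∈ K₀, (⟨j.1, h⟩ : K₀) ∈ J := ⟨j.1.2, j.2⟩
      have := h j.1 hj
      simp only [p', dif_pos hj] at this
      exact this
  have := h (J.map (Embedding.subtype _)) (by
    intro j hj
    simp only [Finset.coe_map, Embedding.subtype_apply, Set.mem_image] at hj
    obtain ⟨i, -, rfl⟩ := hj
    exact i.2) p'
  rw [hset, hset]
  rw [measureReal_def, measureReal_def, ENNReal.toReal_eq_toReal_iff' (measure_ne_top _ _)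
    (measure_ne_top _ _)] at this
  exact this.symm

lemma SameLaw.integral_eq (h : SameLaw P τ τ' K₀) {f : (ι → Bool) → ℝ} (hf : UnitRV (cyl K₀) f) :
    ∫ ω, f (fun j => ω (τ j)) ∂P = ∫ ω, f (fun j => ω (τ' j)) ∂P := by
  obtain ⟨g, hg, rfl⟩ := hf.meas.exists_eq_measurable_comp
  have := h.map_eq
  change ∫ ω, g (fun j : K₀ => ω (τ j)) ∂P = ∫ ω, g (fun j : K₀ => ω (τ' j)) ∂P
  rw [← integral_map (f := g) (measurable_restr τ K₀).aemeasurable hg.aestronglyMeasurable, this,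
    integral_map (measurable_restr τ' K₀).aemeasurable hg.aestronglyMeasurable]

/-- Conditional expectations on `τ '' D` reduce to smaller sets of coordinates containing a copy
`τ' '' D` with the same joint law. -/
lemma SameLaw.condE_eq (h : SameLaw P τ τ' K₀) {f : (ι → Bool) → ℝ} {B D D₁ D₂ : Set ι}
    (hf : UnitRV (cyl B) f) (hB : ∀ e ∈ B, ∃ j ∈ K₀, τ j = e ∧ τ' j = e) (hD : D ⊆ K₀)
    (h1 : ∀ j ∈ D, τ' j ∈ D₁) (h12 : D₁ ⊆ D₂) (h2 : ∀ e ∈ D₂, ∃ j ∈ D, τ j = e)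
    (h3 : ∀ j ∈ D, τ j ∈ D₂) :
    condE P (cyl D₂) f =ᵐ[P] condE P (cyl D₁) f := by
  have hτ : τ '' D = D₂ := Set.Subset.antisymm (by rintro _ ⟨j, hj, rfl⟩; exact h3 j hj)
    fun e he => h2 e he
  have hcom := comap_cyl (D := D) τ
  have hcom' := comap_cyl (D := D) τ'
  rw [hτ] at hcom
  rw [← hcom]
  -- Each coordinate `e` read by `f` has a name `s e` that both substitutions send to `e`. So the
  -- same map `η ↦ (f, D)` applied to either restricted array produces `f` itself, and the two joint
  -- laws agree.
  choose! s hs hsτ hsτ' using hB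
  obtain ⟨g, hg, rfl⟩ := hf.meas.exists_eq_measurable_comp
  have hΦ : Measurable fun η : K₀ → Bool =>
      ((g fun e : B => η ⟨s e, hs e e.2⟩, fun j : D => η ⟨j, hD j.2⟩) : ℝ × (D → Bool)) := by
    refine (hg.comp ?_).prodMk ?_
    · exact measurable_pi_iff.2 fun _ => measurable_pi_apply _
    · exact measurable_pi_iff.2 fun _ => measurable_pi_apply _
  refine condE_eq_of_law (U' := fun ω (j : D) => ω (τ' j)) (hf.mono (cyl_le B))
    (measurable_restr τ D) (measurable_restr τ' D) ?_ ?_ ?_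
  · have := congrArg (Measure.map fun η : K₀ → Bool =>
      ((g fun e : B => η ⟨s e, hs e e.2⟩, fun j : D => η ⟨j, hD j.2⟩) : ℝ × (D → Bool))) h.map_eq
    rw [Measure.map_map hΦ (measurable_restr τ K₀), Measure.map_map hΦ (measurable_restr τ' K₀)]
      at this
    convert this using 2
    · ext1 ω
      simp only [Function.comp, hsτ _ (Subtype.prop _)]
    · ext1 ω
      simp only [Function.comp, hsτ' _ (Subtype.prop _)]
  · rw [hcom']
    refine cyl_mono ?_
    rintro _ ⟨j, hj, rfl⟩
    exact h1 j hj
  · rw [hcom]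
    exact cyl_mono h12

end Cylinder

/-! ### Edges between sets of vertices, and renamings. -/

section EdgeSets

open MeasureTheory

variable {V V' V'' : Type*}

lemma EdgeIdx.map_map (ra rb rc : V → V') (ra' rb' rc' : V' → V'') (j : EdgeIdx V) :
    (j.map ra rb rc).map ra' rb' rc' = j.map (ra' ∘ ra) (rb' ∘ rb) (rc' ∘ rc) := by
  obtain ⟨k, x, y⟩ := j
  fin_cases k <;> rfl

lemma EdgeIdx.map_id (j : EdgeIdx V) : j.map id id id = j := by
  obtain ⟨k, x, y⟩ := j
  fin_cases k <;> rfl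

lemma edgeSet_mono {A B C A' B' C' : Set V} (hA : A ⊆ A') (hB : B ⊆ B') (hC : C ⊆ C') :
    edgeSet A B C ⊆ edgeSet A' B' C' := by
  rintro ⟨k, x, y⟩ h
  fin_cases k
  exacts [⟨hA h.1, hB h.2⟩, ⟨hA h.1, hC h.2⟩, ⟨hB h.1, hC h.2⟩]

lemma EdgeIdx.map_mem {ra rb rc : V → V'} {A B C : Set V} {A' B' C' : Set V'}
    (hA : ∀ x ∈ A, ra x ∈ A') (hB : ∀ x ∈ B, rb x ∈ B') (hC : ∀ x ∈ C, rc x ∈ C')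
    {j : EdgeIdx V} (hj : j ∈ edgeSet A B C) : j.map ra rb rc ∈ edgeSet A' B' C' := by
  obtain ⟨k, x, y⟩ := j
  fin_cases k
  exacts [⟨hA _ hj.1, hB _ hj.2⟩, ⟨hA _ hj.1, hC _ hj.2⟩, ⟨hB _ hj.1, hC _ hj.2⟩]

lemma exists_map_eq {ra rb rc ra' rb' rc' : V → V'} {A B C : Set V} {A' B' C' : Set V'}
    (hA : ∀ x ∈ A', ∃ y ∈ A, ra y = x ∧ ra' y = x) (hB : ∀ x ∈ B', ∃ y ∈ B, rb y = x ∧ rb' y = x)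
    (hC : ∀ x ∈ C', ∃ y ∈ C, rc y = x ∧ rc' y = x) {e : EdgeIdx V'} (he : e ∈ edgeSet A' B' C') :
    ∃ j ∈ edgeSet A B C, j.map ra rb rc = e ∧ j.map ra' rb' rc' = e := by
  obtain ⟨k, x, y⟩ := e
  fin_cases k
  · obtain ⟨x, hx, rfl, hx'⟩ := hA _ he.1
    obtain ⟨y, hy, rfl, hy'⟩ := hB _ he.2
    refine ⟨(0, x, y), ⟨hx, hy⟩, rfl, ?_⟩
    simp [EdgeIdx.map, hx', hy']
  · obtain ⟨x, hx, rfl, hx'⟩ := hA _ he.1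
    obtain ⟨y, hy, rfl, hy'⟩ := hC _ he.2
    refine ⟨(1, x, y), ⟨hx, hy⟩, rfl, ?_⟩
    simp [EdgeIdx.map, hx', hy']
  · obtain ⟨x, hx, rfl, hx'⟩ := hB _ he.1
    obtain ⟨y, hy, rfl, hy'⟩ := hC _ he.2
    refine ⟨(2, x, y), ⟨hx, hy⟩, rfl, ?_⟩
    simp [EdgeIdx.map, hx', hy']

lemma exists_map_eq' {ra rb rc : V → V'} {A B C : Set V} {A' B' C' : Set V'}
    (hA : ∀ x ∈ A', ∃ y ∈ A, ra y = x) (hB : ∀ x ∈ B', ∃ y ∈ B, rb y = x)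
    (hC : ∀ x ∈ C', ∃ y ∈ C, rc y = x) {e : EdgeIdx V'} (he : e ∈ edgeSet A' B' C') :
    ∃ j ∈ edgeSet A B C, j.map ra rb rc = e := by
  obtain ⟨j, hj, h, -⟩ := exists_map_eq (ra := ra) (rb := rb) (rc := rc) (ra' := ra) (rb' := rb)
    (rc' := rc) (A := A) (B := B) (C := C) (by simpa using hA) (by simpa using hB)
    (by simpa using hC) he
  exact ⟨j, hj, h⟩

variable {P : Measure (EdgeIdx V → Bool)} [IsProbabilityMeasure P]
  {ra rb rc ra' rb' rc' : V → V} {V₀ A B C A₀ B₀ C₀ A₁ B₁ C₁ A₂ B₂ C₂ : Set V}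
  {f : (EdgeIdx V → Bool) → ℝ}

/-- Reducing conditional expectations on the edges between given sets of vertices. -/
lemma SameLaw.condE_edgeSet
    (h : SameLaw P (EdgeIdx.map ra rb rc) (EdgeIdx.map ra' rb' rc') (edgeSet V₀ V₀ V₀))
    (hf : UnitRV (cyl (edgeSet A₀ B₀ C₀)) f)
    (hA₀ : ∀ x ∈ A₀, ∃ y ∈ V₀, ra y = x ∧ ra' y = x)
    (hB₀ : ∀ x ∈ B₀, ∃ y ∈ V₀, rb y = x ∧ rb' y = x)
    (hC₀ : ∀ x ∈ C₀, ∃ y ∈ V₀, rc y = x ∧ rc' y = x)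
    (hA : A ⊆ V₀) (hB : B ⊆ V₀) (hC : C ⊆ V₀)
    (hA₁ : ∀ x ∈ A, ra' x ∈ A₁) (hB₁ : ∀ x ∈ B, rb' x ∈ B₁) (hC₁ : ∀ x ∈ C, rc' x ∈ C₁)
    (hA₂ : ∀ x ∈ A, ra x ∈ A₂) (hB₂ : ∀ x ∈ B, rb x ∈ B₂) (hC₂ : ∀ x ∈ C, rc x ∈ C₂)
    (hA₃ : ∀ x ∈ A₂, ∃ y ∈ A, ra y = x) (hB₃ : ∀ x ∈ B₂, ∃ y ∈ B, rb y = x)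
    (hC₃ : ∀ x ∈ C₂, ∃ y ∈ C, rc y = x)
    (hA₄ : A₁ ⊆ A₂) (hB₄ : B₁ ⊆ B₂) (hC₄ : C₁ ⊆ C₂) :
    condE P (cyl (edgeSet A₂ B₂ C₂)) f =ᵐ[P] condE P (cyl (edgeSet A₁ B₁ C₁)) f :=
  h.condE_eq hf (fun _ he => exists_map_eq hA₀ hB₀ hC₀ he) (edgeSet_mono hA hB hC)
    (fun _ hj => EdgeIdx.map_mem hA₁ hB₁ hC₁ hj) (edgeSet_mono hA₄ hB₄ hC₄)
    (fun _ he => exists_map_eq' hA₃ hB₃ hC₃ he) (fun _ hj => EdgeIdx.map_mem hA₂ hB₂ hC₂ hj)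

/-- Reducing the conditional expectation of an edge on the other edges between given sets of
vertices. -/
lemma SameLaw.condE_edge
    (h : SameLaw P (EdgeIdx.map ra rb rc) (EdgeIdx.map ra' rb' rc') (edgeSet V₀ V₀ V₀))
    {e j₀ : EdgeIdx V} (hf : UnitRV (cyl {e}) f) (hj₀ : j₀ ∈ edgeSet V₀ V₀ V₀)
    (he : j₀.map ra rb rc = e) (he' : j₀.map ra' rb' rc' = e)
    (hu : ∀ j ∈ edgeSet A B C, j.map ra rb rc = e → j = j₀)
    (hu' : ∀ j ∈ edgeSet A B C, j.map ra' rb' rc' = e → j = j₀)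
    (hA : A ⊆ V₀) (hB : B ⊆ V₀) (hC : C ⊆ V₀)
    (hA₁ : ∀ x ∈ A, ra' x ∈ A₁) (hB₁ : ∀ x ∈ B, rb' x ∈ B₁) (hC₁ : ∀ x ∈ C, rc' x ∈ C₁)
    (hA₂ : ∀ x ∈ A, ra x ∈ A₂) (hB₂ : ∀ x ∈ B, rb x ∈ B₂) (hC₂ : ∀ x ∈ C, rc x ∈ C₂)
    (hA₃ : ∀ x ∈ A₂, ∃ y ∈ A, ra y = x) (hB₃ : ∀ x ∈ B₂, ∃ y ∈ B, rb y = x)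
    (hC₃ : ∀ x ∈ C₂, ∃ y ∈ C, rc y = x)
    (hA₄ : A₁ ⊆ A₂) (hB₄ : B₁ ⊆ B₂) (hC₄ : C₁ ⊆ C₂) :
    condE P (cyl (edgeSet A₂ B₂ C₂ \ {e})) f =ᵐ[P] condE P (cyl (edgeSet A₁ B₁ C₁ \ {e})) f :=
  h.condE_eq (D := edgeSet A B C \ {j₀}) hf (by rintro _ rfl; exact ⟨j₀, hj₀, he, he'⟩)
    (Set.sdiff_subset.trans (edgeSet_mono hA hB hC))
    (fun j hj => ⟨EdgeIdx.map_mem hA₁ hB₁ hC₁ hj.1, fun h => hj.2 (hu' j hj.1 h)⟩)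
    (Set.sdiff_subset_sdiff_left (edgeSet_mono hA₄ hB₄ hC₄))
    (fun e' he'' => by
      obtain ⟨j, hj, rfl⟩ := exists_map_eq' hA₃ hB₃ hC₃ he''.1
      refine ⟨j, ⟨hj, ?_⟩, rfl⟩
      rintro rfl
      exact he''.2 he)
    (fun j hj => ⟨EdgeIdx.map_mem hA₂ hB₂ hC₂ hj.1, fun h => hj.2 (hu j hj.1 h)⟩)

end EdgeSets

/-! ### Times of order type `ω²`: a front row followed by rows of samples. -/

section Times

/-- The time `(0, n)` in the front row of `ℕ ×ₗ ℕ`. -/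
def frontTime (n : ℕ) : ℕ ×ₗ ℕ := toLex (0, n)

/-- The vertex of the time `(0, n)`. -/
def frontVtx (n : ℕ) : Option (ℕ ×ₗ ℕ) := some (frontTime n)

/-- The vertices of the times outside the front row. -/
def sampleVtx : Set (Option (ℕ ×ₗ ℕ)) := {x | ∃ a b, x = some (toLex (a + 1, b))}

/-- The vertices of the times starting with `(0, n)`. -/
def lateVtx (n : ℕ) : Set (Option (ℕ ×ₗ ℕ)) := sampleVtx ∪ frontVtx '' Set.Ici n

lemma sampleVtx_subset (n : ℕ) : sampleVtx ⊆ lateVtx n := Set.subset_union_left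

lemma lateVtx_mono {m n : ℕ} (h : m ≤ n) : lateVtx n ⊆ lateVtx m :=
  Set.union_subset_union_right _ (Set.image_mono (Set.Ici_subset_Ici.2 h))

lemma frontVtx_mem {m n : ℕ} (h : m ≤ n) : frontVtx n ∈ lateVtx m := .inr ⟨n, h, rfl⟩

lemma frontVtx_injective : Injective frontVtx := fun m n h => by
  simpa [frontVtx, frontTime] using h

/-- Moving the times in the front row by `h` and the other rows by `s`. -/
def moveTime (h : ℕ → ℕ × ℕ) (s : ℕ) (t : ℕ ×ₗ ℕ) : ℕ ×ₗ ℕ :=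
  if (ofLex t).1 = 0 then toLex (h (ofLex t).2) else toLex ((ofLex t).1 + s, (ofLex t).2)

/-- The order type leaves room for the front row to be spread out or to have its tail placed in a
later row, if the other rows are raised by at least the highest row that `h` uses. -/
lemma strictMono_moveTime {h : ℕ → ℕ × ℕ} {s : ℕ} (h1 : StrictMono fun n => toLex (h n))
    (h2 : ∀ n, (h n).1 ≤ s) : StrictMono (moveTime h s) := by
  intro t t' htt
  rw [Prod.Lex.lt_iff] at htt
  unfold moveTime
  split_ifs with a b b
  · rcases htt with htt | htt
    · omega
    · exact h1 htt.2
  · rw [Prod.Lex.toLex_lt_toLex]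
    left
    have := h2 (ofLex t).2
    simp only
    omega
  · omega
  · rw [Prod.Lex.toLex_lt_toLex]
    simp only
    omega

lemma map_moveTime_front (h : ℕ → ℕ × ℕ) (s n : ℕ) :
    (frontVtx n).map (moveTime h s) = some (toLex (h n)) := rfl

lemma map_moveTime_sample (h : ℕ → ℕ × ℕ) {x : Option (ℕ ×ₗ ℕ)} (hx : x ∈ sampleVtx) :
    x.map (moveTime h 0) = x := by
  obtain ⟨a, b, rfl⟩ := hx
  rfl

lemma map_moveTime_mem_sample (h : ℕ → ℕ × ℕ) (s : ℕ) {x : Option (ℕ ×ₗ ℕ)} (hx : x ∈ sampleVtx) :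
    x.map (moveTime h s) ∈ sampleVtx := by
  obtain ⟨a, b, rfl⟩ := hx
  refine ⟨a + s, b, ?_⟩
  simp [moveTime, add_right_comm]

lemma putVtx_late {T : Type*} (t : T) {x : Option T} (hx : x ≠ none) : putVtx t x = x := by
  cases x
  exacts [absurd rfl hx, rfl]

lemma ne_none_of_mem_lateVtx {n : ℕ} {x : Option (ℕ ×ₗ ℕ)} (hx : x ∈ lateVtx n) : x ≠ none := by
  rintro rfl
  obtain ⟨a, b, h⟩ | ⟨k, -, h⟩ := hx <;> cases h

/-- The vertices of patterns. -/
def patternVtx : Set (Option (ℕ ×ₗ ℕ)) := insert none (lateVtx 3)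

lemma lt_of_mem_lateVtx {n : ℕ} {t : ℕ ×ₗ ℕ} (h : some t ∈ lateVtx (n + 1)) : frontTime n < t := by
  obtain ⟨a, b, h⟩ | ⟨k, hk, h⟩ := h
  · rw [Option.some.inj h]
    exact (Prod.Lex.toLex_lt_toLex).2 (.inl (Nat.succ_pos a))
  · rw [← Option.some.inj h]
    exact (Prod.Lex.toLex_lt_toLex).2 (.inr ⟨rfl, hk⟩)

lemma timesOf_late {K : Finset (EdgeIdx (Option (ℕ ×ₗ ℕ)))}
    (hK : ↑K ⊆ edgeSet patternVtx patternVtx patternVtx) : ∀ t ∈ timesOf K, frontTime 2 < t := by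
  intro t ht
  simp only [timesOf, Finset.mem_biUnion, Finset.mem_union, Option.mem_toFinset,
    Option.mem_def] at ht
  obtain ⟨⟨k, x, y⟩, hj, ht⟩ := ht
  have h : x ∈ patternVtx ∧ y ∈ patternVtx := by
    have := hK hj
    fin_cases k <;> exact this
  have key : some t ∈ patternVtx := by
    rcases ht with ht | ht
    exacts [ht ▸ h.1, ht ▸ h.2]
  exact lt_of_mem_lateVtx (key.resolve_left (by simp))

lemma frontTime_lt {m n : ℕ} (h : m < n) : frontTime m < frontTime n :=
  (Prod.Lex.toLex_lt_toLex).2 (.inr ⟨rfl, h⟩)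

end Times

/-! ### Symmetries of the law of the edge array. -/

section ArrayMeasure

open MeasureTheory

variable {G Z : Type*} [Group G] (I : InvMean G) (S : BiSystem G Z) (f : Z → Bool)

instance : Countable (ℕ ×ₗ ℕ) := inferInstanceAs (Countable (ℕ × ℕ))

/-- The measure represents the mean of the edge values of the array. -/
def IsArrayMeasure (P : Measure (EdgeIdx (Option (ℕ ×ₗ ℕ)) → Bool)) : Prop :=
  ∀ (K : Finset (EdgeIdx (Option (ℕ ×ₗ ℕ))))
    (τ : EdgeIdx (Option (ℕ ×ₗ ℕ)) → EdgeIdx (Option (ℕ ×ₗ ℕ)))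
    (p : EdgeIdx (Option (ℕ ×ₗ ℕ)) → Bool),
    P.real {ω | ∀ j ∈ K, ω (τ j) = p j} = arrayMean (tripleMean I) S.mean (1 : G × G × G)
      fun q : ((ℕ ×ₗ ℕ) → G × G × G) × Z => ind (∀ j ∈ K, edgeVal S f (vtx 1 q.1) q.2 (τ j) = p j)

lemma exists_isArrayMeasure : ∃ P, IsProbabilityMeasure P ∧ IsArrayMeasure I S f P :=
  exists_measure_of_mean _ fun q : ((ℕ ×ₗ ℕ) → G × G × G) × Z => edgeVal S f (vtx 1 q.1) q.2

variable {I S f} {P : Measure (EdgeIdx (Option (ℕ ×ₗ ℕ)) → Bool)} (hP : IsArrayMeasure I S f P)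

include hP

lemma IsArrayMeasure.sameLaw_rename {r : (ℕ ×ₗ ℕ) → (ℕ ×ₗ ℕ)} (hr : StrictMono r) :
    SameLaw P (EdgeIdx.map id id id)
      (EdgeIdx.map (Option.map r) (Option.map r) (Option.map r))
      (edgeSet Set.univ Set.univ Set.univ) := by
  intro K _ p
  have h := patternProb_rename I f (S := S) hr K p (EdgeIdx.map id id id)
  rw [hP, ← h, hP]
  simp only [EdgeIdx.map_id]

/-- Both sides are the average over `g` of the pattern probability at `(1, 1, g)`. This lets the
vertices `b` and `c` trade their places in time. -/
lemma IsArrayMeasure.sameLaw_swap {r : (ℕ ×ₗ ℕ) → (ℕ ×ₗ ℕ)} (hr : StrictMono r) :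
    SameLaw P
      (EdgeIdx.map (putVtx (frontTime 0)) (putVtx (frontTime 1)) (putVtx (frontTime 2)))
      (EdgeIdx.map (Option.map r ∘ putVtx (frontTime 0)) (Option.map r ∘ putVtx (frontTime 2))
        (Option.map r ∘ putVtx (frontTime 1))) (edgeSet patternVtx patternVtx patternVtx) := by
  intro K hK p
  have h := patternProb_rename I f (S := S) hr K p
    (EdgeIdx.map (putVtx (frontTime 0)) (putVtx (frontTime 2)) (putVtx (frontTime 1)))
  have h1 := patternProb_front I f (S := S) (frontTime_lt zero_lt_one) (frontTime_lt one_lt_two)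
    (timesOf_late hK) p
  have h2 := patternProb_front_swap I f (S := S) (frontTime_lt zero_lt_one)
    (frontTime_lt one_lt_two) (timesOf_late hK) p
  simp only [EdgeIdx.map_map] at h
  rw [hP, hP, h, h1, h2]

lemma IsArrayMeasure.real_front {K : Finset (EdgeIdx (Option (ℕ ×ₗ ℕ)))}
    (hK : ↑K ⊆ edgeSet patternVtx patternVtx patternVtx) (p : EdgeIdx (Option (ℕ ×ₗ ℕ)) → Bool) :
    P.real {ω | ∀ j ∈ K, ω (j.map (putVtx (frontTime 0)) (putVtx (frontTime 1))
      (putVtx (frontTime 2))) = p j} = I.toFun fun g => patternProb I S f (1, 1, g) K p := by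
  rw [hP, patternProb_front I f (S := S) (frontTime_lt zero_lt_one) (frontTime_lt one_lt_two)
    (timesOf_late hK) p]

/-- When a class is missing, the average over `g` is over a constant. Two random vertices therefore
look like two vertices of the degenerate triangle. -/
lemma IsArrayMeasure.sameLaw_one {A B C : Set (Option (ℕ ×ₗ ℕ))} (hA : A ⊆ patternVtx)
    (hB : B ⊆ patternVtx) (hC : C ⊆ patternVtx) (hABC : none ∉ A ∨ none ∉ B ∨ none ∉ C) :
    SameLaw P
      (EdgeIdx.map (putVtx (frontTime 0)) (putVtx (frontTime 1)) (putVtx (frontTime 2)))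
      id (edgeSet A B C) := by
  intro K hK p
  rw [hP.real_front (hK.trans (edgeSet_mono hA hB hC)), hP]
  simp only [fun g => patternProb_one I f (S := S) hABC (fun j hj => hK hj) p g]
  rw [I.toFinMean.const]
  rfl

end ArrayMeasure

/-! ### Conditional independence in the array. -/

section Instances

open MeasureTheory

variable {G Z : Type*} [Group G] {I : InvMean G} {S : BiSystem G Z} {f : Z → Bool}
  {P : Measure (EdgeIdx (Option (ℕ ×ₗ ℕ)) → Bool)} [IsProbabilityMeasure P]
  (hP : IsArrayMeasure I S f P) {Y : (EdgeIdx (Option (ℕ ×ₗ ℕ)) → Bool) → ℝ}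

/-- The move of the front row that makes a gap of length `d` after the first `n` times. -/
def gap (n d k : ℕ) : ℕ × ℕ := (0, if k < n then k else k + d)

lemma strictMono_gap (n d : ℕ) : StrictMono (moveTime (gap n d) 0) := by
  refine strictMono_moveTime (fun k l hkl => ?_) fun k => le_rfl
  refine (Prod.Lex.toLex_lt_toLex).2 (.inr ⟨rfl, ?_⟩)
  simp only [gap]
  split_ifs <;> omega

lemma map_gap_front_lt {n d k : ℕ} (h : k < n) :
    (frontVtx k).map (moveTime (gap n d) 0) = frontVtx k := by
  rw [map_moveTime_front, gap, if_pos h]; rfl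

lemma map_gap_front_ge {n d k : ℕ} (h : n ≤ k) :
    (frontVtx k).map (moveTime (gap n d) 0) = frontVtx (k + d) := by
  rw [map_moveTime_front, gap, if_neg (not_lt.2 h)]; rfl

lemma map_gap_mem {m n d : ℕ} (hmn : n ≤ m) {x : Option (ℕ ×ₗ ℕ)} (h : x ∈ lateVtx m) :
    x.map (moveTime (gap n d) 0) ∈ lateVtx (m + d) := by
  obtain h | ⟨k, hk, rfl⟩ := h
  · exact sampleVtx_subset _ (map_moveTime_mem_sample _ _ h)
  · rw [map_gap_front_ge (hmn.trans hk)]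
    exact frontVtx_mem (Nat.add_le_add_right hk d)

lemma gap_fix {n d : ℕ} {R : Set (Option (ℕ ×ₗ ℕ))} (hR : R ⊆ sampleVtx ∪ frontVtx '' Set.Iio n)
    (x : Option (ℕ ×ₗ ℕ)) (hx : x ∈ R) :
    ∃ y ∈ (Set.univ : Set (Option (ℕ ×ₗ ℕ))), id y = x ∧ y.map (moveTime (gap n d) 0) = x := by
  refine ⟨x, trivial, rfl, ?_⟩
  obtain h | ⟨k, hk, rfl⟩ := hR hx
  · exact map_moveTime_sample _ h
  · exact map_gap_front_lt hk

include hP in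
-- A gap of length `d` after the first `n` front times fixes everything that `Y` reads and pushes
-- the late vertices past it. The pushed copy already carries all the information on `Y`.
lemma IsArrayMeasure.condE_late (n d : ℕ) {A B C : Set (Option (ℕ ×ₗ ℕ))}
    (hA : A ⊆ sampleVtx ∪ frontVtx '' Set.Iio n) (hB : B ⊆ sampleVtx ∪ frontVtx '' Set.Iio n)
    (hC : C ⊆ sampleVtx ∪ frontVtx '' Set.Iio n) (hY : UnitRV (cyl (edgeSet A B C)) Y) :
    condE P (cyl (edgeSet (lateVtx n) (lateVtx n) (lateVtx n))) Y =ᵐ[P]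
      condE P (cyl (edgeSet (lateVtx (n + d)) (lateVtx (n + d)) (lateVtx (n + d)))) Y := by
  have hs := lateVtx_mono (Nat.le_add_right n d)
  have h0 : ∀ x ∈ lateVtx n, ∃ y ∈ lateVtx n, id y = x := fun x hx => ⟨x, hx, rfl⟩
  exact (hP.sameLaw_rename (strictMono_gap n d)).condE_edgeSet hY (gap_fix hA) (gap_fix hB)
    (gap_fix hC) (Set.subset_univ _) (Set.subset_univ _) (Set.subset_univ _)
    (fun _ => map_gap_mem le_rfl) (fun _ => map_gap_mem le_rfl) (fun _ => map_gap_mem le_rfl)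
    (fun _ => id) (fun _ => id) (fun _ => id) h0 h0 h0 hs hs hs

lemma putVtx_mem_of_late {n : ℕ} (t : ℕ ×ₗ ℕ) {x : Option (ℕ ×ₗ ℕ)} (hx : x ∈ lateVtx n) :
    putVtx t x = x := putVtx_late t (ne_none_of_mem_lateVtx hx)

lemma putVtx_gap_fix {k l : ℕ} (h : (frontVtx l).map (moveTime (gap 1 1) 0) = frontVtx k)
    (x : Option (ℕ ×ₗ ℕ)) (hx : x ∈ insert (frontVtx k) sampleVtx) :
    ∃ y ∈ patternVtx, putVtx (frontTime k) y = x ∧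
      (Option.map (moveTime (gap 1 1) 0) ∘ putVtx (frontTime l)) y = x := by
  rcases hx with rfl | hx
  · exact ⟨none, .inl rfl, rfl, h⟩
  · refine ⟨x, .inr (sampleVtx_subset _ hx), putVtx_mem_of_late _ (sampleVtx_subset 3 hx), ?_⟩
    simp only [Function.comp]
    rw [putVtx_mem_of_late _ (sampleVtx_subset 3 hx), map_moveTime_sample _ hx]

lemma map_gap_putVtx_mem {t : ℕ ×ₗ ℕ} {x : Option (ℕ ×ₗ ℕ)} (hx : x ∈ lateVtx 3) :
    (Option.map (moveTime (gap 1 1) 0) ∘ putVtx t) x ∈ lateVtx 3 := by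
  simp only [Function.comp]
  rw [putVtx_mem_of_late t hx]
  exact lateVtx_mono (by norm_num : 3 ≤ 3 + 1) (map_gap_mem (by norm_num) hx)

include hP in
-- The second-class vertex at time `1` lies between the two front vertices of `Y`, so moving later
-- times does not remove it. After the exchange, `c` is at time `1` and `b` at time `2`; the gap
-- moves them to `2` and `3`, which makes `b` late.
lemma IsArrayMeasure.condE_swap
    (hY : UnitRV (cyl (edgeSet (insert (frontVtx 0) sampleVtx) sampleVtx
      (insert (frontVtx 2) sampleVtx))) Y) :
    condE P (cyl (edgeSet (lateVtx 3) (insert (frontVtx 1) (lateVtx 3)) (lateVtx 3))) Y =ᵐ[P]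
      condE P (cyl (edgeSet (lateVtx 3) (lateVtx 3) (lateVtx 3))) Y := by
  have hl : ∀ t, ∀ x ∈ lateVtx 3, ∃ y ∈ lateVtx 3, putVtx t y = x := fun t x hx =>
    ⟨x, hx, putVtx_mem_of_late t hx⟩
  have hl' : ∀ t, ∀ x ∈ lateVtx 3, putVtx t x ∈ lateVtx 3 := fun t x hx => by
    rwa [putVtx_mem_of_late t hx]
  have e2 : (frontVtx 2).map (moveTime (gap 1 1) 0) = frontVtx 3 := map_gap_front_ge one_le_two
  refine (hP.sameLaw_swap (strictMono_gap 1 1)).condE_edgeSet (A := lateVtx 3) (B := patternVtx)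
    (C := lateVtx 3) hY (putVtx_gap_fix (map_gap_front_lt zero_lt_one)) ?_
    (putVtx_gap_fix (map_gap_front_ge le_rfl)) (Set.subset_insert _ _) subset_rfl
    (Set.subset_insert _ _) (fun _ => map_gap_putVtx_mem) ?_ (fun _ => map_gap_putVtx_mem)
    (hl' _) ?_ (hl' _) (hl _) ?_ (hl _) subset_rfl (Set.subset_insert _ _) subset_rfl
  · intro x hx
    refine ⟨x, .inr (sampleVtx_subset _ hx), putVtx_mem_of_late _ (sampleVtx_subset 3 hx), ?_⟩
    simp only [Function.comp]
    rw [putVtx_mem_of_late _ (sampleVtx_subset 3 hx), map_moveTime_sample _ hx]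
  · rintro x (rfl | hx)
    · exact (congrArg (· ∈ lateVtx 3) e2).mpr (frontVtx_mem le_rfl)
    · exact map_gap_putVtx_mem hx
  · rintro x (rfl | hx)
    · exact .inl rfl
    · exact .inr (hl' _ x hx)
  · rintro x (rfl | hx)
    · exact ⟨none, .inl rfl, rfl⟩
    · exact ⟨x, .inr hx, putVtx_mem_of_late _ hx⟩

/-- The move of the front row that sends the times from `(0, 2)` on to the row `1`. -/
def drop (k : ℕ) : ℕ × ℕ := if k < 2 then (0, k) else (1, k - 2)

lemma strictMono_drop : StrictMono (moveTime drop 1) := by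
  refine strictMono_moveTime (fun k l hkl => ?_) fun k => ?_
  · refine (Prod.Lex.toLex_lt_toLex).2 ?_
    simp only [drop]
    split_ifs <;> simp <;> omega
  · simp only [drop]
    split_ifs <;> simp

lemma map_drop_mem {x : Option (ℕ ×ₗ ℕ)} (h : x ∈ lateVtx 2) :
    x.map (moveTime drop 1) ∈ sampleVtx := by
  obtain h | ⟨k, hk, rfl⟩ := h
  · exact map_moveTime_mem_sample _ _ h
  · rw [map_moveTime_front, drop, if_neg (not_lt.2 hk)]
    exact ⟨0, _, rfl⟩

/-- The move of the front row that sends the times from `(0, 2)` on to the row `1` and `(0, 1)` to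
`(0, 2)`. -/
def dropSwap (k : ℕ) : ℕ × ℕ := if k < 2 then (0, 2 * k) else (1, k - 2)

lemma strictMono_dropSwap : StrictMono (moveTime dropSwap 1) := by
  refine strictMono_moveTime (fun k l hkl => ?_) fun k => ?_
  · refine (Prod.Lex.toLex_lt_toLex).2 ?_
    simp only [dropSwap]
    split_ifs <;> simp <;> omega
  · simp only [dropSwap]
    split_ifs <;> simp

lemma map_dropSwap_mem {x : Option (ℕ ×ₗ ℕ)} (h : x ∈ lateVtx 2) :
    x.map (moveTime dropSwap 1) ∈ sampleVtx := by
  obtain h | ⟨k, hk, rfl⟩ := h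
  · exact map_moveTime_mem_sample _ _ h
  · rw [map_moveTime_front, dropSwap, if_neg (not_lt.2 hk)]
    exact ⟨0, _, rfl⟩

lemma frontVtx_notMem_sample (k : ℕ) : frontVtx k ∉ sampleVtx := by
  rintro ⟨a, b, h⟩
  have := congrArg (fun t => (ofLex t).1) (Option.some.inj h)
  simp [frontTime] at this

lemma frontVtx_notMem_late {k n : ℕ} (h : k < n) : frontVtx k ∉ lateVtx n := by
  rintro (h' | ⟨l, hl, h'⟩)
  · exact frontVtx_notMem_sample k h'
  · rw [frontVtx_injective h'] at hl
    exact absurd hl (not_le.2 h)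

include hP in
-- `drop` fixes the ends of the edge and moves all other vertices, including the third vertex of the
-- triangle, among the samples.
lemma IsArrayMeasure.condE_edge_zero
    (hY : UnitRV (cyl {((0 : Fin 3), frontVtx 0, frontVtx 1)}) Y) :
    condE P (cyl (edgeSet (insert (frontVtx 0) (lateVtx 2)) (insert (frontVtx 1) (lateVtx 2))
      (lateVtx 2) \ {((0 : Fin 3), frontVtx 0, frontVtx 1)})) Y =ᵐ[P]
      condE P (cyl (edgeSet (insert (frontVtx 0) sampleVtx) (insert (frontVtx 1) sampleVtx)
        sampleVtx \ {((0 : Fin 3), frontVtx 0, frontVtx 1)})) Y := by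
  have hi : ∀ {X : Set (Option (ℕ ×ₗ ℕ))}, ∀ x ∈ X, ∃ y ∈ X, id y = x := fun x hx => ⟨x, hx, rfl⟩
  have e0 : (frontVtx 0).map (moveTime drop 1) = frontVtx 0 := rfl
  have e1 : (frontVtx 1).map (moveTime drop 1) = frontVtx 1 := rfl
  have hinj : Injective (Option.map (moveTime drop 1)) :=
    Option.map_injective strictMono_drop.injective
  refine (hP.sameLaw_rename strictMono_drop).condE_edge
    (A := insert (frontVtx 0) (lateVtx 2)) (B := insert (frontVtx 1) (lateVtx 2)) (C := lateVtx 2)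
    (j₀ := (0, frontVtx 0, frontVtx 1)) hY ⟨trivial, trivial⟩ rfl rfl
    (fun j _ h => by rwa [EdgeIdx.map_id] at h) ?_ (Set.subset_univ _) (Set.subset_univ _)
    (Set.subset_univ _) ?_ ?_ (fun _ => map_drop_mem) (fun _ => id) (fun _ => id) (fun _ => id)
    hi hi hi (Set.insert_subset_insert (sampleVtx_subset 2))
    (Set.insert_subset_insert (sampleVtx_subset 2)) (sampleVtx_subset 2)
  · rintro ⟨k, x, y⟩ - h
    fin_cases k
    · simp only [EdgeIdx.map, Prod.mk.injEq, true_and] at h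
      have hx := hinj (h.1.trans e0.symm)
      have hy := hinj (h.2.trans e1.symm)
      rw [hx, hy]; rfl
    · cases (Prod.mk.inj h).1
    · cases (Prod.mk.inj h).1
  · rintro x (rfl | hx)
    exacts [.inl rfl, .inr (map_drop_mem hx)]
  · rintro x (rfl | hx)
    exacts [.inl rfl, .inr (map_drop_mem hx)]

include hP in
-- As for the edge `ab`, but with `b` between `a` and `c`, so the exchange comes first. Then
-- `dropSwap` returns `c` from time `1` to time `2` and sends `b` from time `2` to the samples.
lemma IsArrayMeasure.condE_edge_one
    (hY : UnitRV (cyl {((1 : Fin 3), frontVtx 0, frontVtx 2)}) Y) :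
    condE P (cyl (edgeSet (insert (frontVtx 0) (lateVtx 3)) (insert (frontVtx 1) (lateVtx 3))
      (insert (frontVtx 2) (lateVtx 3)) \ {((1 : Fin 3), frontVtx 0, frontVtx 2)})) Y =ᵐ[P]
      condE P (cyl (edgeSet (insert (frontVtx 0) sampleVtx) sampleVtx
        (insert (frontVtx 2) sampleVtx) \ {((1 : Fin 3), frontVtx 0, frontVtx 2)})) Y := by
  have hsurj : ∀ k, ∀ x ∈ insert (frontVtx k) (lateVtx 3),
      ∃ y ∈ patternVtx, putVtx (frontTime k) y = x := by
    rintro k x (rfl | hx)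
    exacts [⟨none, .inl rfl, rfl⟩, ⟨x, .inr hx, putVtx_mem_of_late _ hx⟩]
  have hput : ∀ k, ∀ x ∈ patternVtx, putVtx (frontTime k) x ∈ insert (frontVtx k) (lateVtx 3) := by
    rintro k x (rfl | hx)
    · exact .inl rfl
    · rw [putVtx_mem_of_late _ hx]; exact .inr hx
  have hinj : ∀ k, k < 3 → ∀ x ∈ patternVtx, putVtx (frontTime k) x = frontVtx k → x = none := by
    rintro k hk x (rfl | hx) h
    · rfl
    · rw [putVtx_mem_of_late _ hx] at h
      exact absurd (h ▸ hx) (frontVtx_notMem_late hk)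
  have hlate : ∀ t, ∀ x ∈ lateVtx 3,
      (Option.map (moveTime dropSwap 1) ∘ putVtx t) x ∈ sampleVtx := by
    intro t x hx
    simp only [Function.comp]
    rw [putVtx_mem_of_late t hx]
    exact map_dropSwap_mem (lateVtx_mono (by norm_num) hx)
  have hmem : ∀ k l, (frontVtx l).map (moveTime dropSwap 1) = frontVtx k → ∀ x ∈ patternVtx,
      (Option.map (moveTime dropSwap 1) ∘ putVtx (frontTime l)) x ∈
        insert (frontVtx k) sampleVtx := by
    rintro k l h x (rfl | hx)
    exacts [.inl h, .inr (hlate _ x hx)]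
  have hinj' : ∀ k l, (Option.map (moveTime dropSwap 1) ∘ putVtx (frontTime l)) none = frontVtx k →
      ∀ x ∈ patternVtx, (Option.map (moveTime dropSwap 1) ∘ putVtx (frontTime l)) x = frontVtx k →
        x = none := by
    rintro k l h x (rfl | hx) h'
    · rfl
    · exact absurd (h' ▸ hlate _ x hx) (frontVtx_notMem_sample k)
  refine (hP.sameLaw_swap strictMono_dropSwap).condE_edge
    (A := patternVtx) (B := patternVtx) (C := patternVtx) (j₀ := (1, none, none)) hY
    ⟨.inl rfl, .inl rfl⟩ rfl rfl ?_ ?_ subset_rfl subset_rfl subset_rfl (hmem 0 0 rfl) ?_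
    (hmem 2 1 rfl) (hput 0) (hput 1) (hput 2) (hsurj 0) (hsurj 1) (hsurj 2)
    (Set.insert_subset_insert (sampleVtx_subset 3))
    ((sampleVtx_subset 3).trans (Set.subset_insert _ _))
    (Set.insert_subset_insert (sampleVtx_subset 3))
  · rintro ⟨k, x, y⟩ hj h
    fin_cases k
    · cases (Prod.mk.inj h).1
    · simp only [EdgeIdx.map, Prod.mk.injEq, true_and] at h
      rw [hinj 0 (by norm_num) x hj.1 h.1, hinj 2 (by norm_num) y hj.2 h.2]; rfl
    · cases (Prod.mk.inj h).1
  · rintro ⟨k, x, y⟩ hj h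
    fin_cases k
    · cases (Prod.mk.inj h).1
    · simp only [EdgeIdx.map, Prod.mk.injEq, true_and] at h
      rw [hinj' 0 0 rfl x hj.1 h.1, hinj' 2 1 rfl y hj.2 h.2]; rfl
    · cases (Prod.mk.inj h).1
  · rintro x (rfl | hx)
    · exact map_dropSwap_mem (frontVtx_mem le_rfl)
    · exact hlate _ x hx

end Instances

/-! ### Finite approximations of the neighbourhood of a vertex. -/

section Cells

open MeasureTheory

/-- An enumeration of the vertices outside the front row. -/
def sampleEnum (i : ℕ) : Option (ℕ ×ₗ ℕ) := some (toLex (i.unpair.1 + 1, i.unpair.2))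

lemma sampleEnum_mem (i : ℕ) : sampleEnum i ∈ sampleVtx := ⟨_, _, rfl⟩

lemma exists_sampleEnum {x : Option (ℕ ×ₗ ℕ)} (hx : x ∈ sampleVtx) : ∃ i, sampleEnum i = x := by
  obtain ⟨a, b, rfl⟩ := hx
  exact ⟨Nat.pair a b, by simp [sampleEnum]⟩

variable {ι : Type*} {a a' b b' : Option (ℕ ×ₗ ℕ) → ι} {D E : Set ι}

/-- The first `n` coordinates in two families of coordinates. -/
def cell (a a' : Option (ℕ ×ₗ ℕ) → ι) (n : ℕ) (ω : ι → Bool) (i : Fin n) : Bool × Bool :=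
  (ω (a (sampleEnum i)), ω (a' (sampleEnum i)))

lemma measurable_cell (h : ∀ y ∈ sampleVtx, a y ∈ D ∧ a' y ∈ D) (n : ℕ) :
    Measurable[cyl D] (cell a a' n) :=
  (@measurable_pi_iff _ _ _ (cyl D) _ _).2 fun i =>
    (measurable_apply_cyl (h _ (sampleEnum_mem i)).1).prodMk
      (measurable_apply_cyl (h _ (sampleEnum_mem i)).2)

variable (D a a' b b') in
/-- The filtration adding more and more coordinates in four families to a set of coordinates. -/
def cellFiltration : Filtration ℕ (MeasurableSpace.pi : MeasurableSpace (ι → Bool)) where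
  seq n := cyl D ⊔ MeasurableSpace.comap (fun ω => (cell a a' n ω, cell b b' n ω)) inferInstance
  mono' := by
    intro n k hnk
    refine sup_le_sup_left ?_ _
    rw [← measurable_iff_comap_le]
    have h : Measurable fun p : (Fin k → Bool × Bool) × (Fin k → Bool × Bool) =>
        ((fun i => p.1 (Fin.castLE hnk i), fun i => p.2 (Fin.castLE hnk i)) :
          (Fin n → Bool × Bool) × (Fin n → Bool × Bool)) := by fun_prop
    exact h.comp (comap_measurable fun ω => (cell a a' k ω, cell b b' k ω))
  le' n := by
    refine sup_le (cyl_le D) ?_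
    rw [← measurable_iff_comap_le]
    exact ((measurable_cell (D := Set.univ) (by simp) n).mono (cyl_le _) le_rfl).prodMk
      ((measurable_cell (D := Set.univ) (by simp) n).mono (cyl_le _) le_rfl)

lemma iSup_cellFiltration_le (hD : D ⊆ E) (ha : ∀ y ∈ sampleVtx, a y ∈ E ∧ a' y ∈ E)
    (hb : ∀ y ∈ sampleVtx, b y ∈ E ∧ b' y ∈ E) : ⨆ n, cellFiltration a a' b b' D n ≤ cyl E := by
  refine iSup_le fun n => sup_le (cyl_mono hD) ?_
  rw [← measurable_iff_comap_le]
  exact (measurable_cell ha n).prodMk (measurable_cell hb n)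

lemma le_iSup_cellFiltration (h : ∀ j ∈ E, j ∈ D ∨ ∃ y ∈ sampleVtx, j = a y ∨ j = a' y ∨ j = b y ∨
    j = b' y) : cyl E ≤ ⨆ n, cellFiltration a a' b b' D n := by
  refine cyl_le_iff.2 fun j hj => ?_
  rcases h j hj with hD | ⟨y, hy, hj⟩
  · exact (measurable_apply_cyl hD).mono
      (le_sup_left.trans (le_iSup (fun n => cellFiltration a a' b b' D n) 0)) le_rfl
  · obtain ⟨i, rfl⟩ := exists_sampleEnum hy
    have hle : MeasurableSpace.comap (fun ω => (cell a a' (i + 1) ω, cell b b' (i + 1) ω))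
        inferInstance ≤ ⨆ n, cellFiltration a a' b b' D n :=
      le_sup_right.trans (le_iSup (fun n => cellFiltration a a' b b' D n) (i + 1))
    have hc := (comap_measurable fun ω => (cell a a' (i + 1) ω, cell b b' (i + 1) ω)).mono
      hle le_rfl
    have key : ∀ g : (Fin (i + 1) → Bool × Bool) × (Fin (i + 1) → Bool × Bool) → Bool,
        Measurable g → Measurable[⨆ n, cellFiltration a a' b b' D n]
          fun ω => g (cell a a' (i + 1) ω, cell b b' (i + 1) ω) := fun g hg => hg.comp hc
    rcases hj with rfl | rfl | rfl | rfl
    · exact key (fun p => (p.1 (Fin.last i)).1) (by fun_prop)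
    · exact key (fun p => (p.1 (Fin.last i)).2) (by fun_prop)
    · exact key (fun p => (p.2 (Fin.last i)).1) (by fun_prop)
    · exact key (fun p => (p.2 (Fin.last i)).2) (by fun_prop)

/-- The coordinates as random variables. -/
noncomputable def coordRV (j : ι) (ω : ι → Bool) : ℝ := ind (ω j = true)

lemma coordRV_unit {j : ι} (hj : j ∈ D) : UnitRV (cyl D) (coordRV j) :=
  .ind (s := {ω : ι → Bool | ω j = true}) (measurable_apply_cyl hj (measurableSet_singleton true))

lemma integral_ind {Ω : Type*} [MeasurableSpace Ω] {P : Measure Ω} {p : Ω → Prop}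
    (hp : MeasurableSet {ω | p ω}) : ∫ ω, ind (p ω) ∂P = P.real {ω | p ω} := by
  rw [← integral_indicator_one hp]
  congr 1

lemma measurableSet_pattern (K : Finset ι) (τ : ι → ι) (p : ι → Bool) :
    MeasurableSet {ω : ι → Bool | ∀ j ∈ K, ω (τ j) = p j} := by
  have : {ω : ι → Bool | ∀ j ∈ K, ω (τ j) = p j} = ⋂ j ∈ K, (fun ω => ω (τ j)) ⁻¹' {p j} := by
    ext ω; simp
  rw [this]
  exact K.measurableSet_biInter fun j _ => measurable_pi_apply _ (measurableSet_singleton _)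

end Cells

/-! ### Triangles in the array are corners. -/

section Corners

open MeasureTheory

variable {G Z : Type*} [Group G] {I : InvMean G} {S : BiSystem G Z} {f : Z → Bool}
  {P : Measure (EdgeIdx (Option (ℕ ×ₗ ℕ)) → Bool)} [IsProbabilityMeasure P]
  (hP : IsArrayMeasure I S f P)

include hP in
lemma IsArrayMeasure.ae_eq {j j' : EdgeIdx (Option (ℕ ×ₗ ℕ))} (hj : j ≠ j')
    (h : ∀ v z, edgeVal S f (vtx (1 : G × G × G) v) z j = edgeVal S f (vtx 1 v) z j') :
    ∀ᵐ ω ∂P, ω j = ω j' := by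
  have key : ∀ c : Bool, ∀ᵐ ω ∂P, ¬ (ω j = c ∧ ω j' = !c) := by
    intro c
    have h1 := hP {j, j'} id fun l => if l = j then c else !c
    simp only [Finset.forall_mem_insert, Finset.mem_singleton, forall_eq, id, if_true,
      if_neg hj.symm] at h1
    have hz : (fun q : ((ℕ ×ₗ ℕ) → G × G × G) × Z => ind (edgeVal S f (vtx 1 q.1) q.2 j = c ∧
        edgeVal S f (vtx 1 q.1) q.2 j' = !c)) = fun _ => 0 := by
      ext q
      rw [h, ind_false]
      rintro ⟨h1, h2⟩
      rw [h1] at h2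
      cases c <;> cases h2
    rw [hz, FinMean.const, measureReal_eq_zero_iff] at h1
    rw [ae_iff]
    simpa only [not_not] using h1
  filter_upwards [key true, key false] with ω h1 h2
  cases hj : ω j <;> cases hj' : ω j' <;> simp_all

omit [IsProbabilityMeasure P] in
include hP in
-- For the triple `(1, 1, g)` the three edges read `f` at `z`, `z g` and `g z`.
lemma IsArrayMeasure.integral_corner :
    ∫ ω, coordRV (0, frontVtx 0, frontVtx 1) ω *
      (coordRV (1, frontVtx 0, frontVtx 2) ω * coordRV (2, frontVtx 1, frontVtx 2) ω) ∂P =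
    I.toFun fun g => S.mean fun z =>
      ind (f z = true ∧ f (S.act g 1 z) = true ∧ f (S.act 1 g z) = true) := by
  set K : Finset (EdgeIdx (Option (ℕ ×ₗ ℕ))) := {(0, none, none), (1, none, none), (2, none, none)}
  have hK : ↑K ⊆ edgeSet patternVtx patternVtx patternVtx := by
    intro j hj
    simp only [K, Finset.coe_insert, Finset.coe_singleton] at hj
    rcases hj with rfl | rfl | rfl <;> exact ⟨.inl rfl, .inl rfl⟩
  have h := hP.real_front hK fun _ => true
  rw [← integral_ind (measurableSet_pattern _ _ _)] at h
  convert h using 2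
  · ext ω
    simp only [coordRV, ← ind_and]
    refine ind_congr ?_
    simp [K, EdgeIdx.map, putVtx, frontVtx]
  · ext g
    rw [← arrayMean_of_const (T := ℕ ×ₗ ℕ) (ν := tripleMean I) (w₀ := (1 : G × G × G))
      (l := S.mean)]
    refine congrArg (arrayMean (tripleMean I) S.mean (1 : G × G × G)).toFun (funext fun q => ?_)
    refine ind_congr ?_
    simp [K, edgeVal, vtx, S.act_one]
    tauto

end Corners

/-! ### Neighbourhood cells of the three vertex classes. -/

section VertexCells

open MeasureTheory

/-- The cell of a vertex of the first class. -/
abbrev cellA (x : Option (ℕ ×ₗ ℕ)) :=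
  cell (fun y => ((0, x, y) : EdgeIdx (Option (ℕ ×ₗ ℕ)))) fun y => (1, x, y)

/-- The cell of a vertex of the second class. -/
abbrev cellB (x : Option (ℕ ×ₗ ℕ)) :=
  cell (fun y => ((0, y, x) : EdgeIdx (Option (ℕ ×ₗ ℕ)))) fun y => (2, x, y)

/-- The cell of a vertex of the third class. -/
abbrev cellC (x : Option (ℕ ×ₗ ℕ)) :=
  cell (fun y => ((1, y, x) : EdgeIdx (Option (ℕ ×ₗ ℕ)))) fun y => (2, y, x)

variable {x : Option (ℕ ×ₗ ℕ)} {A B C : Set (Option (ℕ ×ₗ ℕ))} {n : ℕ}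

lemma unitRV_cellA (hA : x ∈ A) (hB : sampleVtx ⊆ B) (hC : sampleVtx ⊆ C)
    (i : Fin n → Bool × Bool) : UnitRV (cyl (edgeSet A B C)) fun ω => ind (cellA x n ω = i) :=
  .ind_eq (measurable_cell (a := fun y => ((0 : Fin 3), x, y)) (a' := fun y => ((1 : Fin 3), x, y))
    (D := edgeSet A B C) (fun _ hy => ⟨⟨hA, hB hy⟩, ⟨hA, hC hy⟩⟩) n) i

lemma unitRV_cellB (hA : sampleVtx ⊆ A) (hB : x ∈ B) (hC : sampleVtx ⊆ C)
    (i : Fin n → Bool × Bool) : UnitRV (cyl (edgeSet A B C)) fun ω => ind (cellB x n ω = i) :=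
  .ind_eq (measurable_cell (a := fun y => ((0 : Fin 3), y, x)) (a' := fun y => ((2 : Fin 3), x, y))
    (D := edgeSet A B C) (fun _ hy => ⟨⟨hA hy, hB⟩, ⟨hB, hC hy⟩⟩) n) i

lemma unitRV_cellC (hA : sampleVtx ⊆ A) (hB : sampleVtx ⊆ B) (hC : x ∈ C)
    (i : Fin n → Bool × Bool) : UnitRV (cyl (edgeSet A B C)) fun ω => ind (cellC x n ω = i) :=
  .ind_eq (measurable_cell (a := fun y => ((1 : Fin 3), y, x)) (a' := fun y => ((2 : Fin 3), y, x))
    (D := edgeSet A B C) (fun _ hy => ⟨⟨hA hy, hC⟩, ⟨hB hy, hC⟩⟩) n) i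

end VertexCells

/-! ### The corner theorem. -/

section Roth

open MeasureTheory

variable {G Z : Type*} [Group G] {I : InvMean G} {S : BiSystem G Z} {f : Z → Bool}
  {P : Measure (EdgeIdx (Option (ℕ ×ₗ ℕ)) → Bool)} [IsProbabilityMeasure P]
  (hP : IsArrayMeasure I S f P)

/-- The `σ`-algebra of the edges between late vertices. -/
abbrev lateAlg : MeasurableSpace (EdgeIdx (Option (ℕ ×ₗ ℕ)) → Bool) :=
  cyl (edgeSet (lateVtx 3) (lateVtx 3) (lateVtx 3))

include hP in
-- The vertex `none` carries the triple `1`. The identity supplies the comparison of laws in the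
-- counting inequality; `g` is unaffected because late vertices are not renamed.
lemma IsArrayMeasure.integral_put {A B C : Set (Option (ℕ ×ₗ ℕ))} (hA : A ⊆ patternVtx)
    (hB : B ⊆ patternVtx) (hC : C ⊆ patternVtx) (hABC : none ∉ A ∨ none ∉ B ∨ none ∉ C)
    (hA' : lateVtx 3 ⊆ A) (hB' : lateVtx 3 ⊆ B) (hC' : lateVtx 3 ⊆ C)
    {Y g : (EdgeIdx (Option (ℕ ×ₗ ℕ)) → Bool) → ℝ} (hY : UnitRV (cyl (edgeSet A B C)) Y)
    (hg : UnitRV lateAlg g) :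
    ∫ ω, Y ω * g ω ∂P = ∫ ω, Y (fun j => ω (j.map (putVtx (frontTime 0)) (putVtx (frontTime 1))
      (putVtx (frontTime 2)))) * g ω ∂P := by
  have h := (hP.sameLaw_one hA hB hC hABC).integral_eq
    (hY.mul (hg.mono (cyl_mono (edgeSet_mono hA' hB' hC'))))
  refine h.symm.trans (integral_congr_ae (ae_of_all _ fun ω => ?_))
  dsimp only
  congr 1
  refine hg.congr_cyl fun j hj => ?_
  obtain ⟨k, x, y⟩ := j
  fin_cases k <;> simp only [EdgeIdx.map] <;>
    rw [putVtx_mem_of_late _ hj.1, putVtx_mem_of_late _ hj.2] <;> rfl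

lemma front_subset {n k : ℕ} (h : k < n) :
    insert (frontVtx k) sampleVtx ⊆ sampleVtx ∪ frontVtx '' Set.Iio n :=
  Set.insert_subset (.inr ⟨k, h, rfl⟩) Set.subset_union_left

/-- The edges seen by the cells of a pair of vertices of the first and second class. -/
abbrev edgesAB : Set (EdgeIdx (Option (ℕ ×ₗ ℕ))) :=
  edgeSet (insert (frontVtx 0) sampleVtx) (insert (frontVtx 1) sampleVtx) sampleVtx \
    {((0 : Fin 3), frontVtx 0, frontVtx 1)}

/-- The edges seen by the cells of a pair of vertices of the first and third class. -/
abbrev edgesAC : Set (EdgeIdx (Option (ℕ ×ₗ ℕ))) :=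
  edgeSet (insert (frontVtx 0) sampleVtx) sampleVtx (insert (frontVtx 2) sampleVtx) \
    {((1 : Fin 3), frontVtx 0, frontVtx 2)}

include hP in
-- The counting inequality over `lateAlg`, with the front vertices `0`, `1`, `2` as `a`, `b`, `c`
-- and the degenerate triangle at `none` as the point of evaluation.
lemma IsArrayMeasure.sq_integral_le {N N' : (EdgeIdx (Option (ℕ ×ₗ ℕ)) → Bool) → ℝ}
    (hN : UnitRV (cyl edgesAB) N) (hN' : UnitRV (cyl edgesAC) N')
    (hle : ∀ᵐ ω ∂P, coordRV (2, frontVtx 1, frontVtx 2) ω ≤ N ω + N' ω) (n : ℕ) :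
    (∫ ω, coordRV (2, frontVtx 1, frontVtx 2) ω ∂P) ^ 2 ≤
      ∫ ω, condE P (lateAlg ⊔ MeasurableSpace.comap
        (fun ω => (cellA (frontVtx 0) n ω, cellB (frontVtx 1) n ω)) inferInstance)
          (coordRV (0, frontVtx 0, frontVtx 1)) ω * N ω ∂P +
      ∫ ω, condE P (lateAlg ⊔ MeasurableSpace.comap
        (fun ω => (cellA (frontVtx 0) n ω, cellC (frontVtx 2) n ω)) inferInstance)
          (coordRV (1, frontVtx 0, frontVtx 2)) ω * N' ω ∂P := by
  have hs := sampleVtx_subset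
  have hl : ∀ {m n}, m ≤ n → edgeSet (lateVtx n) (lateVtx n) (lateVtx n) ⊆
      edgeSet (lateVtx m) (lateVtx m) (lateVtx m) := fun h =>
    edgeSet_mono (lateVtx_mono h) (lateVtx_mono h) (lateVtx_mono h)
  have f1 : frontVtx 1 ∈ lateVtx 1 := frontVtx_mem le_rfl
  have f12 : frontVtx 2 ∈ lateVtx 1 := frontVtx_mem one_le_two
  have f2 : frontVtx 2 ∈ lateVtx 2 := frontVtx_mem le_rfl
  have i0 : ∀ k n, k < n → insert (frontVtx k) sampleVtx ⊆ sampleVtx ∪ frontVtx '' Set.Iio n :=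
    fun _ _ => front_subset
  have s0 : ∀ n, sampleVtx ⊆ sampleVtx ∪ frontVtx '' Set.Iio n := fun _ => Set.subset_union_left
  have mc : ∀ {a a' : Option (ℕ ×ₗ ℕ) → EdgeIdx (Option (ℕ ×ₗ ℕ))}, Measurable (cell a a' n) :=
    fun {a a'} => Measurable.mono (measurable_cell (D := Set.univ) (by simp) n) (cyl_le _) le_rfl
  have uc : ∀ j, UnitRV MeasurableSpace.pi (coordRV j : (EdgeIdx (Option (ℕ ×ₗ ℕ)) → Bool) → ℝ) :=
    fun j => (coordRV_unit (D := Set.univ) trivial).mono (cyl_le _)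
  have si : ∀ {x : Option (ℕ ×ₗ ℕ)}, sampleVtx ⊆ insert x sampleVtx :=
    fun {_} => Set.subset_insert _ _
  have uA : ∀ i, UnitRV (cyl (edgeSet (insert (frontVtx 0) sampleVtx) sampleVtx sampleVtx))
      fun ω => ind (cellA (frontVtx 0) n ω = i) := unitRV_cellA (.inl rfl) subset_rfl subset_rfl
  -- The vertex `a` precedes `lateVtx 1`, which contains `b` and `c`, so its cell is independent
  -- over `lateAlg` of every edge there.
  have lateA : ∀ (i : Fin n → Bool × Bool) {g : (EdgeIdx (Option (ℕ ×ₗ ℕ)) → Bool) → ℝ},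
      UnitRV (cyl (edgeSet (lateVtx 1) (lateVtx 1) (lateVtx 1))) g →
      condE P lateAlg (fun ω => ind (cellA (frontVtx 0) n ω = i) * g ω) =ᵐ[P] fun ω =>
        condE P lateAlg (fun ω => ind (cellA (frontVtx 0) n ω = i)) ω * condE P lateAlg g ω :=
    fun i g hg => condE_mul_of_condE_eq (cyl_mono (hl (by norm_num))) (cyl_le _)
      ((uA i).mono (cyl_le _)) hg (hP.condE_late 1 2 (i0 0 1 one_pos) (s0 1) (s0 1) (uA i))
  have late2 : ∀ {f g : (EdgeIdx (Option (ℕ ×ₗ ℕ)) → Bool) → ℝ},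
      UnitRV (cyl (edgeSet (insert (frontVtx 0) sampleVtx) (insert (frontVtx 1) sampleVtx)
        sampleVtx)) f →
      UnitRV (cyl (edgeSet (lateVtx 2) (lateVtx 2) (lateVtx 2))) g →
      condE P lateAlg (fun ω => f ω * g ω) =ᵐ[P] fun ω =>
        condE P lateAlg f ω * condE P lateAlg g ω := fun hf hg =>
    condE_mul_of_condE_eq (cyl_mono (hl (by norm_num))) (cyl_le _) (hf.mono (cyl_le _)) hg
      (hP.condE_late 2 1 (i0 0 2 two_pos) (i0 1 2 one_lt_two) (s0 2) hf)
  refine sq_integral_le_of_le_add (cyl_le _) mc mc mc (A' := cellA none n) (B' := cellB none n)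
    (C' := cellC none n) mc mc mc (uc _) (uc _) (uc _) (uc (0, none, none)) (hN.mono (cyl_le _))
    (hN'.mono (cyl_le _)) hle ?_ ?_ ?_ ?_ ?_ ?_ ?_ ?_ ?_
  · exact fun i j => lateA i (unitRV_cellB (hs 1) f1 (hs 1) j)
  · exact fun i j => lateA i (unitRV_cellC (hs 1) (hs 1) f12 j)
  · exact fun i j => late2 (unitRV_cellB si (.inl rfl) subset_rfl i)
      (unitRV_cellC (hs 2) (hs 2) f2 j)
  · exact fun i j k => lateA i (((unitRV_cellB (hs 1) f1 (hs 1) j).mul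
      (unitRV_cellC (hs 1) (hs 1) f12 k)).mul (coordRV_unit ⟨f1, f12⟩))
  · exact fun i j k => late2 (((unitRV_cellA (.inl rfl) si subset_rfl i).mul
      (unitRV_cellB si (.inl rfl) subset_rfl j)).mul (hN.mono (cyl_mono Set.sdiff_subset)))
      (unitRV_cellC (hs 2) (hs 2) f2 k)
  · intro i j k
    have hf : UnitRV (cyl (edgeSet (insert (frontVtx 0) sampleVtx) sampleVtx
        (insert (frontVtx 2) sampleVtx))) fun ω =>
        ind (cellA (frontVtx 0) n ω = i) * ind (cellC (frontVtx 2) n ω = k) * N' ω :=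
      ((unitRV_cellA (.inl rfl) subset_rfl si i).mul
      (unitRV_cellC si subset_rfl (.inl rfl) k)).mul (hN'.mono (cyl_mono Set.sdiff_subset))
    -- `N'` involves the times `0` and `2`, while `b` sits at time `1`; the exchange of `b` and `c`
    -- is needed here.
    exact condE_mul_of_condE_eq
      (cyl_mono (edgeSet_mono subset_rfl (Set.subset_insert _ _) subset_rfl)) (cyl_le _)
      (hf.mono (cyl_le _)) (unitRV_cellB (hs 3) (.inl rfl) (hs 3) j) (hP.condE_swap hf)
  all_goals
    have nl : none ∉ lateVtx 3 := fun h => ne_none_of_mem_lateVtx h rfl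
    have lp : lateVtx 3 ⊆ patternVtx := Set.subset_insert _ _
    have sp : sampleVtx ⊆ patternVtx := (hs 3).trans lp
    have np : none ∈ patternVtx := .inl rfl
    have p0 : ((0 : Fin 3), none, none) ∈ edgeSet patternVtx patternVtx (lateVtx 3) := ⟨np, np⟩
    have p1 : ((1 : Fin 3), none, none) ∈ edgeSet patternVtx (lateVtx 3) patternVtx := ⟨np, np⟩
    have p2 : ((2 : Fin 3), none, none) ∈ edgeSet (lateVtx 3) patternVtx patternVtx := ⟨np, np⟩
    intro i j g hg
  · exact hP.integral_put subset_rfl subset_rfl lp (.inr (.inr nl)) lp lp subset_rfl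
      (((coordRV_unit (j := (0, none, none)) p0).mul (unitRV_cellA np sp (hs 3) i)).mul
        (unitRV_cellB sp np (hs 3) j)) hg
  · refine Eq.trans ?_ (hP.integral_put subset_rfl lp subset_rfl (.inr (.inl nl)) lp subset_rfl lp
      (((coordRV_unit (j := (1, none, none)) p1).mul (unitRV_cellA np (hs 3) sp i)).mul
        (unitRV_cellC sp (hs 3) np j)) hg)
    refine integral_congr_ae ?_
    -- All edges of the degenerate triangle read `f z`.
    filter_upwards [hP.ae_eq (j := (0, none, none)) (j' := (1, none, none)) (by simp) fun v z => by
      simp [edgeVal, vtx]] with ω hω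
    simp only [coordRV, hω]
  · refine Eq.trans ?_ (hP.integral_put lp subset_rfl subset_rfl (.inl nl) subset_rfl lp lp
      (((coordRV_unit (j := (2, none, none)) p2).mul (unitRV_cellB (hs 3) np sp i)).mul
        (unitRV_cellC (hs 3) sp np j)) hg)
    refine integral_congr_ae ?_
    filter_upwards [hP.ae_eq (j := (0, none, none)) (j' := (2, none, none)) (by simp) fun v z => by
      simp [edgeVal, vtx]] with ω hω
    simp only [coordRV, hω]

omit [IsProbabilityMeasure P] in
include hP in
lemma IsArrayMeasure.integral_edge : ∫ ω, coordRV (2, frontVtx 1, frontVtx 2) ω ∂P =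
    S.mean fun z => ind (f z = true) := by
  set K : Finset (EdgeIdx (Option (ℕ ×ₗ ℕ))) := {(2, none, none)}
  have hK : ↑K ⊆ edgeSet ∅ patternVtx patternVtx := by
    intro j hj
    simp only [K, Finset.coe_singleton] at hj
    rcases hj with rfl
    exact ⟨.inl rfl, .inl rfl⟩
  have h := hP.real_front (hK.trans (edgeSet_mono (Set.empty_subset _) subset_rfl subset_rfl))
    fun _ => true
  simp only [fun g => patternProb_one I f (S := S) (.inl (Set.notMem_empty _))
    (fun j hj => hK hj) (fun _ => true) g] at h
  rw [I.toFinMean.const, ← integral_ind (measurableSet_pattern _ _ _)] at h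
  convert h using 2
  · ext ω
    refine ind_congr ?_
    simp [K, EdgeIdx.map, putVtx, frontVtx]
  · rw [← arrayMean_of_const (T := ℕ ×ₗ ℕ) (ν := tripleMean I) (w₀ := (1 : G × G × G))
      (l := S.mean)]
    refine congrArg (arrayMean (tripleMean I) S.mean (1 : G × G × G)).toFun (funext fun q => ?_)
    refine ind_congr ?_
    simp [K, edgeVal, vtx, S.act_one]

/-- An edge of `edgesAB` joins two samples, and is then in `lateAlg`, or joins a front vertex to a
sample, and is then read by a cell. The edge between the two front vertices is excluded. -/
lemma edgesAB_le_iSup_cellFiltration : cyl edgesAB ≤ ⨆ n, cellFiltration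
    (fun y => ((0, frontVtx 0, y) : EdgeIdx (Option (ℕ ×ₗ ℕ)))) (fun y => (1, frontVtx 0, y))
    (fun y => (0, y, frontVtx 1)) (fun y => (2, frontVtx 1, y))
    (edgeSet (lateVtx 3) (lateVtx 3) (lateVtx 3)) n := by
  have hs := sampleVtx_subset 3
  refine le_iSup_cellFiltration ?_
  rintro ⟨k, x, y⟩ ⟨hj, hne⟩
  fin_cases k
  · obtain ⟨rfl | hx, rfl | hy⟩ := hj
    · exact absurd rfl hne
    · exact .inr ⟨y, hy, .inl rfl⟩
    · exact .inr ⟨x, hx, .inr (.inr (.inl rfl))⟩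
    · exact .inl ⟨hs hx, hs hy⟩
  · obtain ⟨rfl | hx, hy⟩ := hj
    · exact .inr ⟨y, hy, .inr (.inl rfl)⟩
    · exact .inl ⟨hs hx, hs hy⟩
  · obtain ⟨rfl | hx, hy⟩ := hj
    · exact .inr ⟨y, hy, .inr (.inr (.inr rfl))⟩
    · exact .inl ⟨hs hx, hs hy⟩

lemma edgesAC_le_iSup_cellFiltration : cyl edgesAC ≤ ⨆ n, cellFiltration
    (fun y => ((0, frontVtx 0, y) : EdgeIdx (Option (ℕ ×ₗ ℕ)))) (fun y => (1, frontVtx 0, y))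
    (fun y => (1, y, frontVtx 2)) (fun y => (2, y, frontVtx 2))
    (edgeSet (lateVtx 3) (lateVtx 3) (lateVtx 3)) n := by
  have hs := sampleVtx_subset 3
  refine le_iSup_cellFiltration ?_
  rintro ⟨k, x, y⟩ ⟨hj, hne⟩
  fin_cases k
  · obtain ⟨rfl | hx, hy⟩ := hj
    · exact .inr ⟨y, hy, .inl rfl⟩
    · exact .inl ⟨hs hx, hs hy⟩
  · obtain ⟨rfl | hx, rfl | hy⟩ := hj
    · exact absurd rfl hne
    · exact .inr ⟨y, hy, .inr (.inl rfl)⟩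
    · exact .inr ⟨x, hx, .inr (.inr (.inl rfl))⟩
    · exact .inl ⟨hs hx, hs hy⟩
  · obtain ⟨hx, rfl | hy⟩ := hj
    · exact .inr ⟨x, hx, .inr (.inr (.inr rfl))⟩
    · exact .inl ⟨hs hx, hs hy⟩

/-- A set of positive mean contains many corners. -/
theorem corner_pos (I : InvMean G) (S : BiSystem G Z) (f : Z → Bool)
    (hf : 0 < S.mean fun z => ind (f z = true)) :
    0 < I.toFun fun g => S.mean fun z =>
      ind (f z = true ∧ f (S.act g 1 z) = true ∧ f (S.act 1 g z) = true) := by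
  obtain ⟨P, _, hP⟩ := exists_isArrayMeasure I S f
  rw [← hP.integral_corner]
  have uc : ∀ j, UnitRV MeasurableSpace.pi (coordRV j : (EdgeIdx (Option (ℕ ×ₗ ℕ)) → Bool) → ℝ) :=
    fun j => (coordRV_unit (D := Set.univ) trivial).mono (cyl_le _)
  refine (integral_nonneg ((uc _).mul ((uc _).mul (uc _))).nonneg).lt_of_ne' fun h0 => ?_
  have hs := sampleVtx_subset
  have f02 : frontVtx 0 ∉ lateVtx 2 := frontVtx_notMem_late two_pos
  have f23 : frontVtx 2 ∉ lateVtx 3 := frontVtx_notMem_late (by norm_num)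
  have f2 : frontVtx 2 ∈ lateVtx 2 := frontVtx_mem le_rfl
  have l32 : lateVtx 3 ⊆ lateVtx 2 := lateVtx_mono (by norm_num)
  have hAB := hP.condE_edge_zero (coordRV_unit rfl)
  have hAC := hP.condE_edge_one (coordRV_unit rfl)
  have m1 : ((1 : Fin 3), frontVtx 0, frontVtx 2) ∈ edgeSet (insert (frontVtx 0) (lateVtx 2))
      (insert (frontVtx 1) (lateVtx 2)) (lateVtx 2) \ {((0 : Fin 3), frontVtx 0, frontVtx 1)} :=
    ⟨⟨.inl rfl, f2⟩, by simp⟩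
  have m2 : ((2 : Fin 3), frontVtx 1, frontVtx 2) ∈ edgeSet (insert (frontVtx 0) (lateVtx 2))
      (insert (frontVtx 1) (lateVtx 2)) (lateVtx 2) \ {((0 : Fin 3), frontVtx 0, frontVtx 1)} :=
    ⟨⟨.inl rfl, f2⟩, by simp⟩
  have m2' : ((2 : Fin 3), frontVtx 1, frontVtx 2) ∈ edgeSet (insert (frontVtx 0) (lateVtx 3))
      (insert (frontVtx 1) (lateVtx 3)) (insert (frontVtx 2) (lateVtx 3)) \
        {((1 : Fin 3), frontVtx 0, frontVtx 2)} :=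
    ⟨⟨.inl rfl, .inl rfl⟩, by simp⟩
  have n1 : ((1 : Fin 3), frontVtx 0, frontVtx 2) ∉ edgeSet (insert (frontVtx 0) sampleVtx)
      (insert (frontVtx 1) sampleVtx) sampleVtx := fun h => frontVtx_notMem_sample 2 h.2
  have n2 : ((0 : Fin 3), frontVtx 0, frontVtx 1) ∉ edgeSet (lateVtx 3) (lateVtx 3) (lateVtx 3) :=
    fun h => f02 (l32 h.1)
  have n3 : ((1 : Fin 3), frontVtx 0, frontVtx 2) ∉ edgeSet (lateVtx 3) (lateVtx 3) (lateVtx 3) :=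
    fun h => f23 h.2
  -- The first conditioning involves `lateVtx 2`, which contains `c`, so it sees the edges `ac` and
  -- `bc`. The second is on all edges except `ac`, with `b` present. It still sees `edgesAB`,
  -- because `c` is not a sample.
  have hle := ae_le_ind_add_ind (cyl_le _) (cyl_le _) (uc _) (uc _)
    (coordRV_unit m1) (coordRV_unit m2) (coordRV_unit m2') (cyl_mono (Set.subset_sdiff_singleton
      (Set.sdiff_subset.trans (edgeSet_mono (Set.insert_subset_insert (hs 3))
        (Set.insert_subset_insert (hs 3)) ((hs 3).trans (Set.subset_insert _ _))))
      fun h => n1 h.1)) hAB hAC h0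
  have key := hP.sq_integral_le
    (.ind (s := {ω | condE P (cyl edgesAB) (coordRV (0, frontVtx 0, frontVtx 1)) ω = 0})
      ((condE_unit _).meas (measurableSet_singleton 0)))
    (.ind (s := {ω | condE P (cyl edgesAC) (coordRV (1, frontVtx 0, frontVtx 2)) ω = 0})
      ((condE_unit _).meas (measurableSet_singleton 0))) hle
  rw [hP.integral_edge] at key
  have t1 := tendsto_integral_condE_mul_ind _ edgesAB_le_iSup_cellFiltration
    (iSup_cellFiltration_le
      (Set.subset_sdiff_singleton (edgeSet_mono (l32.trans (Set.subset_insert _ _))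
        (l32.trans (Set.subset_insert _ _)) l32) n2)
      (fun y hy => ⟨⟨⟨.inl rfl, .inr (hs 2 hy)⟩, fun h => ?_⟩, ⟨.inl rfl, hs 2 hy⟩, by simp⟩)
      (fun y hy => ⟨⟨⟨.inr (hs 2 hy), .inl rfl⟩, fun h => ?_⟩, ⟨.inl rfl, hs 2 hy⟩, by simp⟩))
    (cyl_le _) (uc _) hAB
  have t2 := tendsto_integral_condE_mul_ind _ edgesAC_le_iSup_cellFiltration
    (iSup_cellFiltration_le
      (Set.subset_sdiff_singleton (edgeSet_mono (Set.subset_insert _ _) (Set.subset_insert _ _)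
        (Set.subset_insert _ _)) n3)
      (fun y hy => ⟨⟨⟨.inl rfl, .inr (hs 3 hy)⟩, by simp⟩, ⟨.inl rfl, .inr (hs 3 hy)⟩,
        fun h => ?_⟩)
      (fun y hy => ⟨⟨⟨.inr (hs 3 hy), .inl rfl⟩, fun h => ?_⟩, ⟨.inr (hs 3 hy), .inl rfl⟩,
        by simp⟩))
    (cyl_le _) (uc _) hAC
  -- The left side of `key` is the square of the density and does not depend on `n`, while the right
  -- side tends to `0`.
  · have := ge_of_tendsto' (t1.add t2) key
    rw [add_zero] at this
    exact absurd this (not_le.2 (pow_pos hf 2))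
  all_goals simp only [Set.mem_singleton_iff, Prod.mk.injEq, true_and, and_true] at h
  all_goals exact frontVtx_notMem_sample _ (h ▸ hy)

end Roth

/-! ### Systems of tuples and products of systems. -/

section TupleMean

variable {G : Type*} [Group G]

/-- The iterated mean of tuples of group elements, outermost in the first entry. -/
def tupleMean (m : FinMean G) : (n : ℕ) → FinMean (Fin n → G)
  | 0 => .dirac Fin.elim0
  | n + 1 => m.bind fun y => (tupleMean m n).map fun t => Fin.cons y t

omit [Group G] in
lemma tupleMean_zero (m : FinMean G) (F : (Fin 0 → G) → ℝ) : tupleMean m 0 F = F Fin.elim0 := rfl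

omit [Group G] in
lemma tupleMean_succ (m : FinMean G) (n : ℕ) (F : (Fin (n + 1) → G) → ℝ) :
    tupleMean m (n + 1) F = m fun y => tupleMean m n fun t => F (Fin.cons y t) := rfl

lemma tupleMean_mul_mul (I : InvMean G) {n : ℕ} (a b : Fin n → G) {F : (Fin n → G) → ℝ}
    (hF : BddF F) :
    tupleMean I.toFinMean n (fun t => F fun i => a i * t i * b i) = tupleMean I.toFinMean n F := by
  induction n with
  | zero => exact congrArg F (Subsingleton.elim _ _)
  | succ n ih =>
    obtain ⟨C, hC⟩ := hF
    have h1 : ∀ y t, (fun i => a i * (Fin.cons y t : Fin (n + 1) → G) i * b i) =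
        (Fin.cons (a 0 * y * b 0) fun i => a i.succ * t i * b i.succ : Fin (n + 1) → G) := by
      intro y t
      ext i
      refine Fin.cases ?_ (fun i => ?_) i <;> simp
    simp only [tupleMean_succ, h1]
    have h2 : ∀ y, tupleMean I.toFinMean n (fun t => F (Fin.cons y fun i =>
        a i.succ * t i * b i.succ)) = tupleMean I.toFinMean n fun t => F (Fin.cons y t) := fun y =>
      ih (fun i => a i.succ) (fun i => b i.succ) (F := fun t => F (Fin.cons y t)) ⟨C, fun _ => hC _⟩
    simp only [h2]
    exact I.mul_mul _ _ (F := fun y => tupleMean I.toFinMean n fun t => F (Fin.cons y t))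
      (FinMean.bddF (m := fun _ => tupleMean I.toFinMean n) ⟨C, fun _ _ => hC _⟩)

/-- Multiplying the last entry of a tuple from the left and the first one from the right. -/
def shift (p q : G) {n : ℕ} (t : Fin n → G) (i : Fin n) : G :=
  (if i.val + 1 = n then p else 1) * t i * (if i.val = 0 then q else 1)

/-- The system of tuples of length `n`. -/
def tupleSystem (I : InvMean G) (n : ℕ) : BiSystem G (Fin n → G) where
  -- Tuples list `x₀` last, so `p` multiplies `x₀` from the left and `q` multiplies the entry of
  -- highest index from the right. For `n = 1` both act on the same entry.
  act p q := shift p q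
  act_one t := by ext i; simp [shift]
  act_act p q p' q' t := by
    ext i
    simp only [shift]
    split_ifs <;> simp [mul_assoc]
  mean := tupleMean I.toFinMean n
  mean_act p q _ hf := tupleMean_mul_mul I _ _ hf

variable {Z Z' : Type*}

/-- The product of two systems. -/
def BiSystem.prod (S : BiSystem G Z) (S' : BiSystem G Z') : BiSystem G (Z × Z') where
  act p q z := (S.act p q z.1, S'.act p q z.2)
  act_one z := by rw [S.act_one, S'.act_one]
  act_act p q p' q' z := by rw [S.act_act, S'.act_act]
  mean := S.mean.bind fun z => S'.mean.map fun z' => (z, z')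
  mean_act p q f hf := by
    obtain ⟨C, hC⟩ := hf
    change S.mean (fun z => S'.mean fun z' => f (S.act p q z, S'.act p q z')) =
      S.mean fun z => S'.mean fun z' => f (z, z')
    simp only [fun z => S'.mean_act p q (fun z' => f (S.act p q z, z')) ⟨C, fun _ => hC _⟩]
    exact S.mean_act p q (fun z => S'.mean fun z' => f (z, z'))
      (FinMean.bddF (m := fun _ => S'.mean) ⟨C, fun _ _ => hC _⟩)

lemma BiSystem.prod_mean_mul (S : BiSystem G Z) (S' : BiSystem G Z') {F : Z → ℝ} {F' : Z' → ℝ}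
    (hF : BddF F) (hF' : BddF F') :
    (S.prod S').mean (fun z => F z.1 * F' z.2) = S.mean F * S'.mean F' := by
  change S.mean (fun z => S'.mean fun z' => F z * F' z') = _
  simp only [fun z => S'.mean.smul (F z) hF', mul_comm _ (S'.mean F')]
  exact S.mean.smul _ hF

end TupleMean

/-! ### Corners with a common difference. -/

section MultiCorner

universe u

variable {G : Type*} [Group G] {ι : Type*} {Z : ι → Type u}

/-- The corners in a set at distance `g`. -/
def CornerAt {Z : Type*} (S : BiSystem G Z) (f : Z → Bool) (g : G) (z : Z) : Prop :=
  f z = true ∧ f (S.act g 1 z) = true ∧ f (S.act 1 g z) = true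

/-- A corner in a product set is a corner in each factor with the same `g`, and means of products
multiply. -/
lemma exists_prod_system (S : ∀ i, BiSystem G (Z i)) (f : ∀ i, Z i → Bool) (s : Finset ι) :
    ∃ (Z' : Type u) (S' : BiSystem G Z') (f' : Z' → Bool),
      (S'.mean fun z => ind (f' z = true)) = ∏ i ∈ s, (S i).mean (fun z => ind (f i z = true)) ∧
      ∀ g, (S'.mean fun z => ind (CornerAt S' f' g z)) =
        ∏ i ∈ s, (S i).mean fun z => ind (CornerAt (S i) (f i) g z) := by
  classical
  induction s using Finset.induction_on with
  | empty =>
    refine ⟨PUnit, ⟨fun _ _ z => z, fun _ => rfl, fun _ _ _ _ _ => rfl, .dirac ⟨⟩,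
      fun _ _ _ _ => rfl⟩, fun _ => true, ?_, fun g => ?_⟩
    · simp [FinMean.const]
    · simp [CornerAt, FinMean.const]
  | insert i s hi ih =>
    obtain ⟨Z', S', f', h1, h2⟩ := ih
    refine ⟨Z i × Z', (S i).prod S', fun z => f i z.1 && f' z.2, ?_, fun g => ?_⟩
    · rw [Finset.prod_insert hi, ← h1, ← BiSystem.prod_mean_mul _ _ (.ind _) (.ind _)]
      refine congrArg ((S i).prod S').mean.toFun (funext fun z => ?_)
      rw [← ind_and]
      exact ind_congr (by simp)
    · rw [Finset.prod_insert hi, ← h2, ← BiSystem.prod_mean_mul _ _ (.ind _) (.ind _)]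
      refine congrArg ((S i).prod S').mean.toFun (funext fun z => ?_)
      rw [← ind_and]
      refine ind_congr ?_
      simp only [CornerAt, BiSystem.prod, Bool.and_eq_true]
      tauto

/-- Finitely many sets of positive mean contain many corners at the same distance. -/
lemma multi_corner_pos (I : InvMean G) (S : ∀ i, BiSystem G (Z i)) (f : ∀ i, Z i → Bool)
    (s : Finset ι) (h : ∀ i ∈ s, 0 < (S i).mean fun z => ind (f i z = true)) :
    0 < I.toFun fun g => ∏ i ∈ s, (S i).mean fun z => ind (CornerAt (S i) (f i) g z) := by
  obtain ⟨Z', S', f', h1, h2⟩ := exists_prod_system S f s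
  simp only [← h2]
  exact corner_pos I S' f' (h1 ▸ Finset.prod_pos h)

end MultiCorner

/-! ### Colour focusing. -/

section Rich

variable {G κ : Type*} [Group G]

/-- The tuples built up by successive corners with all colours equal to `a`. -/
def Rich (c : G → κ) (a : κ) : (n : ℕ) → (Fin n → G) → Prop
  | 0, _ => True
  | n + 1, t => c (t 0) = a ∧ Rich c a n (Fin.tail t) ∧ Rich c a n (shift (t 0) 1 (Fin.tail t)) ∧
      Rich c a n (shift 1 (t 0) (Fin.tail t))

/-- The mean of the set of tuples built up by successive corners. -/
noncomputable def richMean (I : InvMean G) (c : G → κ) (a : κ) (n : ℕ) : ℝ :=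
  tupleMean I.toFinMean n fun t => ind (Rich c a n t)

/-- Let `φ a g` be the mean of the corners with difference `g` among rich tuples of colour `a`. The
product of all `φ a g` is at most the factor for the colour of `g`. Averaging over `g` bounds a
positive number by the sum of the means at the lengths `d a + 1`. -/
lemma exists_richMean_succ_pos [Fintype κ] (I : InvMean G) (c : G → κ) (d : κ → ℕ)
    (h : ∀ a, 0 < richMean I c a (d a)) : ∃ a, 0 < richMean I c a (d a + 1) := by
  classical
  set φ : κ → G → ℝ := fun a g => (tupleSystem I (d a)).mean fun t =>
    ind (CornerAt (tupleSystem I (d a)) (fun t => decide (Rich c a (d a) t)) g t)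
  have h0 : ∀ a g, 0 ≤ φ a g := fun a g => FinMean.le_of_ge _ (.ind _) fun _ => ind_nonneg _
  have h1 : ∀ a g, φ a g ≤ 1 := fun a g => FinMean.le_of_le _ (.ind _) fun _ => ind_le_one _
  have key : 0 < I.toFinMean fun g => ∏ a, φ a g :=
    multi_corner_pos I (fun a => tupleSystem I (d a)) (fun a t => decide (Rich c a (d a) t)) _
      fun a _ => by
        simp only [decide_eq_true_eq]
        exact h a
  have hb : ∀ a, BddF fun g => ind (c g = a) * φ a g := fun a =>
    (BddF.ind _).mul (.of_mem_Icc (h0 a) (h1 a))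
  have hr : ∀ a, I.toFinMean (fun g => ind (c g = a) * φ a g) = richMean I c a (d a + 1) := by
    intro a
    rw [richMean, tupleMean_succ]
    refine congrArg I.toFun (funext fun g => ?_)
    rw [← FinMean.smul _ _ (.ind _)]
    refine congrArg (tupleMean I.toFinMean (d a)).toFun (funext fun t => ?_)
    rw [← ind_and]
    refine ind_congr ?_
    simp only [CornerAt, decide_eq_true_eq]
    rfl
  have hle : I.toFinMean (fun g => ∏ a, φ a g) ≤ ∑ a, richMean I c a (d a + 1) := by
    simp only [← hr]
    rw [← I.toFinMean.sum _ fun a _ => hb a]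
    refine I.toFinMean.mono (.of_mem_Icc (fun g => Finset.prod_nonneg fun a _ => h0 a g)
      fun g => Finset.prod_le_one (fun a _ => h0 a g) fun a _ => h1 a g)
      (.sum _ fun a _ => hb a) fun g => ?_
    refine le_trans ?_ (Finset.single_le_sum (f := fun a => ind (c g = a) * φ a g)
      (fun a _ => mul_nonneg (ind_nonneg _) (h0 a g)) (Finset.mem_univ (c g)))
    rw [ind_true rfl, one_mul, ← Finset.mul_prod_erase _ _ (Finset.mem_univ (c g))]
    exact mul_le_of_le_one_right (h0 _ g)
      (Finset.prod_le_one (fun a _ => h0 a g) fun a _ => h1 a g)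
  by_contra! hn
  exact absurd (key.trans_le hle) (not_lt.2 (Finset.sum_nonpos fun a _ => hn a))

/-- If no length reached `k + 1`, single lengths could be increased forever, although their sum is
at most `k` times the number of colours. -/
lemma exists_richMean_pos [Fintype κ] (I : InvMean G) (c : G → κ) (k : ℕ) :
    ∃ a, 0 < richMean I c a (k + 1) := by
  classical
  by_contra! hn
  have key : ∀ N, ∃ d : κ → ℕ, ∑ a, d a = N ∧ ∀ a, d a ≤ k ∧ 0 < richMean I c a (d a) := by
    intro N
    induction N with
    | zero =>
      refine ⟨fun _ => 0, by simp, fun a => ⟨k.zero_le, ?_⟩⟩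
      rw [richMean, tupleMean_zero, ind_true (by trivial)]
      exact one_pos
    | succ N ih =>
      obtain ⟨d, hd, h⟩ := ih
      obtain ⟨a, ha⟩ := exists_richMean_succ_pos I c d fun a => (h a).2
      refine ⟨update d a (d a + 1), ?_, fun b => ?_⟩
      · rw [Finset.sum_update_of_mem (Finset.mem_univ a), ← hd,
          ← Finset.add_sum_erase _ _ (Finset.mem_univ a), Finset.sdiff_singleton_eq_erase]
        ring
      · by_cases hb : b = a
        · subst hb
          rw [update_self]
          refine ⟨Nat.succ_le_of_lt ((h b).1.lt_of_ne fun hk => ?_), ha⟩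
          exact absurd ha (not_lt.2 (hk ▸ hn b))
        · rw [update_of_ne hb]
          exact h b
  obtain ⟨d, hd, h⟩ := key (Fintype.card κ * k + 1)
  have := Finset.sum_le_card_nsmul Finset.univ d k fun a _ => (h a).1
  rw [hd, smul_eq_mul, Finset.card_univ] at this
  omega

end Rich

/-! ### The patterns of rich tuples. -/

section Pattern

variable {G : Type*} [Group G]

lemma orderedProd_congr {n : ℕ} {x y : Fin n → G} {A : Finset (Fin n)} (h : ∀ a ∈ A, x a = y a) :
    orderedProd x A = orderedProd y A := by
  rw [orderedProd, orderedProd]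
  congr 1
  exact List.map_congr_left fun a ha => h a ((Finset.mem_sort _).1 ha)

lemma orderedProd_empty {n : ℕ} (x : Fin n → G) : orderedProd x ∅ = 1 := by simp [orderedProd]

lemma orderedProd_singleton {n : ℕ} (x : Fin n → G) (a : Fin n) : orderedProd x {a} = x a := by
  simp [orderedProd]

lemma orderedProd_union {n : ℕ} (x : Fin n → G) {A B : Finset (Fin n)}
    (h : ∀ a ∈ A, ∀ b ∈ B, a < b) : orderedProd x (A ∪ B) = orderedProd x A * orderedProd x B := by
  have : (A ∪ B).sort = A.sort ++ B.sort := by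
    refine List.Perm.eq_of_pairwise (le := (· ≤ ·)) (fun a b _ _ => le_antisymm) ?_ ?_ ?_
    · exact Finset.pairwise_sort _ _
    · rw [List.pairwise_append]
      exact ⟨Finset.pairwise_sort _ _, Finset.pairwise_sort _ _, fun a ha b hb =>
        (h a ((Finset.mem_sort _).1 ha) b ((Finset.mem_sort _).1 hb)).le⟩
    · rw [List.perm_ext_iff_of_nodup (Finset.sort_nodup _ _)]
      · simp
      · rw [List.nodup_append]
        exact ⟨Finset.sort_nodup _ _, Finset.sort_nodup _ _, fun a ha b hb =>
          (h a ((Finset.mem_sort _).1 ha) b ((Finset.mem_sort _).1 hb)).ne⟩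
  rw [orderedProd, this, List.map_append, List.prod_append]
  rfl

lemma orderedProd_map {n k : ℕ} (x : Fin k → G) (A : Finset (Fin n)) {e : Fin n ↪ Fin k}
    (he : StrictMono e) : orderedProd x (A.map e) = orderedProd (x ∘ e) A := by
  have : (A.map e).sort = A.sort.map e := by
    refine List.Perm.eq_of_pairwise (le := (· ≤ ·)) (fun a b _ _ => le_antisymm) ?_ ?_ ?_
    · exact Finset.pairwise_sort _ _
    · exact (Finset.pairwise_sort A (· ≤ ·)).map e fun a b hab => he.monotone hab
    · rw [List.perm_ext_iff_of_nodup (Finset.sort_nodup _ _)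
        ((Finset.sort_nodup _ _).map e.injective)]
      simp
  rw [orderedProd, this, List.map_map]
  rfl

lemma orderedProd_Icc_last {n : ℕ} (x : Fin (n + 1) → G) (i : Fin (n + 1)) :
    orderedProd x (Finset.Icc i (Fin.last n)) =
      orderedProd x (Finset.Ico i (Fin.last n)) * x (Fin.last n) := by
  rw [← orderedProd_singleton x, ← orderedProd_union]
  · congr 1
    ext j
    have := Fin.le_last i
    have := Fin.le_last j
    simp only [Finset.mem_Icc, Finset.mem_union, Finset.mem_Ico, Finset.mem_singleton]
    grind
  · intro a ha b hb
    rw [Finset.mem_singleton.1 hb]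
    exact (Finset.mem_Ico.1 ha).2

lemma orderedProd_Iic {n : ℕ} (x : Fin (n + 1) → G) (j : Fin (n + 1)) :
    orderedProd x (Finset.Iic j) = x 0 * orderedProd x (Finset.Ioc 0 j) := by
  rw [← orderedProd_singleton x, ← orderedProd_union]
  · congr 1
    ext i
    have := Fin.zero_le i
    have := Fin.zero_le j
    simp only [Finset.mem_Iic, Finset.mem_union, Finset.mem_Ioc, Finset.mem_singleton]
    grind
  · intro a ha b hb
    rw [Finset.mem_singleton.1 ha]
    exact (Finset.mem_Ioc.1 hb).1

lemma shift_rev (p q : G) {n : ℕ} (t : Fin n → G) (i : Fin n) : shift p q t i.rev =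
    (if i.val = 0 then p else 1) * t i.rev * (if i.val + 1 = n then q else 1) := by
  have h1 : i.rev.val + 1 = n ↔ i.val = 0 := by rw [Fin.val_rev]; omega
  have h2 : i.rev.val = 0 ↔ i.val + 1 = n := by rw [Fin.val_rev]; omega
  simp only [shift, h1, h2]

lemma castSucc_Icc {n : ℕ} (i j : Fin n) :
    (Finset.Icc i j).map Fin.castSuccEmb = Finset.Icc i.castSucc j.castSucc := by
  ext l
  refine Fin.lastCases ?_ (fun l => ?_) l <;> simp

/-- The pattern of a tuple arises from three patterns of shorter tuples. -/
lemma productPattern_subset {k : ℕ} (t : Fin (k + 2) → G) :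
    (productPattern fun i => t i.rev) ⊆ {t 0} ∪
      (productPattern fun i => Fin.tail t i.rev) ∪
      (productPattern fun i => shift (t 0) 1 (Fin.tail t) i.rev) ∪
      productPattern fun i => shift 1 (t 0) (Fin.tail t) i.rev := by
  set x : Fin (k + 2) → G := fun i => t i.rev
  set y : Fin (k + 1) → G := fun i => Fin.tail t i.rev
  set yL : Fin (k + 1) → G := fun i => shift (t 0) 1 (Fin.tail t) i.rev
  set yR : Fin (k + 1) → G := fun i => shift 1 (t 0) (Fin.tail t) i.rev
  have hx : x (Fin.last _) = t 0 := by simp [x]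
  have hy : x ∘ Fin.castSuccEmb = y := by
    ext i
    simp [x, y, Fin.tail, Fin.rev_castSucc]
  have hmap : ∀ A : Finset (Fin (k + 1)), orderedProd x (A.map Fin.castSuccEmb) =
      orderedProd y A := fun A => by
    rw [orderedProd_map _ _ Fin.strictMono_castSucc, hy]
  have hL0 : yL 0 = t 0 * y 0 := by simp [yL, y, shift_rev]
  have hL : ∀ i, i ≠ 0 → yL i = y i := fun i hi => by
    simp [yL, y, shift_rev, hi]
  have hR0 : yR (Fin.last k) = y (Fin.last k) * t 0 := by simp [yR, y, shift_rev]
  have hR : ∀ i, i ≠ Fin.last k → yR i = y i := fun i hi => by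
    have : i.val ≠ k := fun h => hi (Fin.ext h)
    simp [yR, y, shift_rev, this]
  have type1 : ∀ i j, i ≤ j → orderedProd x (Finset.Icc i j) ∈ {t 0} ∪ productPattern y ∪
      productPattern yL ∪ productPattern yR := by
    intro i j hij
    induction j using Fin.lastCases with
    | cast j =>
      induction i using Fin.lastCases with
      | cast i =>
        refine .inl (.inl (.inr (.inl ⟨i, j, by simpa using hij, ?_⟩)))
        rw [← castSucc_Icc, hmap]
      | last => exact absurd hij (not_le.2 (Fin.castSucc_lt_last j))
    | last =>
      induction i using Fin.lastCases with
      | cast i =>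
        -- In a product ending with the top entry and starting earlier, the last two factors merge
        -- into the last entry of `yR`.
        refine .inr (.inl ⟨i, Fin.last k, Fin.le_last i, ?_⟩)
        rw [orderedProd_Icc_last, orderedProd_Icc_last, hx, hR0, ← mul_assoc,
          orderedProd_congr (y := y) fun a ha => hR a (Finset.mem_Ico.1 ha).2.ne,
          ← orderedProd_Icc_last, ← hmap, castSucc_Icc]
        congr 2
      | last =>
        rw [Finset.Icc_self, orderedProd_singleton, hx]
        exact .inl (.inl (.inl rfl))
  rintro g (⟨i, j, hij, rfl⟩ | ⟨j, A, hA, rfl⟩)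
  · exact type1 i j hij
  induction j using Fin.lastCases with
  | last =>
    have : A = ∅ := Finset.subset_empty.1 fun b hb =>
      absurd (Finset.mem_Ioi.1 (hA hb)) (not_lt.2 (Fin.le_last b))
    rw [this, orderedProd_empty, one_mul, ← Finset.Icc_bot]
    exact type1 _ _ bot_le
  | cast j =>
    obtain ⟨B, hB⟩ : ∃ B : Finset (Fin (k + 1)), B.map Fin.castSuccEmb = A.erase (Fin.last _) := by
      refine ⟨Finset.univ.filter fun i => i.castSucc ∈ A, ?_⟩
      ext l
      induction l using Fin.lastCases <;> simp [Fin.castSucc_ne_last]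
    have hBj : B ⊆ Finset.Ioi j := by
      intro b hb
      have h1 : b.castSucc ∈ A.erase (Fin.last _) := hB ▸ Finset.mem_map_of_mem _ hb
      have := hA (Finset.mem_of_mem_erase h1)
      simpa using this
    have hj : orderedProd x (Finset.Iic j.castSucc) = orderedProd y (Finset.Iic j) := by
      rw [← hmap]
      congr 1
      rw [← Finset.Icc_bot, ← Finset.Icc_bot, castSucc_Icc]
      rfl
    -- If the top entry occurs in the product over `A`, it comes immediately before `x 0`, and the
    -- two merge into `yL 0`. The other factors have nonzero index, where `yL` agrees with `y`.
    by_cases hl : Fin.last _ ∈ A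
    · refine .inl (.inr (.inr ⟨j, B, hBj, ?_⟩))
      have h1 : orderedProd x A = orderedProd y B * t 0 := by
        rw [← hmap, hB, ← hx, ← orderedProd_singleton x, ← orderedProd_union]
        · congr 1
          ext l
          by_cases h : l = Fin.last _ <;> simp [h, hl]
        · intro a ha b hb
          rw [Finset.mem_singleton.1 hb]
          exact Fin.lt_last_iff_ne_last.2 (Finset.ne_of_mem_erase ha)
      rw [h1, hj, orderedProd_Iic, orderedProd_Iic, hL0,
        orderedProd_congr (A := B) (x := yL) (y := y) fun a ha =>
          hL a (Fin.pos_iff_ne_zero.1 ((Fin.zero_le j).trans_lt (Finset.mem_Ioi.1 (hBj ha)))),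
        orderedProd_congr (A := Finset.Ioc 0 j) (x := yL) (y := y) fun a ha =>
          hL a (Finset.mem_Ioc.1 ha).1.ne']
      simp only [mul_assoc]
    · refine .inl (.inl (.inr (.inr ⟨j, B, hBj, ?_⟩)))
      rw [hj, ← hmap B, hB, Finset.erase_eq_of_notMem hl]

variable {κ : Type*}

lemma Rich.eq_of_mem_productPattern {c : G → κ} {a : κ} {k : ℕ} {t : Fin (k + 1) → G}
    (h : Rich c a (k + 1) t) : ∀ g ∈ productPattern fun i => t i.rev, c g = a := by
  induction k with
  | zero =>
    have hz : ∀ i j : Fin 1, i = j := Subsingleton.elim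
    rintro g (⟨i, j, -, rfl⟩ | ⟨j, A, hA, rfl⟩)
    · rw [hz j i, Finset.Icc_self, orderedProd_singleton, hz i.rev 0]
      exact h.1
    · have : A = ∅ := Finset.subset_empty.1 fun b hb =>
        absurd (hz b j) (Finset.mem_Ioi.1 (hA hb)).ne'
      rw [this, orderedProd_empty, one_mul, orderedProd_Iic]
      have : Finset.Ioc 0 j = ∅ := by rw [hz j 0, Finset.Ioc_self]
      rw [this, orderedProd_empty, mul_one]
      exact h.1
  | succ k ih =>
    intro g hg
    obtain ⟨h0, h1, h2, h3⟩ := h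
    rcases productPattern_subset t hg with ((hg | hg) | hg) | hg
    · rw [hg, h0]
    exacts [ih h1 g hg, ih h2 g hg, ih h3 g hg]

end Pattern

/-! ### From means back to the measure. -/

section Content

variable {G : Type*} [Group G]
  {μ : MeasureTheory.AddContent ℝ≥0 (Set.univ : Set (Set G))}

/-- The invariant mean of an invariant finitely additive probability measure. -/
noncomputable def invMean (hμ : IsInvariantProb μ) : InvMean G where
  toFinMean := contentMean μ hμ.univ_eq_one
  left' := contentMean_left μ hμ
  right' := contentMean_right μ hμ

/-- A function with values in the unit interval and positive mean is positive on a set of positive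
measure. The converse can fail under finite additivity, which is why positivity of means is what the
induction on lengths carries. -/
lemma many_of_tupleMean_pos (hμ : IsInvariantProb μ) {n : ℕ} {p : (Fin n → G) → Prop}
    (h : 0 < tupleMean (invMean hμ).toFinMean n fun t => ind (p t)) : Many μ n p := by
  induction n with
  | zero =>
    by_contra hn
    rw [tupleMean_zero, ind_false (p := p Fin.elim0) hn] at h
    exact lt_irrefl _ h
  | succ n ih =>
    rw [tupleMean_succ] at h
    refine (contentMean_pos μ hμ.univ_eq_one
      (fun y => FinMean.le_of_ge _ (.ind _) fun _ => ind_nonneg _)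
      (fun y => FinMean.le_of_le _ (.ind _) fun _ => ind_le_one _) h).trans_le ?_
    exact content_mono μ fun y hy => ih hy

end Content

theorem theorem1 {G : Type*} [Group G]
    (μ : MeasureTheory.AddContent ℝ≥0 (Set.univ : Set (Set G))) (hμ : IsInvariantProb μ)
    (r : ℕ) (c : G → Fin r) :
    0 < μ {y : G | 0 < μ {x : G | IsMonochromatic c {x, y, x * y, y * x}}} ∧
    ∀ k : ℕ, Many μ (k + 1) fun t : Fin (k + 1) → G =>
      IsMonochromatic c (productPattern fun i : Fin (k + 1) => t (Fin.rev i)) := by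
  have key : ∀ k : ℕ, Many μ (k + 1) fun t : Fin (k + 1) → G =>
      IsMonochromatic c (productPattern fun i : Fin (k + 1) => t (Fin.rev i)) := by
    intro k
    obtain ⟨a, ha⟩ := exists_richMean_pos (invMean hμ) c k
    refine many_of_tupleMean_pos hμ (ha.trans_le ?_)
    exact FinMean.mono _ (.ind _) (.ind _) fun t => ind_mono fun h =>
      ⟨a, h.eq_of_mem_productPattern⟩
  -- For `k = 1`, with `x₀ = x` and `x₁ = y`, the intervals give `x`, `y` and `x * y`, and `I =
  -- {1}`, `j = 0` gives `y * x`.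
  refine ⟨(key 1).trans_le (content_mono μ fun y hy => ?_), key⟩
  refine lt_of_lt_of_le (b := μ _) hy (content_mono μ fun x hx => ?_)
  obtain ⟨a, ha⟩ := hx
  refine ⟨a, fun g hg => ha g ?_⟩
  set z : Fin 2 → G := fun i => (Fin.cons y (Fin.cons x Fin.elim0 : Fin 1 → G) : Fin 2 → G) i.rev
  have h0 : z 0 = x := rfl
  have h1 : z 1 = y := rfl
  rcases hg with rfl | rfl | rfl | rfl
  · exact .inl ⟨0, 0, le_rfl, by rw [Finset.Icc_self, orderedProd_singleton, h0]⟩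
  · exact .inl ⟨1, 1, le_rfl, by rw [Finset.Icc_self, orderedProd_singleton, h1]⟩
  · refine .inl ⟨0, 1, zero_le_one, ?_⟩
    rw [show Finset.Icc (0 : Fin 2) 1 = {0} ∪ {1} from rfl, orderedProd_union _ (by simp),
      orderedProd_singleton, orderedProd_singleton, h0, h1]
  · refine .inr ⟨0, {1}, by simp, ?_⟩
    rw [show Finset.Iic (0 : Fin 2) = {0} from rfl, orderedProd_singleton, orderedProd_singleton,
      h0, h1]
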